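/- **Notation.** Work in $\mathbb R^2$; $B_r(x)$ is the open ball, $B_r=B_r(0)$, $\overline B_r(E)=\{y:\operatorname{dist}(y,E)\le r\}$ (empty if $E=\emptyset$), $f_s(x)=s^{-2}f(x/s)$, $\hat f(\xi)=\int f(x)e^{-i\xi\cdot x}\,dx$, $G(x)=(2\pi)^{-1}e^{-|x|^2/2}$. A bounded open set $\Omega$ is *Lipschitz* (resp. $C^{1,\alpha}$) *with constants $r,L$* if for every $x\in\partial\Omega$ there is $\varphi:\mathbb R\to\mathbb R$, $\varphi(0)=0$, with Lipschitz constant at most $L$ (resp. with $\|\varphi\|_{C^{1,\alpha}(\mathbb R)}=\sup|\varphi|+\sup|\varphi'|+[\varphi']_\alpha\le L$) such that, in suitable orthonormal coordinates $(y_1,y_2)$ (with basis $e_1,e_2$) centred at $x$, every $y\in B_r(x)$ satisfies $y\in\Omega\iff y_2<\varphi(y_1)$. Such coordinates with such a $\varphi$ are called a chart at $x$. $\mathcal A^{0,1}(r,L,R)$ (resp. $\mathcal A^{1,\alpha}(r,L,R)$) is the class of such sets contained in $B_R$. Given $0<\delta_1\le 1/2$ and a chart with a Lipschitz function at $x$,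 put $M_d(x)=\{|y_1|\le d r,\ y_2=\varphi(y_1)\}$ and $N_d(x)=\{|y_1|\le\delta_1 r,\ |y_2-\varphi(y_1)|\le d r\}$. Let $L>0$. *Geometric constants* for $L$ are $0<\delta_2\le\delta_1\le1/2$, $0<m_1\le1$ such that for all $r>0$, all $\Omega$ that are Lipschitz with constants $r,L$, all $x\in\partial\Omega$, all Lipschitz charts at $x$ with constants $r,L$ and all $0<d\le\delta_2$: $N_d(x)\subset B_{r/2}(x)$; $N_d(x)\subset\overline B_{dr}(\partial\Omega)$; $\overline B_{m_1dr}(M_{\delta_1/2}(x))\subset N_d(x)$; and every $y$ with $|y_1|\le\delta_1r/2$, $y_2=\varphi(y_1)\pm dr$ lies outside $\overline B_{m_1dr}(\partial\Omega)$. Put $\delta=\delta_2/4$. *Blur constants* are $R_0\ge1$, $0<\tilde h\le1/24$, $a_1>0$ with $\|\nabla G\|_{L^1(\mathbb R^2\setminus B_{R_0/2})}\le a_1/12$ such that for every $D$ that is Lipschitz with constants $R_0,L$, the function $v=\chi_D*G$ satisfies: if $\tilde h<v(x)<1-\tilde h$ then $x\in\overline B_{m_1\delta R_0}(\partial D)$;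 and for every $x\in\partial D$, every Lipschitz chart at $x$ with constants $R_0,L$ and every $y\in N_\delta(x)$, $\nabla v(y)\cdot(-e_2)\ge a_1$. For $0<\tilde\delta\le\min\{\tilde h,a_1/2\}$ consider $0<s_0\le1$, a radial $\hat T\in C_0^\infty(\mathbb R^2;\mathbb R)$ with $\hat T\equiv1$ on $B_{s_0}$ and $T=(2\pi)^{-2}\hat{\hat T}\in W^{2,1}(\mathbb R^2)$ with $\|T-G\|_{W^{1,1}}\le\tilde\delta$. For $0<s\le1/s_0$ and $0<\sigma\le s$ let $$I_{s,\sigma}(u)(x)=\int\!\!\int u(\xi)\,T_{ss_0}(x-\xi)\,J(\xi-\eta)\,T_{ss_0}(x-\eta)\,u(\eta)\,d\xi\,d\eta,\qquad J(x)=\frac{2J_1(\sigma|x|/s)}{\sigma|x|/s},\quad J(0)=1,$$ with $J_1$ the Bessel function of order $1$, and $\Omega(u)=\{I_{s,\sigma}(u)>h\}$. With $\mathcal A=\mathcal A^{0,1}(r,L,R)$, let $\mathcal A_\gamma$ be the set of $u\in L^1(\mathbb R^2)$ with $u=0$ a.e. outside $B_R$, $0\le u\le1$ a.e., and $\|u-\chi_D\|_{L^1(B_R)}\le\gamma$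 for some $D\in\mathcal A$. On $BV(B_\rho)$ put $d_{st}(f,g)=\|f-g\|_{L^1(B_\rho)}+\bigl||Df|(B_\rho)-|Dg|(B_\rho)\bigr|$. **Theorem.** Let $L>0$. Geometric constants $\delta_1,\delta_2,m_1$ for $L$ exist, and for any choice of them (with $\delta=\delta_2/4$) blur constants $R_0,\tilde h,a_1$ exist. Fix any such constants, as functions of $L$ only. Then there is $\tilde R_0$ with $0<\tilde R_0\le\delta_1R_0/8$, depending only on these constants (hence only on $L$), with the following property. Let $R\ge10R_0$, $p>4$, $\alpha=1-4/p$, and let $\tilde\delta,s_0,\hat T,T$ be as above and $0<s\le1/s_0$. There are constants $0<\tilde\sigma_0\le1$, $\gamma_0>0$ and $L_1\ge L$, depending only on $L$, $R$, $p$, $\|D^2(T-G)\|_{L^1(\mathbb R^2)}$ and $ss_0$, such that for all $1/3\le h\le2/3$, $0<\sigma\le\tilde\sigma_0s$ and $0<\gamma\le\gamma_0$, with $r=ss_0R_0$, $\tilde R=R+2m_1\delta R_0$ and $r_1=ss_0\tilde R_0\le r$: 1. for every $u\in\mathcal A_\gamma$, $\Omega(u)\Subset B_{\tilde R}$ and $\Omega(u)\in\mathcal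 A^{1,\alpha}(r_1,L_1,\tilde R)$; 2. for every $u\in\mathcal A_\gamma$, $\chi_{\Omega(u)}\in BV(B_{\tilde R})$, and the map $u\mapsto\chi_{\Omega(u)}$ is uniformly continuous from $\mathcal A_\gamma$ with the $L^1(B_R)$ norm to $BV(B_{\tilde R})$ with the distance $d_{st}$. -/

import Mathlib

open Set Filter Topology MeasureTheory

noncomputable section

namespace Litho

/-- The Euclidean plane. -/
abbrev Plane : Type := EuclideanSpace ℝ (Fin 2)

/-- The characteristic function of a set. -/
def chi (S : Set Plane) : Plane → ℝ := S.indicator (fun _ => (1 : ℝ))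

/-! ### Domains with Lipschitz and Hölder boundary -/

/-- `e` and `φ` describe `Ω` as a subgraph in the ball of radius `r` about `x`. The rigid motion
`y ↦ e (y - x)` gives the local coordinates `(y₁, y₂)`, in which `x` is the origin, `φ 0 = 0`, and
`y ∈ Ω` if and only if `y₂ < φ y₁`. -/
def IsGraphChart (Ω : Set Plane) (r : ℝ) (x : Plane) (e : Plane ≃ₗᵢ[ℝ] Plane) (φ : ℝ → ℝ) : Prop :=
  φ 0 = 0 ∧ ∀ y ∈ Metric.ball x r, (y ∈ Ω ↔ e (y - x) 1 < φ (e (y - x) 0))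

/-- `φ` is Lipschitz on the line with constant `L`. -/
def IsLip (L : ℝ) (φ : ℝ → ℝ) : Prop := ∀ a b : ℝ, |φ a - φ b| ≤ L * |a - b|

/-- `φ` is of class `C^{1,α}` on the line and its norm
`sup |φ| + sup |φ'| + sup |φ' a - φ' b| / |a - b| ^ α` is at most `L`. -/
def HolderOneNormLE (α L : ℝ) (φ : ℝ → ℝ) : Prop :=
  ContDiff ℝ 1 φ ∧ ∃ A B C : ℝ, A + B + C ≤ L ∧ (∀ a, |φ a| ≤ A) ∧ (∀ a, |deriv φ a| ≤ B) ∧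
    ∀ a b : ℝ, |deriv φ a - deriv φ b| ≤ C * |a - b| ^ α

/-- Bounded open sets that are Lipschitz with constants `r` and `L`. -/
def IsLipschitzDomain (r L : ℝ) (Ω : Set Plane) : Prop :=
  Bornology.IsBounded Ω ∧ IsOpen Ω ∧
    ∀ x ∈ frontier Ω, ∃ (e : Plane ≃ₗᵢ[ℝ] Plane) (φ : ℝ → ℝ), IsLip L φ ∧ IsGraphChart Ω r x e φ

/-- Bounded open sets that are `C^{1,α}` with constants `r` and `L`. -/
def IsHolderOneDomain (α r L : ℝ) (Ω : Set Plane) : Prop :=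
  Bornology.IsBounded Ω ∧ IsOpen Ω ∧
    ∀ x ∈ frontier Ω, ∃ (e : Plane ≃ₗᵢ[ℝ] Plane) (φ : ℝ → ℝ),
      HolderOneNormLE α L φ ∧ IsGraphChart Ω r x e φ

/-- The class `𝒜^{0,1}(r, L, R)`. -/
def LipClass (r L R : ℝ) : Set (Set Plane) :=
  {Ω | IsLipschitzDomain r L Ω ∧ Ω ⊆ Metric.ball 0 R}

/-- The class `𝒜^{1,α}(r, L, R)`. -/
def HolderOneClass (α r L R : ℝ) : Set (Set Plane) :=
  {Ω | IsHolderOneDomain α r L Ω ∧ Ω ⊆ Metric.ball 0 R}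

/-- The piece `M_d(x)` of the graph: `|y₁| ≤ d r`, `y₂ = φ y₁` in the local coordinates. -/
def graphPiece (r : ℝ) (x : Plane) (e : Plane ≃ₗᵢ[ℝ] Plane) (φ : ℝ → ℝ) (d : ℝ) : Set Plane :=
  {y | |e (y - x) 0| ≤ d * r ∧ e (y - x) 1 = φ (e (y - x) 0)}

/-- The strip `N_d(x)` about the graph: `|y₁| ≤ δ₁ r`, `φ y₁ - d r ≤ y₂ ≤ φ y₁ + d r`. -/
def graphStrip (δ₁ r : ℝ) (x : Plane) (e : Plane ≃ₗᵢ[ℝ] Plane) (φ : ℝ → ℝ) (d : ℝ) : Set Plane :=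
  {y | |e (y - x) 0| ≤ δ₁ * r ∧
    φ (e (y - x) 0) - d * r ≤ e (y - x) 1 ∧ e (y - x) 1 ≤ φ (e (y - x) 0) + d * r}

/-- The requirements on the geometric constants `δ₁`, `δ₂`, `m₁` attached to `L`: they are
uniform in the scale `r`, the domain, the boundary point, and the chart. -/
structure IsGeomConst (L δ₁ δ₂ m₁ : ℝ) : Prop where
  δ₁_pos : 0 < δ₁
  δ₁_le : δ₁ ≤ 1 / 2
  δ₂_pos : 0 < δ₂
  δ₂_le : δ₂ ≤ δ₁
  m₁_pos : 0 < m₁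
  m₁_le : m₁ ≤ 1
  strips : ∀ (r : ℝ) (Ω : Set Plane) (x : Plane) (e : Plane ≃ₗᵢ[ℝ] Plane) (φ : ℝ → ℝ) (d : ℝ),
    0 < r → IsLipschitzDomain r L Ω → x ∈ frontier Ω → IsLip L φ → IsGraphChart Ω r x e φ →
    0 < d → d ≤ δ₂ →
      graphStrip δ₁ r x e φ d ⊆ Metric.ball x (r / 2) ∧
      graphStrip δ₁ r x e φ d ⊆ Metric.cthickening (d * r) (frontier Ω) ∧
      Metric.cthickening (m₁ * d * r) (graphPiece r x e φ (δ₁ / 2)) ⊆ graphStrip δ₁ r x e φ d ∧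
      ∀ y : Plane, |e (y - x) 0| ≤ δ₁ * r / 2 →
        (e (y - x) 1 = φ (e (y - x) 0) + d * r ∨ e (y - x) 1 = φ (e (y - x) 0) - d * r) →
        y ∉ Metric.cthickening (m₁ * d * r) (frontier Ω)

/-! ### The Gaussian -/

/-- `G(x) = (2π)⁻¹ exp(-|x|²/2)`. -/
def gauss (x : Plane) : ℝ := (2 * Real.pi)⁻¹ * Real.exp (-‖x‖ ^ 2 / 2)

/-- The convolution `χ_D ∗ G`. -/
def gaussBlur (D : Set Plane) (x : Plane) : ℝ := ∫ y, chi D y * gauss (x - y)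

/-- The requirements on the constants `R₀`, `h̃`, `a₁` attached to `L`, `δ₁`, `m₁` and `δ`: with
`v = χ_D ∗ G`, the transition layer of `v` lies near `∂D`, where `v` has a definite slope in the
direction `-e₂` of every chart, and the tail of `∇G` beyond `R₀ / 2` is small. -/
structure IsBlurConst (L δ₁ m₁ δ R₀ hTil a₁ : ℝ) : Prop where
  one_le_R₀ : 1 ≤ R₀
  hTil_pos : 0 < hTil
  hTil_le : hTil ≤ 1 / 24
  a₁_pos : 0 < a₁
  layer : ∀ (D : Set Plane) (x : Plane), IsLipschitzDomain R₀ L D →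
    hTil < gaussBlur D x → gaussBlur D x < 1 - hTil →
      x ∈ Metric.cthickening (m₁ * δ * R₀) (frontier D)
  slope : ∀ (D : Set Plane) (x : Plane) (e : Plane ≃ₗᵢ[ℝ] Plane) (φ : ℝ → ℝ) (y : Plane),
    IsLipschitzDomain R₀ L D → x ∈ frontier D → IsLip L φ → IsGraphChart D R₀ x e φ →
      y ∈ graphStrip δ₁ R₀ x e φ δ →
        a₁ ≤ fderiv ℝ (gaussBlur D) y (-(e.symm (EuclideanSpace.single 1 1)))
  tail : ∫ x in (Metric.ball (0 : Plane) (R₀ / 2))ᶜ, ‖fderiv ℝ gauss x‖ ≤ a₁ / 12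

/-! ### The optical system -/

/-- The Fourier transform with the convention `f̂(x) = ∫ f(ξ) exp(-i x·ξ) dξ`. -/
def fourierT (f : Plane → ℝ) (x : Plane) : ℂ :=
  ∫ ξ, (f ξ : ℂ) * Complex.exp (-Complex.I * (inner ℝ x ξ : ℝ))

/-- The `W^{1,1}` norm of a continuously differentiable function. -/
def normW11 (f : Plane → ℝ) : ℝ := (∫ x, |f x|) + ∫ x, ‖fderiv ℝ f x‖

/-- The `L¹` norm of the second derivative of a twice continuously differentiable function. -/
def normD2 (f : Plane → ℝ) : ℝ := ∫ x, ‖iteratedFDeriv ℝ 2 f x‖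

/-- `THat` is a radial function in `C_c^∞` with `THat ≡ 1` on `B_{s₀}`, `0 < s₀ ≤ 1`, and `T` is
its inverse Fourier transform, `T = (2π)⁻² (THat)^`. Moreover `T ∈ W^{2,1}` and
`‖T - G‖_{W^{1,1}} ≤ δTil`. Here `T` is smooth, so that its weak derivatives are the
classical ones. -/
structure IsPointSpread (δTil s₀ : ℝ) (THat T : Plane → ℝ) : Prop where
  s₀_pos : 0 < s₀
  s₀_le : s₀ ≤ 1
  smooth : ContDiff ℝ (⊤ : ℕ∞) THat
  compactSupport : HasCompactSupport THat
  radial : ∀ x y : Plane, ‖x‖ = ‖y‖ → THat x = THat y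
  eq_one : ∀ x ∈ Metric.ball (0 : Plane) s₀, THat x = 1
  inversion : ∀ x : Plane, (T x : ℂ) = ((2 * Real.pi : ℝ) : ℂ)⁻¹ ^ 2 * fourierT THat x
  memW21 : Integrable T ∧ Integrable (fderiv ℝ T) ∧ Integrable (iteratedFDeriv ℝ 2 T)
  close : normW11 (fun x => T x - gauss x) ≤ δTil

/-- The rescaling `f_s(x) = s⁻² f(x / s)`. -/
def rescale (s : ℝ) (f : Plane → ℝ) (x : Plane) : ℝ := (s ^ 2)⁻¹ * f (s⁻¹ • x)

/-- The Bessel function `J₁` (of the first kind, of order one). -/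
def besselJOne (t : ℝ) : ℝ :=
  ∑' m : ℕ, (-1 : ℝ) ^ m / ((m.factorial : ℝ) * ((m + 1).factorial : ℝ)) * (t / 2) ^ (2 * m + 1)

/-- The mutual intensity `J(x) = 2 J₁(κ|x|) / (κ|x|)` with `κ = σ / s`, and its
continuous value `1` at the origin. -/
def mutualIntensity (s σ : ℝ) (x : Plane) : ℝ :=
  if x = 0 then 1 else 2 * besselJOne (σ / s * ‖x‖) / (σ / s * ‖x‖)

/-- The image intensity `I_{s,σ}(u)(x) = ∫∫ u(ξ) K(x-ξ) J(ξ-η) K(x-η) u(η) dξ dη`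
with the coherent point spread function `K = T_{s s₀}`. -/
def intensity (T : Plane → ℝ) (s₀ s σ : ℝ) (u : Plane → ℝ) (x : Plane) : ℝ :=
  ∫ ξ, ∫ η, u ξ * rescale (s * s₀) T (x - ξ) * mutualIntensity s σ (ξ - η) *
    rescale (s * s₀) T (x - η) * u η

/-- The exposed set `Ω(u) = {I_{s,σ}(u) > h}`. -/
def exposedSet (T : Plane → ℝ) (s₀ s σ h : ℝ) (u : Plane → ℝ) : Set Plane :=
  {x | h < intensity T s₀ s σ u x}

/-! ### Masks -/

/-- The class `A` of functions `u ∈ L¹(B_R)` (extended by zero) with `0 ≤ u ≤ 1`. -/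
def unitMasks (R : ℝ) : Set (Plane → ℝ) :=
  {u | Integrable u ∧ (∀ᵐ x, x ∉ Metric.ball (0 : Plane) R → u x = 0) ∧
    ∀ᵐ x, x ∈ Metric.ball (0 : Plane) R → 0 ≤ u x ∧ u x ≤ 1}

/-- The `L¹(D)` distance. -/
def distL1 (D : Set Plane) (f g : Plane → ℝ) : ℝ := ∫ x in D, |f x - g x|

/-- The neighbourhood `𝒜_γ` in `A` of the class `𝒜^{0,1}(r, L, R)`. -/
def nearMasks (r L R γ : ℝ) : Set (Plane → ℝ) :=
  {u | u ∈ unitMasks R ∧ ∃ D ∈ LipClass r L R, distL1 (Metric.ball 0 R) u (chi D) ≤ γ}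

/-! ### Functions of bounded variation -/

/-- The divergence of a vector field. -/
def diverg (X : Plane → Plane) (x : Plane) : ℝ :=
  ∑ i : Fin 2, fderiv ℝ X x (EuclideanSpace.single i 1) i

/-- The total variation `|Df|(D) = sup {∫_D f div X : X ∈ C_c^1(D; ℝ²), |X| ≤ 1}`. -/
def totalVar (f : Plane → ℝ) (D : Set Plane) : ENNReal :=
  ⨆ (X : Plane → Plane) (_ : ContDiff ℝ 1 X ∧ HasCompactSupport X ∧ tsupport X ⊆ D ∧
    ∀ x, ‖X x‖ ≤ 1), ENNReal.ofReal (∫ x in D, f x * diverg X x)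

/-- Membership in `BV(D)`. -/
def IsBV (f : Plane → ℝ) (D : Set Plane) : Prop := IntegrableOn f D ∧ totalVar f D < ⊤

/-- The distance `d_st` of strict convergence on `BV(D)`. -/
def distStrict (D : Set Plane) (f g : Plane → ℝ) : ℝ :=
  distL1 D f g + |(totalVar f D).toReal - (totalVar g D).toReal|

end Litho

end

open Litho

namespace Litho

set_option maxSynthPendingDepth 3

/-! ### Coordinates -/

/-! Rescale by t = s s₀. Then I(u)(x) = F(x/t), where F(x) is the double integral of w(ξ) w(η)
J(t(ξ-η)) T(x-ξ) T(x-η) and w(x) = u(tx) (`intensity_eq_pairSmear`). Three approximations simplify F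
in C¹. For small σ/s the factor J is close to 1 on the support, so F is close to f² with f = w ∗ T
(`pairSmear_prod`, `abs_pairSmear_sub_sq_le`, `norm_fderiv_pairSmear_sub_le`). If u is close to χ_D
in L¹, then w can be replaced by the indicator of D/t, since a Lipschitz function with small L¹ norm
is small (`exists_smear_small`). Finally T is close to G in W^{1,1}. So f is close to the Gaussian
blur v of D/t, which is Lipschitz with constants R₀, L.

Where F is near h ∈ [1/3, 2/3], f is at least 11/20 and v lies in its transition layer, so the blur
constants give v a slope at least a₁ in a chart direction. The errors leave F a slope at least a₁/8
on a disc of fixed radius (`IsNearSquare.hasSlope`). The implicit function theorem with explicit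
bounds turns this slope into C^{1,α} charts (`exists_holder_chart`). Their radius cρ/(8C) involves
only slope, gradient bound and disc radius, hence only a₁ and the Gaussian, and it scales by t;
second derivatives do not enter it.

For strict continuity no coarea formula is needed. The field X = -β(F) ∇F/|∇F|, with β a cutoff near
the level h, is a calibration: the perimeter of {F > h} equals the integral of div X over that set
(`IsCalibration.totalVar_eq`), and |div X| is bounded uniformly in u. Testing one set with the field
of the other bounds the difference of the perimeters by the L¹ distance
(`IsCalibration.totalVar_sub_le`). That distance is at most the area of {|F - h| ≤ η} when the
functions differ by at most η, and integration by parts against X shows that this area is O(η)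
(`IsCalibration.volume_layer_le`). -/

lemma abs_coord_le (v : Plane) (i : Fin 2) : |v i| ≤ ‖v‖ := by
  simpa using PiLp.norm_apply_le v i

lemma norm_le_abs_add_abs (v : Plane) : ‖v‖ ≤ |v 0| + |v 1| := by
  rw [EuclideanSpace.norm_eq, Real.sqrt_le_left (by positivity)]
  simp only [Fin.sum_univ_two, Real.norm_eq_abs]
  nlinarith [abs_nonneg (v 0), abs_nonneg (v 1)]

lemma norm_sq_eq_coords (v : Plane) : ‖v‖ ^ 2 = v 0 ^ 2 + v 1 ^ 2 := by
  simp [EuclideanSpace.norm_sq_eq, Fin.sum_univ_two]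

lemma IsLip.nonneg {L : ℝ} {φ : ℝ → ℝ} (h : IsLip L φ) : 0 ≤ L := by
  simpa using (abs_nonneg _).trans (h 1 0)

lemma IsLip.continuous {L : ℝ} {φ : ℝ → ℝ} (h : IsLip L φ) : Continuous φ := by
  have : LipschitzWith (Real.toNNReal L) φ := LipschitzWith.of_dist_le_mul fun a b => by
    simpa [Real.dist_eq, Real.coe_toNNReal _ h.nonneg] using h a b
  exact this.continuous

lemma continuous_coord (e : Plane ≃ₗᵢ[ℝ] Plane) (x : Plane) (i : Fin 2) :
    Continuous fun y : Plane => e (y - x) i := by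
  have : Continuous fun y : Plane => e (y - x) := e.continuous.comp (by fun_prop)
  fun_prop

/-! ### The boundary in a chart -/

/-- Off the graph one of the two strict inequalities persists nearby. A point of the graph is not in
`Ω`, and it is a limit of the points of `Ω` directly below it. -/
lemma IsGraphChart.mem_frontier_iff {Ω : Set Plane} {r : ℝ} {x : Plane}
    {e : Plane ≃ₗᵢ[ℝ] Plane} {φ : ℝ → ℝ} (h : IsGraphChart Ω r x e φ) (hφ : Continuous φ)
    {y : Plane} (hy : y ∈ Metric.ball x r) :
    y ∈ frontier Ω ↔ e (y - x) 1 = φ (e (y - x) 0) := by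
  have hc0 := continuous_coord e x 0
  have hc1 := continuous_coord e x 1
  have hball := Metric.isOpen_ball.mem_nhds hy
  constructor
  · intro hf
    rcases lt_trichotomy (e (y - x) 1) (φ (e (y - x) 0)) with hlt | heq | hgt
    · exfalso
      have hn : {z : Plane | e (z - x) 1 < φ (e (z - x) 0)} ∈ 𝓝 y :=
        (isOpen_lt hc1 (hφ.comp hc0)).mem_nhds hlt
      refine hf.2 (mem_interior_iff_mem_nhds.2 ?_)
      filter_upwards [hn, hball] with z hz hz'
      exact (h.2 z hz').2 hz
    · exact heq
    · exfalso
      have hn : {z : Plane | φ (e (z - x) 0) < e (z - x) 1} ∈ 𝓝 y :=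
        (isOpen_lt (hφ.comp hc0) hc1).mem_nhds hgt
      obtain ⟨z, hz, hzΩ⟩ := mem_closure_iff_nhds.1 hf.1 _ (inter_mem hn hball)
      exact absurd ((h.2 z hz.2).1 hzΩ) (not_lt.2 (le_of_lt hz.1))
  · intro heq
    refine ⟨?_, fun hi => ?_⟩
    · set n : Plane := e.symm (EuclideanSpace.single 1 1)
      have ht : Tendsto (fun τ : ℝ => y - τ • n) (𝓝[>] 0) (𝓝 y) := by
        have : Continuous fun τ : ℝ => y - τ • n := by fun_prop
        simpa using (this.tendsto 0).mono_left nhdsWithin_le_nhds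
      refine mem_closure_of_tendsto ht ?_
      filter_upwards [ht hball, self_mem_nhdsWithin] with τ hτ hτ0
      refine (h.2 _ hτ).2 ?_
      have : e (y - τ • n - x) = e (y - x) - τ • EuclideanSpace.single 1 1 := by
        rw [show y - τ • n - x = (y - x) - τ • n by abel, map_sub, map_smul]; simp [n]
      rw [this]
      have hτ0' : 0 < τ := hτ0
      simpa [-map_sub, heq] using hτ0'
    · exact absurd ((h.2 y hy).1 (interior_subset hi)) (by rw [heq]; exact lt_irrefl _)

lemma graphStrip_subset_ball {L δ₁ r : ℝ} {x : Plane} {e : Plane ≃ₗᵢ[ℝ] Plane} {φ : ℝ → ℝ}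
    {d : ℝ} (hφ : IsLip L φ) (h0 : φ 0 = 0) (hr : 0 < r) (hd : δ₁ * (1 + L) + d < 1 / 2) :
    graphStrip δ₁ r x e φ d ⊆ Metric.ball x (r / 2) := by
  rintro y ⟨h1, h2, h3⟩
  rw [Metric.mem_ball, dist_eq_norm, ← e.norm_map]
  have hL := hφ.nonneg
  have hφ1 := hφ (e (y - x) 0) 0
  rw [h0, sub_zero, sub_zero] at hφ1
  have h5 : |e (y - x) 1| ≤ L * (δ₁ * r) + d * r := by
    have := hφ1.trans (mul_le_mul_of_nonneg_left h1 hL)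
    rw [abs_le] at this ⊢
    constructor <;> linarith
  have := norm_le_abs_add_abs (e (y - x))
  nlinarith

/-- The function y₂ - φ(y₁) vanishes on the graph and has Lipschitz constant 1 + L. This suggests
m₁(1 + L) = 1/4: within distance 2m₁dr of the graph it is at most dr/2, which is inside the strip
and away from its upper and lower edges. -/
lemma exists_isGeomConst {L : ℝ} (hL : 0 < L) : ∃ δ₁ δ₂ m₁ : ℝ, IsGeomConst L δ₁ δ₂ m₁ := by
  have hL1 : 0 < 1 + L := by positivity
  refine ⟨1 / (8 * (1 + L)), 1 / (8 * (1 + L)), 1 / (4 * (1 + L)), by positivity, ?_,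
    by positivity, le_rfl, by positivity, ?_, ?_⟩
  · rw [div_le_div_iff₀ (by positivity) (by positivity)]; linarith
  · rw [div_le_one (by positivity)]; linarith
  intro r Ω x e φ d hr hΩ hx hφ hch hd hd'
  set δ : ℝ := 1 / (8 * (1 + L)) with hδ
  have hδL : δ * (1 + L) = 1 / 8 := by rw [hδ]; field_simp
  have hδpos : 0 < δ := by positivity
  have hδ8 : δ ≤ 1 / 8 := by nlinarith
  set m : ℝ := 1 / (4 * (1 + L)) with hm
  have hmL : m * (1 + L) = 1 / 4 := by rw [hm]; field_simp
  have hmpos : 0 < m := by positivity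
  have hm4 : m ≤ 1 / 4 := by nlinarith
  have hdr : 0 < d * r := by positivity
  have hball : ∀ y : Plane, y ∈ graphStrip δ r x e φ d → y ∈ Metric.ball x (r / 2) :=
    graphStrip_subset_ball hφ hch.1 hr (by linarith)
  have hlt : m * d * r < 2 * (m * d * r) := by nlinarith [mul_pos (mul_pos hmpos hd) hr]
  have hmdr : 2 * (m * d * r) * (1 + L) = d * r / 2 := by linear_combination (2 * d * r) * hmL
  have hlt' : (0 : ℝ) < 2 * (m * d * r) := by positivity
  have hsmall : 2 * (m * d * r) ≤ d * r / 2 := by nlinarith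
  -- The closed thickening is enlarged to the open one of twice the radius, which supplies an actual
  -- nearby point `z`; hence the factor 2.
  have key : ∀ y z : Plane, dist y z < 2 * (m * d * r) → e (z - x) 1 = φ (e (z - x) 0) →
      |e (y - x) 0 - e (z - x) 0| ≤ 2 * (m * d * r) ∧
        |e (y - x) 1 - φ (e (y - x) 0)| ≤ d * r / 2 := by
    intro y z hyz hz
    have hd : ‖e (y - x) - e (z - x)‖ < 2 * (m * d * r) := by
      rw [← map_sub, e.norm_map]
      simpa [dist_eq_norm] using hyz
    have h0 := (abs_coord_le (e (y - x) - e (z - x)) 0).trans hd.le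
    have h1 := (abs_coord_le (e (y - x) - e (z - x)) 1).trans hd.le
    rw [PiLp.sub_apply] at h0 h1
    refine ⟨h0, ?_⟩
    have h2 := (hφ (e (y - x) 0) (e (z - x) 0)).trans (mul_le_mul_of_nonneg_left h0 hL.le)
    rw [hz] at h1
    rw [abs_le] at h1 h2 ⊢
    constructor <;> nlinarith
  refine ⟨hball, ?_, ?_, ?_⟩
  · intro y hy
    -- The vertical projection of `y` to the graph.
    set z : Plane := x + e.symm !₂[e (y - x) 0, φ (e (y - x) 0)] with hz
    have hez : e (z - x) = !₂[e (y - x) 0, φ (e (y - x) 0)] := by simp [hz]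
    have hzs : z ∈ graphStrip δ r x e φ d := by
      refine ⟨?_, ?_, ?_⟩ <;> rw [hez] <;> simp [-map_sub]
      · exact hy.1
      · positivity
      · positivity
    have hzf : z ∈ frontier Ω := by
      rw [hch.mem_frontier_iff hφ.continuous (Metric.ball_subset_ball (by linarith) (hball z hzs)),
        hez]
      simp
    refine Metric.mem_cthickening_of_dist_le y z _ _ hzf ?_
    rw [dist_eq_norm, ← e.norm_map, show y - z = (y - x) - (z - x) by abel, map_sub, hez]
    refine (norm_le_abs_add_abs _).trans ?_
    simp only [PiLp.sub_apply]
    simp only [Matrix.cons_val_zero, Matrix.cons_val_one, sub_self, abs_zero,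
      zero_add]
    rw [abs_le]
    constructor <;> linarith [hy.2.1, hy.2.2]
  · intro y hy
    obtain ⟨z, hz, hyz⟩ := Metric.mem_thickening_iff.1
      (Metric.cthickening_subset_thickening' hlt' hlt _ hy)
    obtain ⟨h0, h1⟩ := key y z hyz hz.2
    have hz0 := hz.1
    refine ⟨?_, ?_, ?_⟩
    · rw [abs_le] at h0 hz0 ⊢
      have : d * r ≤ δ * r := by gcongr
      constructor <;> linarith
    · rw [abs_le] at h1; linarith
    · rw [abs_le] at h1; linarith
  · intro y hy0 hy1 hy
    obtain ⟨z, hz, hyz⟩ := Metric.mem_thickening_iff.1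
      (Metric.cthickening_subset_thickening' hlt' hlt _ hy)
    have hys : y ∈ graphStrip δ r x e φ d := by
      refine ⟨hy0.trans ?_, ?_, ?_⟩
      · nlinarith [mul_pos hδpos hr]
      · rcases hy1 with h | h <;> linarith
      · rcases hy1 with h | h <;> linarith
    -- The chart describes the boundary only in this ball, so the boundary point near `y` has to be
    -- located there first.
    have hzb : z ∈ Metric.ball x r := by
      have h1 := hball y hys
      rw [Metric.mem_ball] at h1 ⊢
      have h2 := dist_triangle z y x
      rw [dist_comm z y] at h2
      have : d * r ≤ 1 / 8 * r := by gcongr; linarith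
      linarith
    have hzg := (hch.mem_frontier_iff hφ.continuous hzb).1 hz
    obtain ⟨-, h1⟩ := key y z hyz hzg
    rw [abs_le] at h1
    rcases hy1 with h | h <;> rw [h] at h1 <;> linarith

/-! ### Differentiation of superpositions -/

section Superposition

variable {Z : Type*} [MeasurableSpace Z] {μ : Measure Z}
  {V : Type*} [NormedAddCommGroup V] [NormedSpace ℝ V]

lemma integrable_smul_of_bound {a : Z → ℝ} (ha : Integrable a μ) {f : Z → V} {B : ℝ}
    (hm : AEStronglyMeasurable f μ) (hb : ∀ z, ‖f z‖ ≤ B) : Integrable (fun z => a z • f z) μ :=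
  ha.smul_bdd B hm (Eventually.of_forall hb)

lemma hasFDerivAt_integral_smul {a : Z → ℝ} (ha : Integrable a μ) {Φ : Plane → Z → V}
    {Φ' : Plane → Z → Plane →L[ℝ] V} {B B' : ℝ} (hm : ∀ x, AEStronglyMeasurable (Φ x) μ)
    (hm' : ∀ x, AEStronglyMeasurable (Φ' x) μ) (hb : ∀ x z, ‖Φ x z‖ ≤ B)
    (hb' : ∀ x z, ‖Φ' x z‖ ≤ B') (hd : ∀ x z, HasFDerivAt (fun y => Φ y z) (Φ' x z) x)
    (x : Plane) :
    HasFDerivAt (fun x => ∫ z, a z • Φ x z ∂μ) (∫ z, a z • Φ' x z ∂μ) x := by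
  refine hasFDerivAt_integral_of_dominated_of_fderiv_le (𝕜 := ℝ) (bound := fun z => |a z| * B')
    (F' := fun x z => a z • Φ' x z) (s := univ) univ_mem
    (Eventually.of_forall fun y => ha.aestronglyMeasurable.smul (hm y))
    (integrable_smul_of_bound ha (hm x) (hb x)) (ha.aestronglyMeasurable.smul (hm' x)) ?_
    (ha.norm.mul_const B') ?_
  · refine Eventually.of_forall fun z y _ => ?_
    rw [norm_smul, Real.norm_eq_abs]
    exact mul_le_mul_of_nonneg_left (hb' y z) (abs_nonneg _)
  · exact Eventually.of_forall fun z y _ => (hd y z).const_smul (a z)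

lemma continuous_integral_smul {a : Z → ℝ} (ha : Integrable a μ) {Φ : Plane → Z → V}
    {B : ℝ} (hm : ∀ x, AEStronglyMeasurable (Φ x) μ) (hb : ∀ x z, ‖Φ x z‖ ≤ B)
    (hc : ∀ z, Continuous fun y => Φ y z) : Continuous fun x => ∫ z, a z • Φ x z ∂μ := by
  refine continuous_of_dominated (bound := fun z => |a z| * B)
    (fun x => ha.aestronglyMeasurable.smul (hm x)) ?_ (ha.norm.mul_const B) ?_
  · refine fun y => Eventually.of_forall fun z => ?_
    rw [norm_smul, Real.norm_eq_abs]
    exact mul_le_mul_of_nonneg_left (hb y z) (abs_nonneg _)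
  · exact Eventually.of_forall fun z => (hc z).const_smul (a z)

end Superposition

/-! ### Kernels -/

/-- Twice continuously differentiable kernels in `W^{2,1} ∩ W^{2,∞}`. -/
structure IsKernel (K : Plane → ℝ) : Prop where
  contDiff : ContDiff ℝ 2 K
  bounded : ∃ B : ℝ, ∀ x, ‖K x‖ ≤ B ∧ ‖fderiv ℝ K x‖ ≤ B ∧ ‖fderiv ℝ (fderiv ℝ K) x‖ ≤ B
  integrable : Integrable K
  integrable_fderiv : Integrable (fderiv ℝ K)
  integrable_fderiv_fderiv : Integrable (fderiv ℝ (fderiv ℝ K))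

namespace IsKernel

variable {K K' : Plane → ℝ}

lemma contDiff_fderiv (h : IsKernel K) : ContDiff ℝ 1 (fderiv ℝ K) :=
  h.contDiff.fderiv_right (by norm_num)

lemma differentiable (h : IsKernel K) : Differentiable ℝ K :=
  h.contDiff.differentiable (by norm_num)

lemma differentiable_fderiv (h : IsKernel K) : Differentiable ℝ (fderiv ℝ K) :=
  h.contDiff_fderiv.differentiable (by norm_num)

lemma continuous (h : IsKernel K) : Continuous K := h.contDiff.continuous

lemma continuous_fderiv (h : IsKernel K) : Continuous (fderiv ℝ K) := h.contDiff_fderiv.continuous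

lemma continuous_fderiv_fderiv (h : IsKernel K) : Continuous (fderiv ℝ (fderiv ℝ K)) :=
  h.contDiff_fderiv.continuous_fderiv (by norm_num)

lemma fderiv_sub (h : IsKernel K) (h' : IsKernel K') :
    fderiv ℝ (fun x => K x - K' x) = fun x => fderiv ℝ K x - fderiv ℝ K' x :=
  funext fun x => _root_.fderiv_fun_sub (h.differentiable x) (h'.differentiable x)

lemma fderiv_fderiv_sub (h : IsKernel K) (h' : IsKernel K') :
    fderiv ℝ (fderiv ℝ (fun x => K x - K' x)) =
      fun x => fderiv ℝ (fderiv ℝ K) x - fderiv ℝ (fderiv ℝ K') x := by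
  rw [h.fderiv_sub h']
  exact funext fun x =>
    _root_.fderiv_fun_sub (h.differentiable_fderiv x) (h'.differentiable_fderiv x)

lemma sub (h : IsKernel K) (h' : IsKernel K') : IsKernel fun x => K x - K' x where
  contDiff := h.contDiff.sub h'.contDiff
  bounded := by
    obtain ⟨B, hB⟩ := h.bounded
    obtain ⟨B', hB'⟩ := h'.bounded
    refine ⟨B + B', fun x => ⟨?_, ?_, ?_⟩⟩
    · exact (norm_sub_le _ _).trans (add_le_add (hB x).1 (hB' x).1)
    · rw [h.fderiv_sub h']; exact (norm_sub_le _ _).trans (add_le_add (hB x).2.1 (hB' x).2.1)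
    · rw [h.fderiv_fderiv_sub h']; exact (norm_sub_le _ _).trans (add_le_add (hB x).2.2 (hB' x).2.2)
  integrable := h.integrable.sub h'.integrable
  integrable_fderiv := by
    rw [h.fderiv_sub h']; exact h.integrable_fderiv.sub h'.integrable_fderiv
  integrable_fderiv_fderiv := by
    rw [h.fderiv_fderiv_sub h']; exact h.integrable_fderiv_fderiv.sub h'.integrable_fderiv_fderiv

end IsKernel

/-! ### Convolution with bounded weights of bounded support -/

/-- The convolution `w ∗ K`. -/
noncomputable def smear {V : Type} [NormedAddCommGroup V] [NormedSpace ℝ V] (K : Plane → V)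
    (w : Plane → ℝ) (x : Plane) : V := ∫ z, w z • K (x - z)

/-- Measurable functions with values in `[-1, 1]` that vanish off a bounded set. -/
structure IsWeight (w : Plane → ℝ) : Prop where
  measurable : Measurable w
  abs_le : ∀ x, |w x| ≤ 1
  support : ∃ ρ : ℝ, ∀ x ∉ Metric.ball (0 : Plane) ρ, w x = 0

lemma integrable_of_support_ball {w : Plane → ℝ} (hm : AEStronglyMeasurable w) {B ρ : ℝ}
    (hb : ∀ x, |w x| ≤ B) (hs : ∀ x ∉ Metric.ball (0 : Plane) ρ, w x = 0) : Integrable w := by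
  have : IntegrableOn w (Metric.ball 0 ρ) :=
    Measure.integrableOn_of_bounded (M := B) measure_ball_lt_top.ne hm
      (Eventually.of_forall hb)
  refine (integrableOn_iff_integrable_of_support_subset fun x hx => ?_).1 this
  by_contra h
  exact hx (hs x h)

namespace IsWeight

variable {w w' : Plane → ℝ}

lemma integrable (h : IsWeight w) : Integrable w := by
  obtain ⟨ρ, hρ⟩ := h.support
  exact integrable_of_support_ball h.measurable.aestronglyMeasurable h.abs_le hρ

lemma of_sub (h : IsWeight w) (h' : IsWeight w') (h0 : ∀ x, 0 ≤ w x) (h0' : ∀ x, 0 ≤ w' x) :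
    IsWeight fun x => w x - w' x where
  measurable := h.measurable.sub h'.measurable
  abs_le x := by
    have h1 := _root_.abs_le.1 (h.abs_le x)
    have h2 := _root_.abs_le.1 (h'.abs_le x)
    rw [_root_.abs_le]
    constructor <;> linarith [h0 x, h0' x]
  support := by
    obtain ⟨ρ, hρ⟩ := h.support
    obtain ⟨ρ', hρ'⟩ := h'.support
    refine ⟨max ρ ρ', fun x hx => ?_⟩
    rw [hρ x fun h => hx (Metric.ball_subset_ball (le_max_left _ _) h),
      hρ' x fun h => hx (Metric.ball_subset_ball (le_max_right _ _) h), sub_zero]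

end IsWeight

lemma isWeight_chi {D : Set Plane} (hD : IsOpen D) (hb : Bornology.IsBounded D) :
    IsWeight (chi D) where
  measurable := measurable_const.indicator hD.measurableSet
  abs_le x := by by_cases h : x ∈ D <;> simp [chi, h]
  support := by
    obtain ⟨ρ, hρ⟩ := hb.subset_ball 0
    exact ⟨ρ, fun x hx => indicator_of_notMem (fun h => hx (hρ h)) _⟩

lemma chi_nonneg (D : Set Plane) (x : Plane) : 0 ≤ chi D x :=
  indicator_nonneg (fun _ _ => zero_le_one) _

lemma gaussBlur_eq_smear (D : Set Plane) : gaussBlur D = smear gauss (chi D) := rfl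

section Smear

variable {V : Type} [NormedAddCommGroup V] [NormedSpace ℝ V] {w w' : Plane → ℝ}

lemma aestronglyMeasurable_translate {V : Type} [NormedAddCommGroup V] {K : Plane → V}
    (hK : Continuous K) (x : Plane) :
    AEStronglyMeasurable fun z => K (x - z) :=
  (hK.comp (continuous_const.sub continuous_id)).aestronglyMeasurable

lemma integrable_weight_smul {K : Plane → V} {B : ℝ} (hw : Integrable w) (hK : Continuous K)
    (hB : ∀ x, ‖K x‖ ≤ B) (x : Plane) : Integrable fun z => w z • K (x - z) :=
  integrable_smul_of_bound hw (aestronglyMeasurable_translate hK x) fun z => hB (x - z)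

lemma smear_sub_weight {K : Plane → V} {B : ℝ} (hw : Integrable w) (hw' : Integrable w')
    (hK : Continuous K) (hB : ∀ x, ‖K x‖ ≤ B) (x : Plane) :
    smear K (fun z => w z - w' z) x = smear K w x - smear K w' x := by
  simp only [smear, sub_smul]
  exact integral_sub (integrable_weight_smul hw hK hB x) (integrable_weight_smul hw' hK hB x)

lemma smear_sub_kernel {K K' : Plane → V} {B B' : ℝ} (hw : Integrable w)
    (hK : Continuous K) (hB : ∀ x, ‖K x‖ ≤ B) (hK' : Continuous K') (hB' : ∀ x, ‖K' x‖ ≤ B')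
    (x : Plane) : smear (fun z => K z - K' z) w x = smear K w x - smear K' w x := by
  simp only [smear, smul_sub]
  exact integral_sub (integrable_weight_smul hw hK hB x) (integrable_weight_smul hw hK' hB' x)

lemma norm_smear_le {K : Plane → V} (hK : Integrable K) (hw : ∀ x, |w x| ≤ 1) (x : Plane) :
    ‖smear K w x‖ ≤ ∫ z, ‖K z‖ := by
  rw [← integral_sub_left_eq_self (fun z => ‖K z‖) volume x]
  refine norm_integral_le_of_norm_le (hK.norm.comp_sub_left x) (Eventually.of_forall fun z => ?_)
  rw [norm_smul, Real.norm_eq_abs]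
  exact mul_le_of_le_one_left (norm_nonneg _) (hw z)

lemma hasFDerivAt_smear {K : Plane → V} {B : ℝ} (hw : Integrable w) (hK : ContDiff ℝ 1 K)
    (hB : ∀ x, ‖K x‖ ≤ B) (hB' : ∀ x, ‖fderiv ℝ K x‖ ≤ B) (x : Plane) :
    HasFDerivAt (smear K w) (smear (fderiv ℝ K) w x) x := by
  refine hasFDerivAt_integral_smul hw (aestronglyMeasurable_translate hK.continuous)
    (aestronglyMeasurable_translate (hK.continuous_fderiv (by norm_num)))
    (fun x z => hB (x - z)) (fun x z => hB' (x - z)) (fun x z => ?_) x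
  have := ((hK.differentiable (by norm_num)) (x - z)).hasFDerivAt
  simpa [Function.comp_def] using this.comp x ((hasFDerivAt_id x).sub_const z)

lemma lintegral_norm_smear_le {K : Plane → V} (hK : Continuous K) (hKi : Integrable K)
    (hw : Measurable w) (hwi : Integrable w) :
    ∫⁻ x, ‖smear K w x‖ₑ ≤ ENNReal.ofReal ((∫ z, |w z|) * ∫ z, ‖K z‖) := by
  have hm : Measurable fun p : Plane × Plane => ‖w p.2‖ₑ * ‖K (p.1 - p.2)‖ₑ := by
    have h1 : Measurable fun p : Plane × Plane => ‖K (p.1 - p.2)‖ₑ := by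
      have : Continuous fun p : Plane × Plane => ‖K (p.1 - p.2)‖ₑ :=
        continuous_enorm.comp (hK.comp (continuous_fst.sub continuous_snd))
      exact this.measurable
    exact (hw.enorm.comp measurable_snd).mul h1
  calc ∫⁻ x, ‖smear K w x‖ₑ
      ≤ ∫⁻ x, ∫⁻ z, ‖w z‖ₑ * ‖K (x - z)‖ₑ := by
        refine lintegral_mono fun x => (enorm_integral_le_lintegral_enorm _).trans_eq ?_
        simp only [enorm_smul]
    _ = ∫⁻ z, ∫⁻ x, ‖w z‖ₑ * ‖K (x - z)‖ₑ := lintegral_lintegral_swap hm.aemeasurable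
    _ = ∫⁻ z, ‖w z‖ₑ * ∫⁻ x, ‖K x‖ₑ := by
        refine lintegral_congr fun z => ?_
        rw [lintegral_const_mul' _ _ enorm_ne_top,
          lintegral_sub_right_eq_self (fun x => ‖K x‖ₑ) z]
    _ = (∫⁻ z, ‖w z‖ₑ) * ∫⁻ x, ‖K x‖ₑ := lintegral_mul_const _ hw.enorm
    _ = ENNReal.ofReal ((∫ z, |w z|) * ∫ z, ‖K z‖) := by
        rw [ENNReal.ofReal_mul (integral_nonneg fun _ => abs_nonneg _),
          ofReal_integral_norm_eq_lintegral_enorm hKi]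
        congr 1
        exact (ofReal_integral_norm_eq_lintegral_enorm hwi).symm

/-- A Lipschitz function with small `L¹` norm is small. -/
lemma norm_le_of_lipschitz_of_lintegral_le {V : Type} [NormedAddCommGroup V] {g : Plane → V}
    {Λ ε τ : ℝ} (hτ : 0 < τ)
    (hε : 0 ≤ ε) (hg : ∀ x y, ‖g x - g y‖ ≤ Λ * ‖x - y‖) (hΛ : 0 ≤ Λ)
    (hi : ∫⁻ x, ‖g x‖ₑ ≤ ENNReal.ofReal ε) (x : Plane) :
    ‖g x‖ ≤ Λ * τ + ε / (volume (Metric.ball (0 : Plane) τ)).toReal := by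
  have hpos : 0 < (volume (Metric.ball (0 : Plane) τ)).toReal :=
    ENNReal.toReal_pos (Metric.measure_ball_pos _ _ hτ).ne' measure_ball_lt_top.ne
  by_contra! hcon
  rw [← lt_sub_iff_add_lt'] at hcon
  set c := ‖g x‖ - Λ * τ with hc
  have hc0 : 0 ≤ c := le_trans (by positivity) hcon.le
  -- On the disc of radius `τ` about `x` the norm stays above `c`, so the L¹ norm is at least `c`
  -- times the area.
  have h1 : ∀ y ∈ Metric.ball x τ, ENNReal.ofReal c ≤ ‖g y‖ₑ := by
    intro y hy
    rw [← ofReal_norm]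
    refine ENNReal.ofReal_le_ofReal ?_
    have h2 := hg x y
    have h3 : ‖x - y‖ ≤ τ := by rw [← dist_eq_norm, dist_comm]; exact hy.le
    have h4 := norm_sub_norm_le (g x) (g y)
    have h5 := mul_le_mul_of_nonneg_left h3 hΛ
    linarith
  have h2 : ENNReal.ofReal c * volume (Metric.ball x τ) ≤ ENNReal.ofReal ε := by
    rw [← setLIntegral_const]
    exact (setLIntegral_mono' measurableSet_ball h1).trans
      ((setLIntegral_le_lintegral _ _).trans hi)
  rw [Measure.addHaar_ball_center, ← ENNReal.ofReal_toReal (measure_ball_lt_top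
    (x := (0 : Plane)) (r := τ) (μ := volume)).ne, ← ENNReal.ofReal_mul hc0,
    ENNReal.ofReal_le_ofReal_iff hε] at h2
  rw [div_lt_iff₀ hpos] at hcon
  linarith

/-- Convolution with a weight that is small in `L¹` is uniformly small, at a rate that depends on
the `W^{1,1}` norm of the kernel only. -/
lemma exists_smear_small {A ε : ℝ} (hA : 0 ≤ A) (hε : 0 < ε) : ∃ γ : ℝ, 0 < γ ∧
    ∀ (V : Type) [NormedAddCommGroup V] [NormedSpace ℝ V] (K : Plane → V) (B : ℝ) (w : Plane → ℝ),
      ContDiff ℝ 1 K → (∀ x, ‖K x‖ ≤ B) → (∀ x, ‖fderiv ℝ K x‖ ≤ B) → Integrable K →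
      Integrable (fderiv ℝ K) → ∫ x, ‖K x‖ ≤ A → ∫ x, ‖fderiv ℝ K x‖ ≤ A → IsWeight w →
      ∫ x, |w x| ≤ γ → ∀ x, ‖smear K w x‖ ≤ ε := by
  -- The oscillation over a disc of radius `τ` costs at most ε/2; `γ` is then chosen so that the
  -- mean over such a disc costs at most ε/2. The bound `B` plays no part in the choice.
  set τ : ℝ := ε / (2 * (A + 1)) with hτd
  have hτ : 0 < τ := by positivity
  set vol := (volume (Metric.ball (0 : Plane) τ)).toReal with hvol
  have hpos : 0 < vol :=
    ENNReal.toReal_pos (Metric.measure_ball_pos _ _ hτ).ne' measure_ball_lt_top.ne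
  refine ⟨ε * vol / (2 * (A + 1)), by positivity, ?_⟩
  intro V _ _ K B w hK hB hB' hKi hKi' hA1 hA2 hw hγ x
  have hd : ∀ x, HasFDerivAt (smear K w) (smear (fderiv ℝ K) w x) x :=
    hasFDerivAt_smear hw.integrable hK hB hB'
  have hLip : ∀ x y, ‖smear K w x - smear K w y‖ ≤ A * ‖x - y‖ := fun x y =>
    Convex.norm_image_sub_le_of_norm_hasFDerivWithin_le (𝕜 := ℝ) (s := univ)
      (fun z _ => (hd z).hasFDerivWithinAt)
      (fun z _ => (norm_smear_le hKi' hw.abs_le z).trans hA2) convex_univ (mem_univ y) (mem_univ x)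
  have hw0 : 0 ≤ ∫ x, |w x| := integral_nonneg fun _ => abs_nonneg _
  have hi := lintegral_norm_smear_le hK.continuous hKi hw.measurable hw.integrable
  have hle : (∫ z, |w z|) * ∫ z, ‖K z‖ ≤ ε * vol / (2 * (A + 1)) * A := by gcongr
  have := norm_le_of_lipschitz_of_lintegral_le hτ (by positivity) hLip hA
    (hi.trans (ENNReal.ofReal_le_ofReal hle)) x
  refine this.trans ?_
  rw [← hvol]
  have e1 : A * τ = ε / 2 * (A / (A + 1)) := by rw [hτd]; field_simp
  have e2 : ε * vol / (2 * (A + 1)) * A / vol = ε / 2 * (A / (A + 1)) := by field_simp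
  have e3 : A / (A + 1) ≤ 1 := by rw [div_le_one (by positivity)]; linarith
  rw [e1, e2]
  nlinarith

end Smear

/-! ### Bilinear superpositions -/

/-- The function `x ↦ ∫∫ a(ξ, η) K(x - ξ) K(x - η) dξ dη`. -/
noncomputable def pairSmear (K : Plane → ℝ) (a : Plane × Plane → ℝ) (x : Plane) : ℝ :=
  ∫ z, a z • (K (x - z.1) * K (x - z.2))

/-- The derivative of `x ↦ K (x - ξ) K (x - η)`. -/
noncomputable def pairDeriv (K : Plane → ℝ) (x : Plane) (z : Plane × Plane) : Plane →L[ℝ] ℝ :=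
  K (x - z.1) • fderiv ℝ K (x - z.2) + K (x - z.2) • fderiv ℝ K (x - z.1)

/-- The second derivative of `x ↦ K (x - ξ) K (x - η)`. -/
noncomputable def pairDeriv₂ (K : Plane → ℝ) (x : Plane) (z : Plane × Plane) :
    Plane →L[ℝ] Plane →L[ℝ] ℝ :=
  (K (x - z.1) • fderiv ℝ (fderiv ℝ K) (x - z.2) +
      (fderiv ℝ K (x - z.1)).smulRight (fderiv ℝ K (x - z.2))) +
    (K (x - z.2) • fderiv ℝ (fderiv ℝ K) (x - z.1) +
      (fderiv ℝ K (x - z.2)).smulRight (fderiv ℝ K (x - z.1)))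

section

variable {K : Plane → ℝ} {a a' : Plane × Plane → ℝ}

lemma hasFDerivAt_translate {V : Type} [NormedAddCommGroup V] [NormedSpace ℝ V] {f : Plane → V}
    (hf : Differentiable ℝ f) (x z : Plane) :
    HasFDerivAt (fun y => f (y - z)) (fderiv ℝ f (x - z)) x := by
  simpa [Function.comp_def] using
    (hf (x - z)).hasFDerivAt.comp x ((hasFDerivAt_id x).sub_const z)

lemma hasFDerivAt_pair (hK : IsKernel K) (x : Plane) (z : Plane × Plane) :
    HasFDerivAt (fun y => K (y - z.1) * K (y - z.2)) (pairDeriv K x z) x :=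
  (hasFDerivAt_translate hK.differentiable x z.1).mul
    (hasFDerivAt_translate hK.differentiable x z.2)

lemma hasFDerivAt_pairDeriv (hK : IsKernel K) (x : Plane) (z : Plane × Plane) :
    HasFDerivAt (fun y => pairDeriv K y z) (pairDeriv₂ K x z) x :=
  ((hasFDerivAt_translate hK.differentiable x z.1).smul
      (hasFDerivAt_translate hK.differentiable_fderiv x z.2)).add
    ((hasFDerivAt_translate hK.differentiable x z.2).smul
      (hasFDerivAt_translate hK.differentiable_fderiv x z.1))

lemma norm_pairDeriv_le (x : Plane) (z : Plane × Plane) :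
    ‖pairDeriv K x z‖ ≤ ‖K (x - z.1)‖ * ‖fderiv ℝ K (x - z.2)‖ +
      ‖K (x - z.2)‖ * ‖fderiv ℝ K (x - z.1)‖ := by
  refine (norm_add_le _ _).trans_eq ?_
  rw [norm_smul, norm_smul]

lemma norm_pairDeriv₂_le (x : Plane) (z : Plane × Plane) :
    ‖pairDeriv₂ K x z‖ ≤ (‖K (x - z.1)‖ * ‖fderiv ℝ (fderiv ℝ K) (x - z.2)‖ +
      ‖fderiv ℝ K (x - z.1)‖ * ‖fderiv ℝ K (x - z.2)‖) +
      (‖K (x - z.2)‖ * ‖fderiv ℝ (fderiv ℝ K) (x - z.1)‖ +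
      ‖fderiv ℝ K (x - z.2)‖ * ‖fderiv ℝ K (x - z.1)‖) := by
  refine (norm_add_le _ _).trans (add_le_add ?_ ?_) <;>
  · refine (norm_add_le _ _).trans_eq ?_
    rw [norm_smul, ContinuousLinearMap.norm_smulRight_apply]

lemma continuous_translate₁ {V : Type} [TopologicalSpace V] {f : Plane → V} (hf : Continuous f) :
    Continuous fun p : Plane × (Plane × Plane) => f (p.1 - p.2.1) := by fun_prop

lemma continuous_translate₂ {V : Type} [TopologicalSpace V] {f : Plane → V} (hf : Continuous f) :
    Continuous fun p : Plane × (Plane × Plane) => f (p.1 - p.2.2) := by fun_prop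

lemma continuous_pair (hK : IsKernel K) :
    Continuous fun p : Plane × (Plane × Plane) => K (p.1 - p.2.1) * K (p.1 - p.2.2) :=
  (continuous_translate₁ hK.continuous).mul (continuous_translate₂ hK.continuous)

lemma continuous_pairDeriv (hK : IsKernel K) :
    Continuous fun p : Plane × (Plane × Plane) => pairDeriv K p.1 p.2 :=
  ((continuous_translate₁ hK.continuous).smul (continuous_translate₂ hK.continuous_fderiv)).add
    ((continuous_translate₂ hK.continuous).smul (continuous_translate₁ hK.continuous_fderiv))

lemma continuous_pairDeriv₂ (hK : IsKernel K) :
    Continuous fun p : Plane × (Plane × Plane) => pairDeriv₂ K p.1 p.2 := by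
  have h0 := hK.continuous
  have h1 := hK.continuous_fderiv
  have h2 := hK.continuous_fderiv_fderiv
  have hs : Continuous fun q : (Plane →L[ℝ] ℝ) × (Plane →L[ℝ] ℝ) => q.1.smulRight q.2 := by
    have := (ContinuousLinearMap.smulRightL ℝ Plane (Plane →L[ℝ] ℝ)).continuous₂
    exact this
  exact (((continuous_translate₁ h0).smul (continuous_translate₂ h2)).add
      (hs.comp ((continuous_translate₁ h1).prodMk (continuous_translate₂ h1)))).add
    (((continuous_translate₂ h0).smul (continuous_translate₁ h2)).add
      (hs.comp ((continuous_translate₂ h1).prodMk (continuous_translate₁ h1))))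

lemma exists_pair_bound (hK : IsKernel K) : ∃ B : ℝ, 0 ≤ B ∧ ∀ x z,
    ‖K (x - z.1) * K (x - z.2)‖ ≤ B ∧ ‖pairDeriv K x z‖ ≤ B ∧ ‖pairDeriv₂ K x z‖ ≤ B := by
  obtain ⟨B, hB⟩ := hK.bounded
  have hB0 : 0 ≤ B := (norm_nonneg _).trans (hB 0).1
  refine ⟨4 * (B * B), by positivity, fun x z => ⟨?_, ?_, ?_⟩⟩
  · rw [norm_mul]
    have := mul_le_mul (hB (x - z.1)).1 (hB (x - z.2)).1 (norm_nonneg _) hB0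
    nlinarith
  · refine (norm_pairDeriv_le x z).trans ?_
    have h1 := mul_le_mul (hB (x - z.1)).1 (hB (x - z.2)).2.1 (norm_nonneg _) hB0
    have h2 := mul_le_mul (hB (x - z.2)).1 (hB (x - z.1)).2.1 (norm_nonneg _) hB0
    nlinarith
  · refine (norm_pairDeriv₂_le x z).trans ?_
    have h1 := mul_le_mul (hB (x - z.1)).1 (hB (x - z.2)).2.2 (norm_nonneg _) hB0
    have h2 := mul_le_mul (hB (x - z.2)).1 (hB (x - z.1)).2.2 (norm_nonneg _) hB0
    have h3 := mul_le_mul (hB (x - z.1)).2.1 (hB (x - z.2)).2.1 (norm_nonneg _) hB0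
    have h4 := mul_le_mul (hB (x - z.2)).2.1 (hB (x - z.1)).2.1 (norm_nonneg _) hB0
    nlinarith

lemma hasFDerivAt_pairSmear (hK : IsKernel K) (ha : Integrable a) (x : Plane) :
    HasFDerivAt (pairSmear K a) (∫ z, a z • pairDeriv K x z) x := by
  obtain ⟨B, -, hB⟩ := exists_pair_bound hK
  exact hasFDerivAt_integral_smul ha
    (fun x => ((continuous_pair hK).comp (Continuous.prodMk_right x)).aestronglyMeasurable)
    (fun x => ((continuous_pairDeriv hK).comp (Continuous.prodMk_right x)).aestronglyMeasurable)
    (fun x z => (hB x z).1) (fun x z => (hB x z).2.1) (hasFDerivAt_pair hK) x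

lemma fderiv_pairSmear (hK : IsKernel K) (ha : Integrable a) :
    fderiv ℝ (pairSmear K a) = fun x => ∫ z, a z • pairDeriv K x z :=
  funext fun x => (hasFDerivAt_pairSmear hK ha x).fderiv

lemma fderiv_fderiv_pairSmear (hK : IsKernel K) (ha : Integrable a) (x : Plane) :
    HasFDerivAt (fderiv ℝ (pairSmear K a)) (∫ z, a z • pairDeriv₂ K x z) x := by
  obtain ⟨B, -, hB⟩ := exists_pair_bound hK
  rw [fderiv_pairSmear hK ha]
  exact hasFDerivAt_integral_smul ha
    (fun x => ((continuous_pairDeriv hK).comp (Continuous.prodMk_right x)).aestronglyMeasurable)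
    (fun x => ((continuous_pairDeriv₂ hK).comp (Continuous.prodMk_right x)).aestronglyMeasurable)
    (fun x z => (hB x z).2.1) (fun x z => (hB x z).2.2) (hasFDerivAt_pairDeriv hK) x

lemma contDiff_two_of_hasFDerivAt {f : Plane → ℝ} {f'' : Plane → Plane →L[ℝ] Plane →L[ℝ] ℝ}
    (h1 : Differentiable ℝ f) (h2 : ∀ x, HasFDerivAt (fderiv ℝ f) (f'' x) x)
    (hc : Continuous f'') : ContDiff ℝ 2 f := by
  have h3 : fderiv ℝ (fderiv ℝ f) = f'' := funext fun x => (h2 x).fderiv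
  have h4 : ContDiff ℝ 1 (fderiv ℝ f) :=
    contDiff_one_iff_fderiv.2 ⟨fun x => (h2 x).differentiableAt, h3 ▸ hc⟩
  exact (contDiff_succ_iff_fderiv (n := 1)).2 ⟨h1, by simp, h4⟩

lemma continuous_integral_pairDeriv₂ (hK : IsKernel K) (ha : Integrable a) :
    Continuous fun x => ∫ z, a z • pairDeriv₂ K x z := by
  obtain ⟨B, -, hB⟩ := exists_pair_bound hK
  have hc := continuous_pairDeriv₂ hK
  have hm : ∀ x, AEStronglyMeasurable (pairDeriv₂ K x) volume := fun x =>
    Continuous.aestronglyMeasurable (by fun_prop)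
  have hc' : ∀ z, Continuous fun y => pairDeriv₂ K y z := fun z => by fun_prop
  exact continuous_integral_smul ha hm (fun x z => (hB x z).2.2) hc'

lemma contDiff_pairSmear (hK : IsKernel K) (ha : Integrable a) : ContDiff ℝ 2 (pairSmear K a) :=
  contDiff_two_of_hasFDerivAt (fun x => (hasFDerivAt_pairSmear hK ha x).differentiableAt)
    (fderiv_fderiv_pairSmear hK ha) (continuous_integral_pairDeriv₂ hK ha)

lemma pairSmear_sub (hK : IsKernel K) (ha : Integrable a) (ha' : Integrable a') (x : Plane) :
    pairSmear K (fun z => a z - a' z) x = pairSmear K a x - pairSmear K a' x := by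
  obtain ⟨B, -, hB⟩ := exists_pair_bound hK
  have hm := ((continuous_pair hK).comp (Continuous.prodMk_right x)).aestronglyMeasurable
    (μ := (volume : Measure (Plane × Plane)))
  simp only [pairSmear, sub_smul]
  exact integral_sub (integrable_smul_of_bound ha hm fun z => (hB x z).1)
    (integrable_smul_of_bound ha' hm fun z => (hB x z).1)

/-- The fully coherent limit: with J ≡ 1 the double integral factors by Fubini. -/
lemma pairSmear_prod (w : Plane → ℝ) (x : Plane) :
    pairSmear K (fun z => w z.1 * w z.2) x = smear K w x ^ 2 := by
  rw [sq, smear, ← integral_prod_mul, pairSmear]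
  refine integral_congr_ae (Eventually.of_forall fun z => ?_)
  simp only [smul_eq_mul]
  ring

/-! ### Bounds in terms of `L¹` norms -/

lemma integrable_translate_mul {f g : Plane → ℝ} (hf : Integrable f) (hg : Integrable g)
    (x : Plane) : Integrable fun z : Plane × Plane => f (x - z.1) * g (x - z.2) :=
  (hf.comp_sub_left x).mul_prod (hg.comp_sub_left x)

lemma integral_translate_mul (f g : Plane → ℝ) (x : Plane) :
    ∫ z : Plane × Plane, f (x - z.1) * g (x - z.2) = (∫ z, f z) * ∫ z, g z := by
  rw [← integral_sub_left_eq_self f volume x, ← integral_sub_left_eq_self g volume x,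
    ← integral_prod_mul]
  rfl

lemma integral_translate_mul' (f g : Plane → ℝ) (x : Plane) :
    ∫ z : Plane × Plane, f (x - z.2) * g (x - z.1) = (∫ z, f z) * ∫ z, g z := by
  rw [mul_comm, ← integral_translate_mul g f x]
  simp only [mul_comm]

lemma integrable_translate_mul' {f g : Plane → ℝ} (hf : Integrable f) (hg : Integrable g)
    (x : Plane) : Integrable fun z : Plane × Plane => f (x - z.2) * g (x - z.1) := by
  simpa only [mul_comm] using integrable_translate_mul hg hf x

lemma norm_integral_smul_le {V : Type} [NormedAddCommGroup V] [NormedSpace ℝ V]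
    {f : Plane × Plane → V} {g : Plane × Plane → ℝ} {c : ℝ} (hc : 0 ≤ c) (ha : ∀ z, |a z| ≤ c)
    (hf : ∀ z, ‖f z‖ ≤ g z) (hg : Integrable g) : ‖∫ z, a z • f z‖ ≤ c * ∫ z, g z := by
  rw [← integral_const_mul]
  refine norm_integral_le_of_norm_le (hg.const_mul c) (Eventually.of_forall fun z => ?_)
  rw [norm_smul, Real.norm_eq_abs]
  exact mul_le_mul (ha z) (hf z) (norm_nonneg _) hc

variable {c A₀ A₁ A₂ : ℝ}

/-- Here and in the next two lemmas the weight enters only through its supremum, so the bounds do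
not depend on the size of its support. -/
lemma abs_pairSmear_le (hK : IsKernel K) (hc : 0 ≤ c) (ha : ∀ z, |a z| ≤ c)
    (h0 : ∫ z, ‖K z‖ ≤ A₀) (x : Plane) : |pairSmear K a x| ≤ c * (A₀ * A₀) := by
  have hn : 0 ≤ ∫ z, ‖K z‖ := integral_nonneg fun _ => norm_nonneg _
  refine (norm_integral_smul_le (g := fun z => ‖K (x - z.1)‖ * ‖K (x - z.2)‖) hc ha
    (fun z => (norm_mul _ _).le) (integrable_translate_mul hK.integrable.norm
      hK.integrable.norm x)).trans ?_
  rw [integral_translate_mul (fun z => ‖K z‖) (fun z => ‖K z‖) x]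
  have := mul_le_mul h0 h0 hn (hn.trans h0)
  gcongr

lemma norm_integral_pairDeriv_le (hK : IsKernel K) (hc : 0 ≤ c) (ha : ∀ z, |a z| ≤ c)
    (h0 : ∫ z, ‖K z‖ ≤ A₀) (h1 : ∫ z, ‖fderiv ℝ K z‖ ≤ A₁) (x : Plane) :
    ‖∫ z, a z • pairDeriv K x z‖ ≤ c * (2 * A₀ * A₁) := by
  have hn0 : 0 ≤ ∫ z, ‖K z‖ := integral_nonneg fun _ => norm_nonneg _
  have hn1 : 0 ≤ ∫ z, ‖fderiv ℝ K z‖ := integral_nonneg fun _ => norm_nonneg _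
  have i1 := integrable_translate_mul hK.integrable.norm hK.integrable_fderiv.norm x
  have i2 := integrable_translate_mul' hK.integrable.norm hK.integrable_fderiv.norm x
  refine (norm_integral_smul_le hc ha (fun z => norm_pairDeriv_le x z) (i1.add i2)).trans ?_
  gcongr
  rw [integral_add i1 i2,
    integral_translate_mul (fun z => ‖K z‖) (fun z => ‖fderiv ℝ K z‖) x,
    integral_translate_mul' (fun z => ‖K z‖) (fun z => ‖fderiv ℝ K z‖) x]
  have := mul_le_mul h0 h1 hn1 (hn0.trans h0)
  linarith

lemma norm_integral_pairDeriv₂_le (hK : IsKernel K) (hc : 0 ≤ c) (ha : ∀ z, |a z| ≤ c)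
    (h0 : ∫ z, ‖K z‖ ≤ A₀) (h1 : ∫ z, ‖fderiv ℝ K z‖ ≤ A₁)
    (h2 : ∫ z, ‖fderiv ℝ (fderiv ℝ K) z‖ ≤ A₂) (x : Plane) :
    ‖∫ z, a z • pairDeriv₂ K x z‖ ≤ c * (2 * A₀ * A₂ + 2 * A₁ * A₁) := by
  have hn0 : 0 ≤ ∫ z, ‖K z‖ := integral_nonneg fun _ => norm_nonneg _
  have hn1 : 0 ≤ ∫ z, ‖fderiv ℝ K z‖ := integral_nonneg fun _ => norm_nonneg _
  have hn2 : 0 ≤ ∫ z, ‖fderiv ℝ (fderiv ℝ K) z‖ := integral_nonneg fun _ => norm_nonneg _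
  have k0 := hK.integrable.norm
  have k1 := hK.integrable_fderiv.norm
  have k2 := hK.integrable_fderiv_fderiv.norm
  have i1 := integrable_translate_mul k0 k2 x
  have i2 := integrable_translate_mul k1 k1 x
  have i3 := integrable_translate_mul' k0 k2 x
  have i4 := integrable_translate_mul' k1 k1 x
  refine (norm_integral_smul_le hc ha (fun z => norm_pairDeriv₂_le x z)
    ((i1.add i2).add (i3.add i4))).trans ?_
  gcongr
  have e := integral_add (i1.add i2) (i3.add i4)
  simp only [Pi.add_apply] at e
  rw [e, integral_add i1 i2, integral_add i3 i4,
    integral_translate_mul (fun z => ‖K z‖) (fun z => ‖fderiv ℝ (fderiv ℝ K) z‖) x,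
    integral_translate_mul' (fun z => ‖K z‖) (fun z => ‖fderiv ℝ (fderiv ℝ K) z‖) x,
    integral_translate_mul (fun z => ‖fderiv ℝ K z‖) (fun z => ‖fderiv ℝ K z‖) x,
    integral_translate_mul' (fun z => ‖fderiv ℝ K z‖) (fun z => ‖fderiv ℝ K z‖) x]
  have e1 := mul_le_mul h0 h2 hn2 (hn0.trans h0)
  have e2 := mul_le_mul h1 h1 hn1 (hn1.trans h1)
  linarith

end

/-! ### The Gaussian kernel -/

/-- The real inner product of the plane as a continuous bilinear map. -/
noncomputable def innerCLM : Plane →L[ℝ] Plane →L[ℝ] ℝ := innerSL ℝ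

lemma gauss_pos (x : Plane) : 0 < gauss x := by
  unfold gauss; positivity

lemma hasFDerivAt_gauss (x : Plane) : HasFDerivAt gauss (-(gauss x • innerSL ℝ x)) x := by
  have h1 : HasFDerivAt (fun x : Plane => ‖x‖ ^ 2) (2 • innerSL ℝ x) x :=
    (hasStrictFDerivAt_norm_sq x).hasFDerivAt
  have h2 := ((h1.neg.mul_const (2⁻¹ : ℝ)).exp).const_mul ((2 * Real.pi)⁻¹)
  have h3 : gauss = fun x : Plane => (2 * Real.pi)⁻¹ * Real.exp (-‖x‖ ^ 2 * 2⁻¹) := by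
    funext x; simp only [gauss, div_eq_mul_inv]
  rw [h3]
  refine h2.congr_fderiv ?_
  ext v
  simp
  ring

lemma fderiv_gauss : fderiv ℝ gauss = fun x => -(gauss x • innerSL ℝ x) :=
  funext fun x => (hasFDerivAt_gauss x).fderiv

lemma hasFDerivAt_fderiv_gauss (x : Plane) :
    HasFDerivAt (fderiv ℝ gauss) (-(gauss x • innerCLM +
      (-(gauss x • innerSL ℝ x)).smulRight (innerSL ℝ x))) x := by
  rw [fderiv_gauss]
  exact ((hasFDerivAt_gauss x).smul
    (innerCLM.hasFDerivAt (x := x))).neg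

lemma continuous_gauss : Continuous gauss := by
  unfold gauss; fun_prop

lemma contDiff_gauss : ContDiff ℝ 2 gauss := by
  refine contDiff_two_of_hasFDerivAt (fun x => (hasFDerivAt_gauss x).differentiableAt)
    hasFDerivAt_fderiv_gauss ?_
  have h1 := continuous_gauss
  have h2 : Continuous fun x : Plane => innerSL ℝ x :=
    innerCLM.continuous
  have hs : Continuous fun q : (Plane →L[ℝ] ℝ) × (Plane →L[ℝ] ℝ) => q.1.smulRight q.2 :=
    (ContinuousLinearMap.smulRightL ℝ Plane (Plane →L[ℝ] ℝ)).continuous₂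
  exact ((h1.smul continuous_const).add (hs.comp ((h1.smul h2).neg.prodMk h2))).neg

/-- One envelope for all derivatives needed: G, |∇G| and |D²G| are each at most (1 + |x|²)G, and
half of the Gaussian exponent absorbs the polynomial. -/
lemma one_add_sq_mul_gauss_le (x : Plane) :
    (1 + ‖x‖ ^ 2) * gauss x ≤ Real.exp (-(1 / 4) * ‖x‖ ^ 2) := by
  have h1 : 1 + ‖x‖ ^ 2 ≤ 4 * Real.exp (1 / 4 * ‖x‖ ^ 2) := by
    have := Real.add_one_le_exp (1 / 4 * ‖x‖ ^ 2)
    nlinarith [sq_nonneg ‖x‖]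
  have h2 : (2 * Real.pi)⁻¹ ≤ 4⁻¹ := by
    apply inv_anti₀ (by norm_num)
    linarith [Real.pi_gt_three]
  calc (1 + ‖x‖ ^ 2) * gauss x
      ≤ 4 * Real.exp (1 / 4 * ‖x‖ ^ 2) * (4⁻¹ * Real.exp (-‖x‖ ^ 2 / 2)) := by
        unfold gauss; gcongr
    _ = Real.exp (1 / 4 * ‖x‖ ^ 2) * Real.exp (-‖x‖ ^ 2 / 2) := by ring
    _ = Real.exp (-(1 / 4) * ‖x‖ ^ 2) := by rw [← Real.exp_add]; congr 1; ring

lemma gauss_le (x : Plane) : ‖gauss x‖ ≤ Real.exp (-(1 / 4) * ‖x‖ ^ 2) := by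
  rw [Real.norm_of_nonneg (gauss_pos x).le]
  refine le_trans ?_ (one_add_sq_mul_gauss_le x)
  nlinarith [gauss_pos x, sq_nonneg ‖x‖]

lemma norm_fderiv_gauss (x : Plane) : ‖fderiv ℝ gauss x‖ = gauss x * ‖x‖ := by
  rw [fderiv_gauss]
  simp only [norm_neg]
  rw [norm_smul, innerSL_apply_norm, Real.norm_of_nonneg (gauss_pos x).le]

lemma norm_fderiv_gauss_le (x : Plane) :
    ‖fderiv ℝ gauss x‖ ≤ Real.exp (-(1 / 4) * ‖x‖ ^ 2) := by
  rw [norm_fderiv_gauss]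
  refine le_trans ?_ (one_add_sq_mul_gauss_le x)
  nlinarith [gauss_pos x, sq_nonneg (‖x‖ - 1)]

lemma norm_fderiv_fderiv_gauss_le (x : Plane) :
    ‖fderiv ℝ (fderiv ℝ gauss) x‖ ≤ Real.exp (-(1 / 4) * ‖x‖ ^ 2) := by
  rw [(hasFDerivAt_fderiv_gauss x).fderiv, norm_neg]
  refine le_trans ((norm_add_le _ _).trans ?_) (one_add_sq_mul_gauss_le x)
  rw [norm_smul, ContinuousLinearMap.norm_smulRight_apply, norm_neg, norm_smul, innerSL_apply_norm,
    Real.norm_of_nonneg (gauss_pos x).le]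
  have := mul_le_mul_of_nonneg_left (show ‖innerCLM‖ ≤ 1 from norm_innerSL_le ℝ) (gauss_pos x).le
  linarith

lemma integrable_exp_neg_mul_norm_sq {b : ℝ} (hb : 0 < b) :
    Integrable fun x : Plane => Real.exp (-b * ‖x‖ ^ 2) := by
  by_contra h
  have h1 := GaussianFourier.integral_rexp_neg_mul_sq_norm (V := Plane) hb
  rw [integral_undef h] at h1
  have : 0 < (Real.pi / b) ^ (Module.finrank ℝ Plane / 2 : ℝ) := by positivity
  exact this.ne h1

lemma isKernel_gauss : IsKernel gauss where
  contDiff := contDiff_gauss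
  bounded := by
    refine ⟨1, fun x => ?_⟩
    have h : Real.exp (-(1 / 4) * ‖x‖ ^ 2) ≤ 1 := by
      rw [Real.exp_le_one_iff]; nlinarith [sq_nonneg ‖x‖]
    exact ⟨(gauss_le x).trans h, (norm_fderiv_gauss_le x).trans h,
      (norm_fderiv_fderiv_gauss_le x).trans h⟩
  integrable := (integrable_exp_neg_mul_norm_sq (by norm_num)).mono'
    continuous_gauss.aestronglyMeasurable (Eventually.of_forall gauss_le)
  integrable_fderiv := (integrable_exp_neg_mul_norm_sq (by norm_num)).mono'
    (contDiff_gauss.continuous_fderiv (by norm_num)).aestronglyMeasurable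
    (Eventually.of_forall norm_fderiv_gauss_le)
  integrable_fderiv_fderiv := (integrable_exp_neg_mul_norm_sq (by norm_num)).mono'
    ((contDiff_gauss.fderiv_right (m := 1) (by norm_num)).continuous_fderiv
      (by norm_num)).aestronglyMeasurable
    (Eventually.of_forall norm_fderiv_fderiv_gauss_le)

lemma integral_gauss : ∫ x, gauss x = 1 := by
  have h1 := GaussianFourier.integral_rexp_neg_mul_sq_norm (V := Plane) (b := 1 / 2) (by norm_num)
  simp only [gauss]
  rw [integral_const_mul]
  have h2 : ∀ x : Plane, Real.exp (-‖x‖ ^ 2 / 2) = Real.exp (-(1 / 2) * ‖x‖ ^ 2) := by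
    intro x; congr 1; ring
  simp only [h2]
  rw [h1]
  simp
  field_simp

lemma integral_gauss_sub (x : Plane) : ∫ z, gauss (x - z) = 1 :=
  (integral_sub_left_eq_self gauss volume x).trans integral_gauss

/-! ### Tails -/

/-- The envelope is the square of exp(-|x|²/8); off the ball one factor is at most exp(-ρ²/8) and
the other remains integrable. -/
lemma integral_tail_le {f : Plane → ℝ} (hf : Integrable f) {ρ : ℝ} (hρ : 0 ≤ ρ)
    (hb : ∀ x, f x ≤ Real.exp (-(1 / 4) * ‖x‖ ^ 2)) :
    ∫ x in (Metric.ball (0 : Plane) ρ)ᶜ, f x ≤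
      (∫ x : Plane, Real.exp (-(1 / 8) * ‖x‖ ^ 2)) * Real.exp (-(1 / 8) * ρ ^ 2) := by
  have hi := integrable_exp_neg_mul_norm_sq (b := 1 / 8) (by norm_num)
  rw [← integral_mul_const]
  refine (setIntegral_mono_on hf.integrableOn (hi.mul_const _).integrableOn
    measurableSet_ball.compl fun x hx => (hb x).trans ?_).trans
    (setIntegral_le_integral (hi.mul_const _) (Eventually.of_forall fun x => by positivity))
  have hx' : ρ ≤ ‖x‖ := by simpa using hx
  rw [← Real.exp_add, Real.exp_le_exp]
  have : ρ ^ 2 ≤ ‖x‖ ^ 2 := by gcongr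
  linarith

lemma norm_smear_le_tail {V : Type} [NormedAddCommGroup V] [NormedSpace ℝ V] {K : Plane → V}
    {f : Plane → ℝ} (hK : Integrable K) (hf : ∀ z, |f z| ≤ 1) {x : Plane} {ρ : ℝ}
    (h0 : ∀ z ∈ Metric.ball x ρ, f z = 0) :
    ‖smear K f x‖ ≤ ∫ z in (Metric.ball (0 : Plane) ρ)ᶜ, ‖K z‖ := by
  rw [← integral_indicator measurableSet_ball.compl,
    ← integral_sub_left_eq_self (indicator (Metric.ball (0 : Plane) ρ)ᶜ fun z => ‖K z‖) volume x]
  refine norm_integral_le_of_norm_le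
    ((hK.norm.indicator measurableSet_ball.compl).comp_sub_left x)
    (Eventually.of_forall fun z => ?_)
  by_cases hz : z ∈ Metric.ball x ρ
  · rw [h0 z hz, zero_smul, norm_zero]
    exact indicator_nonneg (fun _ _ => norm_nonneg _) _
  · rw [indicator_of_mem, norm_smul, Real.norm_eq_abs]
    · exact mul_le_of_le_one_left (norm_nonneg _) (hf z)
    · intro h
      apply hz
      rw [Metric.mem_ball, dist_eq_norm, ← norm_neg, neg_sub]
      simpa using h

lemma abs_chi_le (D : Set Plane) (z : Plane) : |chi D z| ≤ 1 := by
  by_cases h : z ∈ D <;> simp [chi, h]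

lemma chi_le_one (D : Set Plane) (z : Plane) : chi D z ≤ 1 := (le_abs_self _).trans (abs_chi_le D z)

lemma ball_subset_or_disjoint {D : Set Plane} (hD : IsOpen D) {x : Plane} {ρ : ℝ}
    (h : Disjoint (Metric.ball x ρ) (frontier D)) :
    Metric.ball x ρ ⊆ D ∨ Disjoint (Metric.ball x ρ) D := by
  have hc : IsPreconnected (Metric.ball x ρ) := (convex_ball x ρ).isPreconnected
  have hsub : Metric.ball x ρ ⊆ D ∪ (closure D)ᶜ := by
    intro z hz
    by_contra hcon
    rw [mem_union, not_or, mem_compl_iff, not_not] at hcon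
    refine disjoint_left.1 h hz ⟨hcon.2, ?_⟩
    rw [hD.interior_eq]
    exact hcon.1
  have hdis : Disjoint D (closure D)ᶜ := disjoint_compl_right.mono_left subset_closure |>.mono_right
    (compl_subset_compl.2 subset_rfl)
  rcases hc.subset_or_subset hD isClosed_closure.isOpen_compl hdis hsub with h1 | h1
  · exact Or.inl h1
  · exact Or.inr (disjoint_left.2 fun z hz hzD => h1 hz (subset_closure hzD))

/-- A disc that misses the boundary lies in `D` or in its complement, so at its centre the blur
differs from 1 or 0 only by the tail of the Gaussian. -/
lemma gaussBlur_layer {D : Set Plane} (hD : IsOpen D) (hb : Bornology.IsBounded D) {x : Plane}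
    {ρ κ : ℝ} (hρ : 0 < ρ)
    (hκ : (∫ x : Plane, Real.exp (-(1 / 8) * ‖x‖ ^ 2)) * Real.exp (-(1 / 8) * ρ ^ 2) ≤ κ)
    (h1 : κ < gaussBlur D x) (h2 : gaussBlur D x < 1 - κ) :
    x ∈ Metric.cthickening ρ (frontier D) := by
  by_contra hcon
  have hdis : Disjoint (Metric.ball x ρ) (frontier D) := by
    refine disjoint_left.2 fun z hz hzf => hcon ?_
    exact Metric.mem_cthickening_of_dist_le x z _ _ hzf (by rw [dist_comm]; exact hz.le)
  have htail : ∫ z in (Metric.ball (0 : Plane) ρ)ᶜ, ‖gauss z‖ ≤ κ :=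
    (integral_tail_le isKernel_gauss.integrable.norm hρ.le gauss_le).trans hκ
  have hi := integrable_weight_smul (isWeight_chi hD hb).integrable continuous_gauss
    (B := 1) (fun x => (gauss_le x).trans (by
      rw [Real.exp_le_one_iff]; nlinarith [sq_nonneg ‖x‖])) x
  rcases ball_subset_or_disjoint hD hdis with hs | hs
  · have h3 := norm_smear_le_tail (f := fun z => 1 - chi D z) (x := x) (ρ := ρ)
      isKernel_gauss.integrable
      (fun z => by
        have := chi_nonneg D z; have := chi_le_one D z
        rw [_root_.abs_le]; constructor <;> linarith)
      (fun z hz => by simp [chi, hs hz])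
    have h4 : smear gauss (fun z => 1 - chi D z) x = 1 - gaussBlur D x := by
      simp only [smear, sub_smul, one_smul]
      rw [integral_sub (isKernel_gauss.integrable.comp_sub_left x) hi, integral_gauss_sub]
      rfl
    rw [h4] at h3
    have := (le_abs_self _).trans (h3.trans htail)
    linarith
  · have h3 := norm_smear_le_tail (f := chi D) (x := x) (ρ := ρ) isKernel_gauss.integrable
      (abs_chi_le D) (fun z hz => by simp [chi, disjoint_left.1 hs hz])
    have h4 := (le_abs_self _).trans (h3.trans htail)
    rw [← gaussBlur_eq_smear] at h4
    linarith

/-! ### The slope of the blurred subgraph -/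

lemma hasFDerivAt_gaussBlur {D : Set Plane} (hD : IsOpen D) (hb : Bornology.IsBounded D)
    (x : Plane) : HasFDerivAt (gaussBlur D) (smear (fderiv ℝ gauss) (chi D) x) x := by
  obtain ⟨B, hB⟩ := isKernel_gauss.bounded
  exact hasFDerivAt_smear (isWeight_chi hD hb).integrable (contDiff_gauss.of_le (by norm_num))
    (fun x => (hB x).1) (fun x => (hB x).2.1) x

lemma hasDerivAt_exp_neg_sq (p b : ℝ) :
    HasDerivAt (fun b => Real.exp (-(p - b) ^ 2 / 2)) ((p - b) * Real.exp (-(p - b) ^ 2 / 2)) b := by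
  have h1 : HasDerivAt (fun b : ℝ => -(p - b) ^ 2 / 2) (p - b) b := by
    have := ((((hasDerivAt_id b).const_sub p).pow 2).neg).div_const 2
    refine this.congr_deriv ?_
    simp
  simpa [mul_comm] using h1.exp

lemma integrable_sub_mul_exp_neg_sq (p : ℝ) :
    Integrable fun b : ℝ => (p - b) * Real.exp (-(p - b) ^ 2 / 2) := by
  have h := (integrable_mul_exp_neg_mul_sq (b := 1 / 2) (by norm_num)).comp_sub_left p
  refine h.congr (Eventually.of_forall fun b => ?_)
  change (p - b) * Real.exp (-(1 / 2) * (p - b) ^ 2) = (p - b) * Real.exp (-(p - b) ^ 2 / 2)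
  congr 2; ring

lemma integral_Iio_sub_mul_exp_neg_sq (p c : ℝ) :
    ∫ b in Iio c, (p - b) * Real.exp (-(p - b) ^ 2 / 2) = Real.exp (-(p - c) ^ 2 / 2) := by
  rw [← integral_Iic_eq_integral_Iio]
  rw [integral_Iic_of_hasDerivAt_of_tendsto' (f := fun b => Real.exp (-(p - b) ^ 2 / 2)) (m := 0)
    (fun b _ => hasDerivAt_exp_neg_sq p b) (integrable_sub_mul_exp_neg_sq p).integrableOn]
  · rw [sub_zero]
  · refine Real.tendsto_exp_atBot.comp ?_
    have h1 : Tendsto (fun b : ℝ => p - b) atBot atTop := tendsto_atBot_atTop.2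
      fun c => ⟨p - c, fun b hb => by linarith⟩
    have h2 : Tendsto (fun b : ℝ => -((p - b) ^ 2 / 2)) atBot atBot :=
      tendsto_neg_atTop_atBot.comp (((tendsto_pow_atTop two_ne_zero).comp h1).atTop_div_const
        (by norm_num))
    simpa only [neg_div] using h2

/-- The measurable equivalence of the plane with `ℝ × ℝ`. -/
noncomputable def planeEquiv : Plane ≃ᵐ ℝ × ℝ :=
  (MeasurableEquiv.toLp 2 (Fin 2 → ℝ)).symm.trans MeasurableEquiv.finTwoArrow

lemma planeEquiv_apply (x : Plane) : planeEquiv x = (x 0, x 1) := rfl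

lemma measurePreserving_planeEquiv : MeasurePreserving planeEquiv :=
  (volume_preserving_finTwoArrow ℝ).comp
    (EuclideanSpace.volume_preserving_symm_measurableEquiv_toLp (Fin 2))

/-- In the vertical variable the integrand is an exact derivative. Integrating it over the half-line
below the graph leaves the Gaussian evaluated on the graph, which is positive. -/
lemma integral_subgraph_gauss {φ : ℝ → ℝ} (hφ : Continuous φ) (p : Plane) :
    ∫ q : Plane, {q : Plane | q 1 < φ (q 0)}.indicator (fun q => gauss (p - q) * (p 1 - q 1)) q =
      ∫ s, (2 * Real.pi)⁻¹ * Real.exp (-(p 0 - s) ^ 2 / 2) * Real.exp (-(p 1 - φ s) ^ 2 / 2) ∧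
    Integrable fun s =>
      (2 * Real.pi)⁻¹ * Real.exp (-(p 0 - s) ^ 2 / 2) * Real.exp (-(p 1 - φ s) ^ 2 / 2) := by
  set S : Set (ℝ × ℝ) := {q | q.2 < φ q.1} with hS
  have hSm : MeasurableSet S := (isOpen_lt continuous_snd (hφ.comp continuous_fst)).measurableSet
  set g : ℝ × ℝ → ℝ := S.indicator fun q => (2 * Real.pi)⁻¹ * Real.exp (-(p 0 - q.1) ^ 2 / 2) *
    ((p 1 - q.2) * Real.exp (-(p 1 - q.2) ^ 2 / 2)) with hg
  have hgi : Integrable g := by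
    refine Integrable.indicator ?_ hSm
    have h1 : Integrable fun s : ℝ => (2 * Real.pi)⁻¹ * Real.exp (-(p 0 - s) ^ 2 / 2) := by
      have h := ((integrable_exp_neg_mul_sq (b := 1 / 2) (by norm_num)).comp_sub_left
        (p 0)).const_mul ((2 * Real.pi)⁻¹)
      refine h.congr (Eventually.of_forall fun b => ?_)
      simp only
      congr 2; ring
    exact h1.mul_prod (integrable_sub_mul_exp_neg_sq (p 1))
  have hcomp : ∀ q : Plane, {q : Plane | q 1 < φ (q 0)}.indicator
      (fun q => gauss (p - q) * (p 1 - q 1)) q = g (planeEquiv q) := by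
    intro q
    rw [planeEquiv_apply, hg]
    by_cases h : q 1 < φ (q 0)
    · rw [indicator_of_mem (show q ∈ {q : Plane | q 1 < φ (q 0)} from h),
        indicator_of_mem (show (q 0, q 1) ∈ S from h)]
      simp only [gauss, norm_sq_eq_coords, PiLp.sub_apply]
      rw [show -((p 0 - q 0) ^ 2 + (p 1 - q 1) ^ 2) / 2 =
        -(p 0 - q 0) ^ 2 / 2 + -(p 1 - q 1) ^ 2 / 2 by ring, Real.exp_add]
      ring
    · rw [indicator_of_notMem (show q ∉ {q : Plane | q 1 < φ (q 0)} from h),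
        indicator_of_notMem (show (q 0, q 1) ∉ S from h)]
  have hin : ∀ s, ∫ b, g (s, b) =
      (2 * Real.pi)⁻¹ * Real.exp (-(p 0 - s) ^ 2 / 2) * Real.exp (-(p 1 - φ s) ^ 2 / 2) := by
    intro s
    rw [← integral_Iio_sub_mul_exp_neg_sq (p 1) (φ s), ← integral_const_mul,
      ← integral_indicator measurableSet_Iio]
    rfl
  constructor
  · simp only [hcomp]
    rw [measurePreserving_planeEquiv.integral_comp planeEquiv.measurableEmbedding g,
      Measure.volume_eq_prod, integral_prod g hgi]
    simp only [hin]
  · have := hgi.integral_prod_left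
    simpa only [hin] using this

/-- Since the integrand over the graph is positive, it suffices to keep a unit interval of
abscissae, on which the graph stays within vertical distance κ + L of `p`. -/
lemma subgraph_slope_ge {L κ : ℝ} {φ : ℝ → ℝ} (hφ : IsLip L φ) {p : Plane}
    (hp : |p 1 - φ (p 0)| ≤ κ) :
    (2 * Real.pi)⁻¹ * Real.exp (-(1 / 2) - (κ + L) ^ 2 / 2) ≤
      ∫ q : Plane, {q : Plane | q 1 < φ (q 0)}.indicator
        (fun q => gauss (p - q) * (p 1 - q 1)) q := by
  obtain ⟨h1, h2⟩ := integral_subgraph_gauss hφ.continuous p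
  rw [h1]
  refine le_trans ?_ (setIntegral_le_integral (s := Icc (p 0) (p 0 + 1)) h2
    (Eventually.of_forall fun s => by positivity))
  have h3 : ∫ _ in Icc (p 0) (p 0 + 1), (2 * Real.pi)⁻¹ * Real.exp (-(1 / 2) - (κ + L) ^ 2 / 2) =
      (2 * Real.pi)⁻¹ * Real.exp (-(1 / 2) - (κ + L) ^ 2 / 2) := by simp
  rw [← h3]
  refine setIntegral_mono_on (integrableOn_const (by simp)) h2.integrableOn
    measurableSet_Icc fun s hs => ?_
  rw [mul_assoc, ← Real.exp_add]
  gcongr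
  have hs1 : |p 0 - s| ≤ 1 := by rw [_root_.abs_le]; constructor <;> linarith [hs.1, hs.2]
  have hs2 : |p 1 - φ s| ≤ κ + L := by
    have h4 := (hφ (p 0) s).trans (mul_le_of_le_one_right hφ.nonneg hs1)
    have := abs_sub_le (p 1) (φ (p 0)) (φ s)
    linarith
  have e1 := sq_le_sq' (_root_.abs_le.1 hs1).1 (_root_.abs_le.1 hs1).2
  have e2 := sq_le_sq' (_root_.abs_le.1 hs2).1 (_root_.abs_le.1 hs2).2
  linarith

/-- In the disc of radius r/2 about `y` the domain coincides with the full subgraph `S`, so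
replacing `D` by `S` changes the gradient by at most the tail of ∇G beyond r/2. For `S` the slope is
explicit. -/
lemma gaussBlur_slope {L δ₁ δ r : ℝ} {D : Set Plane} (hD : IsOpen D) (hb : Bornology.IsBounded D)
    {x : Plane} {e : Plane ≃ₗᵢ[ℝ] Plane} {φ : ℝ → ℝ} (hφ : IsLip L φ)
    (hch : IsGraphChart D r x e φ) {y : Plane} (hy : y ∈ graphStrip δ₁ r x e φ δ)
    (hyb : y ∈ Metric.ball x (r / 2)) :
    (2 * Real.pi)⁻¹ * Real.exp (-(1 / 2) - (δ * r + L) ^ 2 / 2) -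
        ∫ z in (Metric.ball (0 : Plane) (r / 2))ᶜ, ‖fderiv ℝ gauss z‖ ≤
      fderiv ℝ (gaussBlur D) y (-(e.symm (EuclideanSpace.single 1 1))) := by
  set n : Plane := -(e.symm (EuclideanSpace.single 1 1)) with hn
  have hn1 : ‖n‖ = 1 := by rw [hn, norm_neg, e.symm.norm_map]; simp
  obtain ⟨B, hB⟩ := isKernel_gauss.bounded
  set S : Set Plane := {z | e (z - x) 1 < φ (e (z - x) 0)} with hS
  have hSm : MeasurableSet S := (isOpen_lt (continuous_coord e x 1)
    (hφ.continuous.comp (continuous_coord e x 0))).measurableSet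
  rw [(hasFDerivAt_gaussBlur hD hb y).fderiv]
  have hKi : Integrable fun z => fderiv ℝ gauss (y - z) :=
    isKernel_gauss.integrable_fderiv.comp_sub_left y
  have hi1 : Integrable fun z => chi D z • fderiv ℝ gauss (y - z) :=
    integrable_weight_smul (isWeight_chi hD hb).integrable isKernel_gauss.continuous_fderiv
      (fun x => (hB x).2.1) y
  -- `S` is unbounded, so integrability has to come from the kernel.
  have hi2 : Integrable fun z => chi S z • fderiv ℝ gauss (y - z) := by
    have : (fun z => chi S z • fderiv ℝ gauss (y - z)) =
        S.indicator fun z => fderiv ℝ gauss (y - z) := by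
      funext z; by_cases h : z ∈ S <;> simp [chi, h]
    rw [this]
    exact hKi.indicator hSm
  have hdiff : smear (fderiv ℝ gauss) (fun z => chi S z - chi D z) y =
      smear (fderiv ℝ gauss) (chi S) y - smear (fderiv ℝ gauss) (chi D) y := by
    simp only [smear, sub_smul]
    exact integral_sub hi2 hi1
  have htail := norm_smear_le_tail (f := fun z => chi S z - chi D z) (x := y) (ρ := r / 2)
    isKernel_gauss.integrable_fderiv
    (fun z => by
      have := chi_nonneg D z; have := chi_le_one D z
      have := chi_nonneg S z; have := chi_le_one S z
      rw [_root_.abs_le]; constructor <;> linarith)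
    (fun z hz => by
      have hzx : z ∈ Metric.ball x r := by
        rw [Metric.mem_ball] at hz hyb ⊢
        linarith [dist_triangle z y x]
      have : z ∈ D ↔ z ∈ S := hch.2 z hzx
      by_cases h : z ∈ S <;> simp [chi, h, this])
  have hS1 : smear (fderiv ℝ gauss) (chi S) y n =
      ∫ q : Plane, {q : Plane | q 1 < φ (q 0)}.indicator
        (fun q => gauss (e (y - x) - q) * (e (y - x) 1 - q 1)) q := by
    have hmp : MeasurePreserving (fun z : Plane => e (z - x)) :=
      e.measurePreserving.comp (measurePreserving_sub_right volume x)
    have hme : MeasurableEmbedding (fun z : Plane => e (z - x)) :=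
      (e.toHomeomorph.measurableEmbedding).comp (MeasurableEquiv.subRight x).measurableEmbedding
    rw [← hmp.integral_comp hme, smear, ContinuousLinearMap.integral_apply hi2]
    refine integral_congr_ae (Eventually.of_forall fun z => ?_)
    simp only
    by_cases h : z ∈ S
    · rw [indicator_of_mem (show e (z - x) ∈ {q : Plane | q 1 < φ (q 0)} from h)]
      have h1 : e (y - x) - e (z - x) = e (y - z) := by rw [← map_sub]; congr 1; abel
      have h2 : gauss (e (y - z)) = gauss (y - z) := by simp [-map_sub, gauss, e.norm_map]
      have h3 : inner ℝ (y - z) n = -(e (y - z) 1) := by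
        rw [hn, inner_neg_right, ← e.inner_map_map, e.apply_symm_apply]
        simp [-map_sub, EuclideanSpace.inner_single_right]
      rw [h1, h2, ← PiLp.sub_apply, h1, fderiv_gauss]
      simp [-map_sub, chi, h, h3]
    · rw [indicator_of_notMem (show e (z - x) ∉ {q : Plane | q 1 < φ (q 0)} from h)]
      simp [chi, h]
  have hlow := subgraph_slope_ge (κ := δ * r) hφ (p := e (y - x)) (by
    rw [_root_.abs_le]; constructor <;> linarith [hy.2.1, hy.2.2])
  have h5 : smear (fderiv ℝ gauss) (chi S) y n - smear (fderiv ℝ gauss) (chi D) y n ≤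
      ∫ z in (Metric.ball (0 : Plane) (r / 2))ᶜ, ‖fderiv ℝ gauss z‖ := by
    rw [← sub_apply, ← hdiff]
    refine (le_abs_self _).trans (le_trans ?_ htail)
    have := ContinuousLinearMap.le_opNorm
      (smear (fderiv ℝ gauss) (fun z => chi S z - chi D z) y) n
    rwa [hn1, mul_one] at this
  rw [← hS1] at hlow
  linarith

/-! ### Existence of blur constants -/

lemma tendsto_exp_quadratic {a b c : ℝ} (ha : 0 < a) :
    Tendsto (fun R : ℝ => Real.exp (-a * R ^ 2 + b * R + c)) atTop (𝓝 0) := by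
  refine Real.tendsto_exp_atBot.comp ?_
  have h1 : Tendsto (fun R : ℝ => -a * R + b) atTop atBot :=
    tendsto_atBot_add_const_right _ _ ((tendsto_const_mul_atBot_of_neg (by linarith)).2 tendsto_id)
  have h2 : Tendsto (fun R : ℝ => R * (-a * R + b)) atTop atBot := tendsto_id.atTop_mul_atBot₀ h1
  refine (tendsto_atBot_add_const_right _ c h2).congr fun R => by ring

/-- The strip has height proportional to R₀, so the slope guaranteed on it decays as R₀ grows, like
exp(-(δR₀ + L)²/2). Since δ ≤ 1/8, this is slower than the tail exp(-R₀²/32), and a large R₀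
satisfies all requirements. -/
lemma exists_isBlurConst {L δ₁ δ₂ m₁ : ℝ} (hL : 0 < L) (hg : IsGeomConst L δ₁ δ₂ m₁) :
    ∃ R₀ hTil a₁ : ℝ, IsBlurConst L δ₁ m₁ (δ₂ / 4) R₀ hTil a₁ := by
  set δ := δ₂ / 4 with hδ
  have hδ0 : 0 < δ := by have := hg.δ₂_pos; positivity
  have hδ8 : δ ≤ 1 / 8 := by have := hg.δ₂_le; have := hg.δ₁_le; linarith
  have hm := hg.m₁_pos
  set C := ∫ x : Plane, Real.exp (-(1 / 8) * ‖x‖ ^ 2) with hC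
  have hC0 : 0 ≤ C := integral_nonneg fun _ => (Real.exp_pos _).le
  have hlim1 : Tendsto (fun R : ℝ => C * Real.exp (-(1 / 8 * (m₁ * δ) ^ 2) * R ^ 2 + 0 * R + 0))
      atTop (𝓝 (C * 0)) := (tendsto_exp_quadratic (by positivity)).const_mul C
  -- The quotient of tail and slope: -R²/32 + 1/2 + (R/8 + L)²/2 has leading coefficient -3/128.
  have hlim2 : Tendsto (fun R : ℝ => C * Real.exp (-(3 / 128) * R ^ 2 + L / 8 * R +
      (1 / 2 + L ^ 2 / 2))) atTop (𝓝 (C * 0)) := (tendsto_exp_quadratic (by norm_num)).const_mul C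
  rw [mul_zero] at hlim1 hlim2
  obtain ⟨R, hR1, hR2, hR3⟩ := ((eventually_ge_atTop (1 : ℝ)).and
    ((hlim1.eventually_le_const (show (0 : ℝ) < 1 / 24 by norm_num)).and
      (hlim2.eventually_le_const (show (0 : ℝ) < (2 * Real.pi)⁻¹ / 24 by positivity)))).exists
  have hR0 : 0 < R := by linarith
  set c := (2 * Real.pi)⁻¹ * Real.exp (-(1 / 2) - (δ * R + L) ^ 2 / 2) with hc
  have hc0 : 0 < c := by positivity
  have htail : ∫ z in (Metric.ball (0 : Plane) (R / 2))ᶜ, ‖fderiv ℝ gauss z‖ ≤ c / 2 / 12 := by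
    refine (integral_tail_le isKernel_gauss.integrable_fderiv.norm (by positivity)
      norm_fderiv_gauss_le).trans ?_
    rw [← hC]
    have h1 := mul_le_mul_of_nonneg_right hR3
      (Real.exp_pos (-(1 / 2) - (δ * R + L) ^ 2 / 2)).le
    rw [mul_assoc, ← Real.exp_add] at h1
    refine le_trans (mul_le_mul_of_nonneg_left (Real.exp_le_exp.2 ?_) hC0) (h1.trans_eq ?_)
    · have : (δ * R + L) ^ 2 ≤ (1 / 8 * R + L) ^ 2 := by gcongr
      nlinarith
    · rw [hc]; ring
  -- With a₁ = c/2 the tail is at most a₁/12 = c/24, and the slope c - c/24 exceeds a₁.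
  refine ⟨R, 1 / 24, c / 2, hR1, by norm_num, le_rfl, by positivity, ?_, ?_, htail⟩
  · intro D x hD h1 h2
    refine gaussBlur_layer hD.2.1 hD.1 (κ := 1 / 24) (by positivity) ?_ h1 h2
    refine le_trans (le_of_eq ?_) hR2
    rw [← hC]; congr 2; ring
  · intro D x e φ y hD hx hφ hch hy
    have hyb := (hg.strips R D x e φ δ hR0 hD hx hφ hch hδ0
      (by have := hg.δ₂_pos; linarith)).1 hy
    have := gaussBlur_slope hD.2.1 hD.1 hφ hch hy hyb
    rw [← hc] at this
    linarith

/-! ### The coherent point spread function -/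

lemma isKernel_schwartzMap (f : SchwartzMap Plane ℝ) : IsKernel f := by
  have hb : ∀ {V : Type} [NormedAddCommGroup V] [NormedSpace ℝ V] (g : SchwartzMap Plane V),
      ∃ C : ℝ, ∀ x, ‖g x‖ ≤ C := fun g => ⟨_, fun x => g.norm_le_seminorm ℝ x⟩
  have h1 : fderiv ℝ f = SchwartzMap.fderivCLM ℝ Plane ℝ f := rfl
  have h2 : fderiv ℝ (fderiv ℝ f) =
      SchwartzMap.fderivCLM ℝ Plane (Plane →L[ℝ] ℝ) (SchwartzMap.fderivCLM ℝ Plane ℝ f) := rfl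
  refine ⟨f.smooth 2, ?_, f.integrable, ?_, ?_⟩
  · obtain ⟨C0, hC0⟩ := hb f
    obtain ⟨C1, hC1⟩ := hb (SchwartzMap.fderivCLM ℝ Plane ℝ f)
    obtain ⟨C2, hC2⟩ := hb (SchwartzMap.fderivCLM ℝ Plane (Plane →L[ℝ] ℝ)
      (SchwartzMap.fderivCLM ℝ Plane ℝ f))
    refine ⟨max C0 (max C1 C2), fun x => ⟨(hC0 x).trans (le_max_left _ _), ?_, ?_⟩⟩
    · exact (hC1 x).trans ((le_max_left _ _).trans (le_max_right _ _))
    · exact (hC2 x).trans ((le_max_right _ _).trans (le_max_right _ _))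
  · rw [h1]; exact (SchwartzMap.fderivCLM ℝ Plane ℝ f).integrable
  · rw [h2]
    exact (SchwartzMap.fderivCLM ℝ Plane (Plane →L[ℝ] ℝ)
      (SchwartzMap.fderivCLM ℝ Plane ℝ f)).integrable

open scoped FourierTransform in
lemma fourierT_eq (f : Plane → ℝ) (x : Plane) :
    fourierT f x = 𝓕 (fun ξ => (f ξ : ℂ)) ((2 * Real.pi)⁻¹ • x) := by
  rw [Real.fourier_eq', fourierT]
  refine integral_congr_ae (Eventually.of_forall fun ξ => ?_)
  simp only [smul_eq_mul]
  rw [mul_comm]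
  congr 2
  rw [real_inner_smul_right, real_inner_comm]
  push_cast
  have : (Real.pi : ℂ) ≠ 0 := by exact_mod_cast Real.pi_ne_zero
  field_simp

-- `T` is, up to a dilation and a factor, the real part of the Fourier transform of a test function,
-- hence a Schwartz function; this gives all the qualitative properties at once.
open scoped FourierTransform in
lemma IsPointSpread.isKernel {δTil s₀ : ℝ} {THat T : Plane → ℝ}
    (h : IsPointSpread δTil s₀ THat T) : IsKernel T := by
  have hc : HasCompactSupport fun ξ => (THat ξ : ℂ) :=
    h.compactSupport.comp_left Complex.ofReal_zero
  have hs : ContDiff ℝ (⊤ : ℕ∞) fun ξ => (THat ξ : ℂ) := Complex.ofRealCLM.contDiff.comp h.smooth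
  let g : SchwartzMap Plane ℂ := hc.toSchwartzMap hs
  have h2π : (2 * Real.pi)⁻¹ ≠ 0 := by positivity
  let S : SchwartzMap Plane ℂ := SchwartzMap.compCLMOfContinuousLinearEquiv ℝ
    (ContinuousLinearEquiv.smulLeft (Units.mk0 ((2 * Real.pi)⁻¹) h2π)) (𝓕 g)
  let c : ℝ := (2 * Real.pi)⁻¹ ^ 2
  let P : SchwartzMap Plane ℝ := SchwartzMap.postcompCLM (c • Complex.reCLM) S
  have hT : T = P := by
    funext x
    have h1 : ((2 * Real.pi : ℝ) : ℂ)⁻¹ ^ 2 = (c : ℂ) := by simp only [c]; push_cast; rfl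
    have h2 := congrArg Complex.re (h.inversion x)
    rw [Complex.ofReal_re, h1, Complex.re_ofReal_mul, fourierT_eq] at h2
    exact h2
  rw [hT]
  exact isKernel_schwartzMap P

lemma norm_fderiv_fderiv_eq (f : Plane → ℝ) (x : Plane) :
    ‖fderiv ℝ (fderiv ℝ f) x‖ = ‖iteratedFDeriv ℝ 2 f x‖ := by
  rw [← norm_iteratedFDeriv_fderiv, ← norm_iteratedFDeriv_fderiv, norm_iteratedFDeriv_zero]

/-- Only the last bound involves D²(T - G); the others are controlled by `δTil` and the Gaussian. -/
lemma IsPointSpread.norm_bounds {δTil s₀ : ℝ} {THat T : Plane → ℝ}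
    (h : IsPointSpread δTil s₀ THat T) :
    (∫ x, ‖T x - gauss x‖ ≤ δTil) ∧
    (∫ x, ‖fderiv ℝ (fun y => T y - gauss y) x‖ ≤ δTil) ∧
    (∫ x, ‖T x‖ ≤ 1 + δTil) ∧
    (∫ x, ‖fderiv ℝ T x‖ ≤ (∫ x, ‖fderiv ℝ gauss x‖) + δTil) ∧
    ∫ x, ‖fderiv ℝ (fderiv ℝ T) x‖ ≤ (∫ x, ‖fderiv ℝ (fderiv ℝ gauss) x‖) +
      normD2 (fun x => T x - gauss x) := by
  have hT := h.isKernel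
  have hG := isKernel_gauss
  have hd := hT.sub hG
  have hc := h.close
  have p0 : 0 ≤ ∫ x, |T x - gauss x| := integral_nonneg fun _ => abs_nonneg _
  have p1 : 0 ≤ ∫ x, ‖fderiv ℝ (fun y => T y - gauss y) x‖ := integral_nonneg fun _ => norm_nonneg _
  unfold normW11 at hc
  have e0 : ∫ x, ‖T x - gauss x‖ ≤ δTil := by
    simp only [Real.norm_eq_abs]; linarith
  have e1 : ∫ x, ‖fderiv ℝ (fun y => T y - gauss y) x‖ ≤ δTil := by linarith
  have key : ∀ {V : Type} [NormedAddCommGroup V] (f g : Plane → V), Integrable f → Integrable g →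
      ∫ x, ‖f x‖ ≤ (∫ x, ‖g x‖) + ∫ x, ‖f x - g x‖ := by
    intro V _ f g hf hg
    have hfg : Integrable fun x => ‖f x - g x‖ := (hf.sub hg).norm
    rw [← integral_add hg.norm hfg]
    refine integral_mono hf.norm (hg.norm.add hfg) fun x => ?_
    have := norm_add_le (g x) (f x - g x)
    rwa [add_sub_cancel] at this
  refine ⟨e0, e1, ?_, ?_, ?_⟩
  · have h1 := key T gauss hT.integrable hG.integrable
    have h2 : ∫ x, ‖gauss x‖ = 1 := by
      rw [← integral_gauss]
      exact integral_congr_ae (Eventually.of_forall fun x => Real.norm_of_nonneg (gauss_pos x).le)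
    linarith
  · have h1 := key _ _ hT.integrable_fderiv hG.integrable_fderiv
    rw [hT.fderiv_sub hG] at e1
    linarith
  · have h1 := key _ _ hT.integrable_fderiv_fderiv hG.integrable_fderiv_fderiv
    have h2 : ∀ x, ‖fderiv ℝ (fderiv ℝ T) x - fderiv ℝ (fderiv ℝ gauss) x‖ =
        ‖iteratedFDeriv ℝ 2 (fun x => T x - gauss x) x‖ := by
      intro x
      rw [← norm_fderiv_fderiv_eq, hT.fderiv_fderiv_sub hG]
    simp only [h2] at h1
    exact h1

/-! ### The mutual intensity -/

lemma summable_besselJOne (t : ℝ) : Summable fun m : ℕ =>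
    (-1 : ℝ) ^ m / ((m.factorial : ℝ) * ((m + 1).factorial : ℝ)) * (t / 2) ^ (2 * m + 1) := by
  have h1 : Summable fun m : ℕ => |t / 2| * (((t / 2) ^ 2) ^ m / (m.factorial : ℝ)) :=
    (Real.summable_pow_div_factorial ((t / 2) ^ 2)).mul_left _
  refine Summable.of_norm_bounded h1 fun m => ?_
  rw [norm_mul, norm_div, norm_pow, norm_neg, norm_one, one_pow, norm_pow, Real.norm_eq_abs,
    Real.norm_eq_abs, abs_of_pos (by positivity), pow_succ, pow_mul, sq_abs]
  have h2 : (1 : ℝ) / ((m.factorial : ℝ) * ((m + 1).factorial : ℝ)) ≤ 1 / (m.factorial : ℝ) := by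
    gcongr
    have : (1 : ℝ) ≤ ((m + 1).factorial : ℝ) := by
      exact_mod_cast Nat.succ_le_of_lt (Nat.factorial_pos _)
    have h3 : (0 : ℝ) < (m.factorial : ℝ) := by positivity
    nlinarith
  calc 1 / ((m.factorial : ℝ) * ((m + 1).factorial : ℝ)) * (((t / 2) ^ 2) ^ m * |t / 2|)
      ≤ 1 / (m.factorial : ℝ) * (((t / 2) ^ 2) ^ m * |t / 2|) := by gcongr
    _ = _ := by ring

lemma measurable_besselJOne : Measurable besselJOne := by
  refine measurable_of_tendsto_metrizable (f := fun (n : ℕ) (t : ℝ) => ∑ m ∈ Finset.range n,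
    (-1 : ℝ) ^ m / ((m.factorial : ℝ) * ((m + 1).factorial : ℝ)) * (t / 2) ^ (2 * m + 1))
    (fun n => by fun_prop) ?_
  exact tendsto_pi_nhds.2 fun t => (summable_besselJOne t).hasSum.tendsto_sum_nat

/-- y/2 is the leading term of the series; the rest is dominated by (y/2)³ times a geometric series
of ratio 1/4. -/
lemma abs_besselJOne_sub_le {y : ℝ} (h0 : 0 ≤ y) (h1 : y ≤ 1) :
    |besselJOne y - y / 2| ≤ y ^ 3 / 6 := by
  have hs := summable_besselJOne y
  have e1 : besselJOne y - y / 2 = ∑' m : ℕ, (-1 : ℝ) ^ (m + 1) / (((m + 1).factorial : ℝ) *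
      ((m + 1 + 1).factorial : ℝ)) * (y / 2) ^ (2 * (m + 1) + 1) := by
    rw [besselJOne, hs.tsum_eq_zero_add]
    simp
  have hg : HasSum (fun m : ℕ => (y / 2) ^ 3 * (1 / 4 : ℝ) ^ m)
      ((y / 2) ^ 3 * (1 - 1 / 4)⁻¹) :=
    (hasSum_geometric_of_lt_one (by norm_num) (by norm_num)).mul_left _
  rw [e1, ← Real.norm_eq_abs]
  refine (tsum_of_norm_bounded hg fun m => ?_).trans_eq (by ring)
  rw [norm_mul, norm_div, norm_pow, norm_neg, norm_one, one_pow, norm_pow, Real.norm_eq_abs,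
    Real.norm_eq_abs, abs_of_pos (by positivity), abs_of_nonneg (by positivity)]
  have h2 : (1 : ℝ) / (((m + 1).factorial : ℝ) * ((m + 1 + 1).factorial : ℝ)) ≤ 1 := by
    rw [div_le_one (by positivity)]
    exact_mod_cast Nat.succ_le_of_lt (Nat.mul_pos (Nat.factorial_pos _) (Nat.factorial_pos _))
  calc 1 / (((m + 1).factorial : ℝ) * ((m + 1 + 1).factorial : ℝ)) * (y / 2) ^ (2 * (m + 1) + 1)
      ≤ 1 * (y / 2) ^ (2 * (m + 1) + 1) := by gcongr
    _ = (y / 2) ^ 3 * ((y / 2) ^ 2) ^ m := by rw [← pow_mul, ← pow_add]; ring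
    _ ≤ (y / 2) ^ 3 * (1 / 4) ^ m := by
        gcongr
        nlinarith

lemma measurable_mutualIntensity (s σ : ℝ) : Measurable (mutualIntensity s σ) := by
  unfold mutualIntensity
  refine Measurable.ite (measurableSet_singleton 0) measurable_const ?_
  exact ((measurable_besselJOne.comp (measurable_const.mul measurable_norm)).const_mul 2).div
    (measurable_const.mul measurable_norm)

/-- With y = (σ/s)|x| the deviation is at most y²/3. -/
lemma abs_mutualIntensity_sub_one_le {s σ ε : ℝ} {x : Plane} (hκ : 0 < σ / s)
    (hε : ε ≤ 1) (hx : σ / s * ‖x‖ ≤ ε) : |mutualIntensity s σ x - 1| ≤ ε := by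
  have hy0 : 0 ≤ σ / s * ‖x‖ := by positivity
  unfold mutualIntensity
  split_ifs with h
  · simpa using hy0.trans hx
  · have hy : 0 < σ / s * ‖x‖ := mul_pos hκ (norm_pos_iff.2 h)
    set y := σ / s * ‖x‖
    have h1 := abs_besselJOne_sub_le hy0 (hx.trans hε)
    have h2 : 2 * besselJOne y / y - 1 = 2 / y * (besselJOne y - y / 2) := by field_simp
    rw [h2, abs_mul, abs_of_pos (by positivity)]
    calc 2 / y * |besselJOne y - y / 2| ≤ 2 / y * (y ^ 3 / 6) := by gcongr
      _ = y * y / 3 := by field_simp; ring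
      _ ≤ ε := by nlinarith

/-! ### Rescaling -/

lemma integral_eq_smul_scale {t : ℝ} (ht : 0 < t) (f : Plane → ℝ) :
    ∫ x, f x = t ^ 2 * ∫ x, f (t • x) := by
  rw [Measure.integral_comp_smul]
  simp only [finrank_euclideanSpace, Fintype.card_fin, smul_eq_mul]
  rw [abs_of_pos (by positivity)]
  field_simp

/-- The weight in the double integral for the rescaled intensity. -/
noncomputable def pairWeight (b w : Plane → ℝ) (z : Plane × Plane) : ℝ :=
  w z.1 * w z.2 * b (z.1 - z.2)

section PairWeight

variable {b w : Plane → ℝ} {ρ ε : ℝ}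

lemma abs_pairWeight_sub_le (hw : IsWeight w) (hs : ∀ x ∉ Metric.ball (0 : Plane) ρ, w x = 0)
    (hε : 0 ≤ ε) (hb : ∀ ξ ∈ Metric.ball (0 : Plane) ρ, ∀ η ∈ Metric.ball (0 : Plane) ρ,
      |b (ξ - η) - 1| ≤ ε) (z : Plane × Plane) :
    |pairWeight b w z - w z.1 * w z.2| ≤ ε := by
  have h : pairWeight b w z - w z.1 * w z.2 = w z.1 * w z.2 * (b (z.1 - z.2) - 1) := by
    unfold pairWeight; ring
  rw [h]
  by_cases h1 : z.1 ∈ Metric.ball (0 : Plane) ρ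
  · by_cases h2 : z.2 ∈ Metric.ball (0 : Plane) ρ
    · rw [abs_mul, abs_mul]
      have h3 := mul_le_one₀ (hw.abs_le z.1) (abs_nonneg _) (hw.abs_le z.2)
      exact (mul_le_of_le_one_left (abs_nonneg _) h3).trans (hb _ h1 _ h2)
    · simp [hs _ h2, hε]
  · simp [hs _ h1, hε]

lemma measurable_pairWeight (hb : Measurable b) (hw : Measurable w) :
    Measurable (pairWeight b w) :=
  ((hw.comp measurable_fst).mul (hw.comp measurable_snd)).mul
    (hb.comp (measurable_fst.sub measurable_snd))

lemma integrable_pairWeight (hbm : Measurable b) (hw : IsWeight w)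
    (hs : ∀ x ∉ Metric.ball (0 : Plane) ρ, w x = 0)
    (hb : ∀ ξ ∈ Metric.ball (0 : Plane) ρ, ∀ η ∈ Metric.ball (0 : Plane) ρ,
      |b (ξ - η) - 1| ≤ 1) : Integrable (pairWeight b w) := by
  have hi : Integrable fun z : Plane × Plane => w z.1 * w z.2 :=
    hw.integrable.mul_prod hw.integrable
  refine (hi.norm.const_mul 2).mono' (measurable_pairWeight hbm hw.measurable).aestronglyMeasurable
    (Eventually.of_forall fun z => ?_)
  unfold pairWeight
  by_cases h1 : z.1 ∈ Metric.ball (0 : Plane) ρ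
  · by_cases h2 : z.2 ∈ Metric.ball (0 : Plane) ρ
    · rw [norm_mul, mul_comm]
      have h3 := _root_.abs_le.1 (hb _ h1 _ h2)
      gcongr
      rw [Real.norm_eq_abs, _root_.abs_le]
      constructor <;> linarith
    · simp [hs _ h2]
  · simp [hs _ h1]

end PairWeight

lemma intensity_congr {T u u' : Plane → ℝ} (s₀ s σ : ℝ) (h : u =ᵐ[volume] u') :
    intensity T s₀ s σ u = intensity T s₀ s σ u' := by
  funext x
  unfold intensity
  refine integral_congr_ae ?_
  filter_upwards [h] with ξ hξ
  refine integral_congr_ae ?_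
  filter_upwards [h] with η hη
  rw [hξ, hη]

/-- Substituting tξ and tη produces the Jacobian t² twice, which cancels the two factors t⁻² in the
rescaled kernels. -/
lemma intensity_eq_pairSmear {T u : Plane → ℝ} (hT : IsKernel T) {s₀ s σ t : ℝ} (ht : 0 < t)
    (hst : s * s₀ = t)
    (hi : Integrable (pairWeight (fun z => mutualIntensity s σ (t • z)) fun x => u (t • x)))
    (x : Plane) :
    intensity T s₀ s σ u x =
      pairSmear T (pairWeight (fun z => mutualIntensity s σ (t • z)) fun x => u (t • x))
        (t⁻¹ • x) := by
  obtain ⟨B, -, hB⟩ := exists_pair_bound hT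
  set a := pairWeight (fun z => mutualIntensity s σ (t • z)) fun x => u (t • x) with ha
  have hint : Integrable fun z : Plane × Plane =>
      a z • (T (t⁻¹ • x - z.1) * T (t⁻¹ • x - z.2)) :=
    integrable_smul_of_bound hi
      ((continuous_pair hT).comp (Continuous.prodMk_right (t⁻¹ • x))).aestronglyMeasurable
      fun z => (hB (t⁻¹ • x) z).1
  rw [pairSmear, Measure.volume_eq_prod, integral_prod _ hint, intensity,
    integral_eq_smul_scale ht, ← integral_const_mul]
  refine integral_congr_ae (Eventually.of_forall fun ξ => ?_)
  simp only
  rw [integral_eq_smul_scale ht, ← integral_const_mul, ← integral_const_mul]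
  refine integral_congr_ae (Eventually.of_forall fun η => ?_)
  have h1 : ∀ z : Plane, t⁻¹ • (x - t • z) = t⁻¹ • x - z := fun z => by
    rw [smul_sub, inv_smul_smul₀ ht.ne']
  simp only [rescale, hst, h1, ha, pairWeight, smul_eq_mul, ← smul_sub]
  field_simp

/-- Masks have measurable representatives with values in `[0, 1]` that vanish off the disc. -/
lemma exists_clean_mask {u : Plane → ℝ} {R : ℝ} (hu : u ∈ unitMasks R) :
    ∃ u' : Plane → ℝ, u =ᵐ[volume] u' ∧ Measurable u' ∧ (∀ x, 0 ≤ u' x) ∧ (∀ x, u' x ≤ 1) ∧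
      ∀ x ∉ Metric.ball (0 : Plane) R, u' x = 0 := by
  obtain ⟨hi, h0, h1⟩ := hu
  set g := hi.aestronglyMeasurable.mk u with hg
  have hgm : Measurable g := hi.aestronglyMeasurable.stronglyMeasurable_mk.measurable
  refine ⟨(Metric.ball (0 : Plane) R).indicator fun x => max 0 (min 1 (g x)), ?_,
    (measurable_const.max (measurable_const.min hgm)).indicator measurableSet_ball, ?_, ?_, ?_⟩
  · filter_upwards [h0, h1, hi.aestronglyMeasurable.ae_eq_mk] with x hx0 hx1 hxg
    by_cases hx : x ∈ Metric.ball (0 : Plane) R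
    · rw [indicator_of_mem hx, hg, ← hxg, min_eq_right (hx1 hx).2, max_eq_right (hx1 hx).1]
    · rw [indicator_of_notMem hx, hx0 hx]
  · exact fun x => indicator_nonneg (fun _ _ => le_max_left _ _) _
  · intro x
    refine indicator_apply_le' (fun _ => ?_) fun _ => zero_le_one
    exact max_le zero_le_one (min_le_left _ _)
  · exact fun x hx => indicator_of_notMem hx _

/-- The dilated chart function t⁻¹φ(t·) has the same Lipschitz constant, so only the radius changes.
This brings a mask of scale tR₀ to the scale R₀ of the blur constants. -/
lemma IsLipschitzDomain.scale {r L t : ℝ} {D : Set Plane} (h : IsLipschitzDomain (t * r) L D)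
    (ht : 0 < t) : IsLipschitzDomain r L {x | t • x ∈ D} := by
  obtain ⟨hb, ho, hc⟩ := h
  have hcont : Continuous fun x : Plane => t • x := by fun_prop
  refine ⟨?_, ho.preimage hcont, ?_⟩
  · obtain ⟨ρ, hρ⟩ := hb.subset_ball 0
    refine (Metric.isBounded_ball (x := (0 : Plane)) (r := t⁻¹ * ρ)).subset fun x hx => ?_
    have := hρ hx
    rw [mem_ball_zero_iff, norm_smul, Real.norm_of_nonneg ht.le] at this
    rw [mem_ball_zero_iff, inv_mul_eq_div, lt_div_iff₀ ht]
    linarith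
  · intro x hx
    have hx' : t • x ∈ frontier D := by
      have := (Homeomorph.smulOfNeZero (α := Plane) t ht.ne').preimage_frontier D
      have h2 : x ∈ frontier ((Homeomorph.smulOfNeZero (α := Plane) t ht.ne') ⁻¹' D) := hx
      rw [← this] at h2
      exact h2
    obtain ⟨e, φ, hφ, h0, hch⟩ := hc _ hx'
    refine ⟨e, fun a => t⁻¹ * φ (t * a), ?_, ?_, ?_⟩
    · intro a b
      rw [← mul_sub, abs_mul, abs_of_pos (by positivity)]
      have := hφ (t * a) (t * b)
      rw [← mul_sub, abs_mul, abs_of_pos ht] at this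
      calc t⁻¹ * |φ (t * a) - φ (t * b)| ≤ t⁻¹ * (L * (t * |a - b|)) := by gcongr
        _ = L * |a - b| := by field_simp
    · simp [h0]
    · intro y hy
      have hy' : t • y ∈ Metric.ball (t • x) (t * r) := by
        rw [Metric.mem_ball, dist_smul₀, Real.norm_of_nonneg ht.le]
        exact mul_lt_mul_of_pos_left hy ht
      have := hch _ hy'
      rw [← smul_sub, map_smul, PiLp.smul_apply, PiLp.smul_apply, smul_eq_mul, smul_eq_mul] at this
      refine this.trans ?_
      change _ ↔ _ < t⁻¹ * _
      rw [inv_mul_eq_div, lt_div_iff₀ ht, mul_comm]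

/-! ### Level sets with a uniform slope -/

/-- `F` is of class `C²` with bounds `C` and `Λ` for its derivatives, and near each point
where `|F - h| ≤ ε` it has slope at least `c` in a fixed direction on a disc of radius `ρ`. -/
structure HasSlope (F : Plane → ℝ) (h ε c C Λ ρ : ℝ) : Prop where
  contDiff : ContDiff ℝ 2 F
  grad_le : ∀ x, ‖fderiv ℝ F x‖ ≤ C
  hess_le : ∀ x, ‖fderiv ℝ (fderiv ℝ F) x‖ ≤ Λ
  slope : ∀ x, |F x - h| ≤ ε → ∃ e : Plane ≃ₗᵢ[ℝ] Plane, ∀ y ∈ Metric.ball x ρ,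
    c ≤ fderiv ℝ F y (-(e.symm (EuclideanSpace.single 1 1)))

lemma HasSlope.differentiable {F : Plane → ℝ} {h ε c C Λ ρ : ℝ} (hF : HasSlope F h ε c C Λ ρ) :
    Differentiable ℝ F := hF.contDiff.differentiable (by norm_num)

lemma HasSlope.differentiable_fderiv {F : Plane → ℝ} {h ε c C Λ ρ : ℝ}
    (hF : HasSlope F h ε c C Λ ρ) : Differentiable ℝ (fderiv ℝ F) :=
  (hF.contDiff.fderiv_right (m := 1) (by norm_num)).differentiable (by norm_num)

lemma norm_sub_le_of_norm_fderiv_le {V : Type} [NormedAddCommGroup V] [NormedSpace ℝ V]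
    {f : Plane → V} (hf : Differentiable ℝ f) {C : ℝ} (hC : ∀ x, ‖fderiv ℝ f x‖ ≤ C)
    (x y : Plane) : ‖f x - f y‖ ≤ C * ‖x - y‖ :=
  Convex.norm_image_sub_le_of_norm_fderiv_le (𝕜 := ℝ) (s := univ) (fun z _ => hf z)
    (fun z _ => hC z) convex_univ (mem_univ y) (mem_univ x)

/-- A bounded smooth function that is the identity near the origin. -/
lemma exists_bounded_identity {a₀ : ℝ} (h : 0 < a₀) : ∃ (τ : ℝ → ℝ) (K : ℝ), 0 < K ∧
    Differentiable ℝ τ ∧ (∀ a, |a| ≤ a₀ / 2 → τ a = a) ∧ (∀ a, |τ a| ≤ a₀) ∧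
    (∀ a, |deriv τ a| ≤ K) ∧ (∀ a b, |τ a - τ b| ≤ K * |a - b|) ∧
    ∀ a b, |deriv τ a - deriv τ b| ≤ K * |a - b| := by
  let β : ContDiffBump (0 : ℝ) := ⟨a₀ / 2, a₀, by positivity, by linarith⟩
  set τ : ℝ → ℝ := fun a => a * β a with hτ
  have hs : ContDiff ℝ 2 τ := contDiff_id.mul β.contDiff
  have hc : HasCompactSupport τ := β.hasCompactSupport.mul_left
  have hs1 : ContDiff ℝ 1 (deriv τ) := by
    have : ContDiff ℝ (1 + 1) τ := by norm_num; exact hs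
    exact (contDiff_succ_iff_deriv.1 this).2.2
  have hd : Differentiable ℝ τ := hs.differentiable (by norm_num)
  have hd1 : Differentiable ℝ (deriv τ) := hs1.differentiable (by norm_num)
  obtain ⟨K1, hK1⟩ := hs1.continuous.bounded_above_of_compact_support hc.deriv
  obtain ⟨K2, hK2⟩ := (hs1.continuous_deriv le_rfl).bounded_above_of_compact_support hc.deriv.deriv
  have lip : ∀ {f : ℝ → ℝ} {K : ℝ}, Differentiable ℝ f → (∀ x, ‖deriv f x‖ ≤ K) →
      ∀ a b, |f a - f b| ≤ K * |a - b| := fun hf hK a b =>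
    Convex.norm_image_sub_le_of_norm_deriv_le (s := univ) (fun z _ => hf z)
      (fun z _ => hK z) convex_univ (mem_univ b) (mem_univ a)
  refine ⟨τ, max 1 (max K1 K2), by positivity, hd, ?_, ?_, ?_, ?_, ?_⟩
  · intro a ha
    have : β a = 1 := β.one_of_mem_closedBall (by simpa using ha)
    simp [hτ, this]
  · intro a
    by_cases ha : |a| < a₀
    · rw [hτ, abs_mul, abs_of_nonneg β.nonneg]
      exact (mul_le_of_le_one_right (abs_nonneg _) β.le_one).trans ha.le
    · have : β a = 0 := β.zero_of_le_dist (by simpa using ha)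
      simp [hτ, this, h.le]
  · exact fun a => (hK1 a).trans ((le_max_left _ _).trans (le_max_right _ _))
  · intro a b
    refine (lip hd hK1 a b).trans ?_
    gcongr
    exact (le_max_left _ _).trans (le_max_right _ _)
  · intro a b
    refine (lip hd1 hK2 a b).trans ?_
    gcongr
    exact (le_max_right _ _).trans (le_max_right _ _)

/-- Pairs at distance at most 1 use the Lipschitz bound of the derivative, the others its supremum;
together they cost M + 2B in the Hölder seminorm. -/
lemma holderOneNormLE_of_lipschitz {ψ ψ' : ℝ → ℝ} {α A B M : ℝ} (hα : 0 < α) (hα1 : α ≤ 1)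
    (hd : ∀ a, HasDerivAt ψ (ψ' a) a) (hA : ∀ a, |ψ a| ≤ A) (hB : ∀ a, |ψ' a| ≤ B)
    (hM : ∀ a b, |ψ' a - ψ' b| ≤ M * |a - b|) :
    HolderOneNormLE α (A + B + (M + 2 * B)) ψ := by
  have hder : deriv ψ = ψ' := funext fun a => (hd a).deriv
  have hB0 : 0 ≤ B := (abs_nonneg _).trans (hB 0)
  have hM0 : 0 ≤ M := by simpa using (abs_nonneg _).trans (hM 1 0)
  refine ⟨?_, A, B, M + 2 * B, le_rfl, hA, hder ▸ hB, ?_⟩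
  · rw [contDiff_one_iff_deriv, hder]
    refine ⟨fun a => (hd a).differentiableAt, ?_⟩
    exact (LipschitzWith.of_dist_le_mul (K := M.toNNReal) fun a b => by
      simpa [Real.dist_eq, Real.coe_toNNReal _ hM0] using hM a b).continuous
  · intro a b
    rw [hder]
    rcases le_total |a - b| 1 with h1 | h1
    · have h2 : |a - b| ≤ |a - b| ^ α := by
        simpa using Real.rpow_le_rpow_of_exponent_ge' (abs_nonneg (a - b)) h1 hα.le hα1
      calc |ψ' a - ψ' b| ≤ M * |a - b| := hM a b
        _ ≤ (M + 2 * B) * |a - b| ^ α := by gcongr; linarith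
    · have h2 : 1 ≤ |a - b| ^ α := Real.one_le_rpow h1 hα.le
      have h3 := abs_sub (ψ' a) (ψ' b)
      have := hB a
      have := hB b
      calc |ψ' a - ψ' b| ≤ (M + 2 * B) * 1 := by linarith
        _ ≤ (M + 2 * B) * |a - b| ^ α := by gcongr

/-! ### The implicit function -/

section Implicit

variable {F : Plane → ℝ} {x e₁ e₂ : Plane} {c C Λ ρ h K : ℝ} {τ : ℝ → ℝ}

/-- The curved coordinates `x + τ(a) e₁ + b e₂`. -/
noncomputable def coordPt (x e₁ e₂ : Plane) (τ : ℝ → ℝ) (a b : ℝ) : Plane :=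
  x + τ a • e₁ + b • e₂

lemma coordPt_mem_ball (h1 : ‖e₁‖ = 1) (h2 : ‖e₂‖ = 1) {a b : ℝ} (hρ : 0 < ρ)
    (ha : |τ a| ≤ ρ / 4) (hb : |b| ≤ ρ / 2) : coordPt x e₁ e₂ τ a b ∈ Metric.ball x ρ := by
  rw [Metric.mem_ball, dist_eq_norm, coordPt, add_assoc, add_sub_cancel_left]
  refine (norm_add_le _ _).trans_lt ?_
  rw [norm_smul, norm_smul, h1, h2, Real.norm_eq_abs, Real.norm_eq_abs]
  linarith

lemma norm_coordPt_sub_le (h1 : ‖e₁‖ = 1) (h2 : ‖e₂‖ = 1) (a b a' b' : ℝ) :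
    ‖coordPt x e₁ e₂ τ a b - coordPt x e₁ e₂ τ a' b'‖ ≤ |τ a - τ a'| + |b - b'| := by
  have : coordPt x e₁ e₂ τ a b - coordPt x e₁ e₂ τ a' b' = (τ a - τ a') • e₁ + (b - b') • e₂ := by
    unfold coordPt; module
  rw [this]
  refine (norm_add_le _ _).trans_eq ?_
  rw [norm_smul, norm_smul, h1, h2, mul_one, mul_one]
  rfl

lemma coordPt_strict_decrease (hF : Differentiable ℝ F)
    (hs : ∀ y ∈ Metric.ball x ρ, fderiv ℝ F y e₂ ≤ -c) (h1 : ‖e₁‖ = 1) (h2 : ‖e₂‖ = 1)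
    (hρ : 0 < ρ) {a : ℝ} (ha : |τ a| ≤ ρ / 4) {b b' : ℝ} (hb : -(ρ / 2) ≤ b) (hbb : b ≤ b')
    (hb' : b' ≤ ρ / 2) :
    F (coordPt x e₁ e₂ τ a b') - F (coordPt x e₁ e₂ τ a b) ≤ -c * (b' - b) := by
  have hd : ∀ s, HasDerivAt (fun s => F (coordPt x e₁ e₂ τ a s))
      (fderiv ℝ F (coordPt x e₁ e₂ τ a s) e₂) s := by
    intro s
    have h3 : HasDerivAt (fun s => coordPt x e₁ e₂ τ a s) e₂ s := by
      have := ((hasDerivAt_id s).smul_const e₂).const_add (x + τ a • e₁)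
      simpa [coordPt] using this
    exact (hF _).hasFDerivAt.comp_hasDerivAt s h3
  refine Convex.image_sub_le_mul_sub_of_deriv_le (convex_Icc (-(ρ / 2)) (ρ / 2))
    (fun s _ => (hd s).continuousAt.continuousWithinAt)
    (fun s _ => (hd s).differentiableAt.differentiableWithinAt) (fun s hs' => ?_) b
    ⟨hb, hbb.trans hb'⟩ b' ⟨hb.trans hbb, hb'⟩ hbb
  rw [(hd s).deriv]
  have hs2 := interior_subset hs'
  exact hs _ (coordPt_mem_ball h1 h2 hρ ha (_root_.abs_le.2 hs2))

/-- A horizontal shift of at most cρ/(4C) moves F by at most cρ/4, while moving up or down by ρ/2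
changes it by at least cρ/2 in the respective direction. The level h is crossed in between. -/
lemma exists_implicit (hF : Differentiable ℝ F) (hC : ∀ y, ‖fderiv ℝ F y‖ ≤ C) (hC0 : 0 < C)
    (hc : 0 < c) (hcC : c ≤ C)
    (hs : ∀ y ∈ Metric.ball x ρ, fderiv ℝ F y e₂ ≤ -c) (h1 : ‖e₁‖ = 1) (h2 : ‖e₂‖ = 1)
    (hρ : 0 < ρ) (hx : F x = h) (hτ : ∀ a, |τ a| ≤ c * ρ / (4 * C)) (a : ℝ) :
    ∃ b, |b| ≤ ρ / 2 ∧ F (coordPt x e₁ e₂ τ a b) = h := by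
  have hle : c * ρ / (4 * C) ≤ ρ / 4 := by
    rw [div_le_div_iff₀ (by positivity) (by norm_num)]
    nlinarith
  have hτ' := (hτ a).trans hle
  have h0 : |F (coordPt x e₁ e₂ τ a 0) - h| ≤ c * ρ / 4 := by
    rw [← hx]
    refine (norm_sub_le_of_norm_fderiv_le hF hC _ x).trans ?_
    have : coordPt x e₁ e₂ τ a 0 - x = τ a • e₁ := by unfold coordPt; module
    rw [this, norm_smul, h1, mul_one, Real.norm_eq_abs]
    calc C * |τ a| ≤ C * (c * ρ / (4 * C)) := by gcongr; exact hτ a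
      _ = c * ρ / 4 := by field_simp
  have h0' := _root_.abs_le.1 h0
  have hp := coordPt_strict_decrease hF hs h1 h2 hρ hτ' (b := 0) (b' := ρ / 2) (by linarith)
    (by linarith) le_rfl
  have hm := coordPt_strict_decrease hF hs h1 h2 hρ hτ' (b := -(ρ / 2)) (b' := 0) le_rfl
    (by linarith) (by linarith)
  have hcρ : 0 < c * ρ := by positivity
  have hcont : ContinuousOn (fun b => F (coordPt x e₁ e₂ τ a b)) (Icc (-(ρ / 2)) (ρ / 2)) := by
    have : Continuous fun b => coordPt x e₁ e₂ τ a b := by unfold coordPt; fun_prop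
    exact (hF.continuous.comp this).continuousOn
  obtain ⟨b, hb, hbh⟩ := intermediate_value_Icc' (by linarith) hcont
    (show h ∈ Icc _ _ from ⟨by linarith, by linarith⟩)
  exact ⟨b, _root_.abs_le.2 hb, hbh⟩

variable {ψ : ℝ → ℝ}

lemma implicit_lt_iff (hF : Differentiable ℝ F) (hc : 0 < c)
    (hs : ∀ y ∈ Metric.ball x ρ, fderiv ℝ F y e₂ ≤ -c) (h1 : ‖e₁‖ = 1) (h2 : ‖e₂‖ = 1)
    (hρ : 0 < ρ) (hτ : ∀ a, |τ a| ≤ ρ / 4) (hψ : ∀ a, |ψ a| ≤ ρ / 2)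
    (hψh : ∀ a, F (coordPt x e₁ e₂ τ a (ψ a)) = h) {a b : ℝ} (hb : |b| ≤ ρ / 2) :
    h < F (coordPt x e₁ e₂ τ a b) ↔ b < ψ a := by
  have hb' := _root_.abs_le.1 hb
  have hψ' := _root_.abs_le.1 (hψ a)
  rw [← hψh a]
  constructor
  · intro hlt
    by_contra! hcon
    have := coordPt_strict_decrease hF hs h1 h2 hρ (hτ a) hψ'.1 hcon hb'.2
    have : 0 ≤ c * (b - ψ a) := mul_nonneg hc.le (by linarith)
    linarith
  · intro hlt
    have := coordPt_strict_decrease hF hs h1 h2 hρ (hτ a) hb'.1 hlt.le hψ'.2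
    have : 0 < c * (ψ a - b) := mul_pos hc (by linarith)
    linarith

/-- A horizontal displacement changes F by at most CK|a - b|, and the vertical one that restores the
level acts at rate at least c. -/
lemma implicit_lipschitz (hF : Differentiable ℝ F) (hC : ∀ y, ‖fderiv ℝ F y‖ ≤ C) (hc : 0 < c)
    (hs : ∀ y ∈ Metric.ball x ρ, fderiv ℝ F y e₂ ≤ -c) (h1 : ‖e₁‖ = 1) (h2 : ‖e₂‖ = 1)
    (hρ : 0 < ρ) (hτ : ∀ a, |τ a| ≤ ρ / 4) (hψ : ∀ a, |ψ a| ≤ ρ / 2)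
    (hψh : ∀ a, F (coordPt x e₁ e₂ τ a (ψ a)) = h) (hK : ∀ a b, |τ a - τ b| ≤ K * |a - b|)
    (a b : ℝ) : |ψ a - ψ b| ≤ C * K / c * |a - b| := by
  have hC0 : 0 ≤ C := (norm_nonneg _).trans (hC x)
  wlog hab : ψ b ≤ ψ a generalizing a b
  · rw [abs_sub_comm, abs_sub_comm a b]
    exact this b a (by linarith)
  have h3 := coordPt_strict_decrease hF hs h1 h2 hρ (hτ a) (_root_.abs_le.1 (hψ b)).1 hab
    (_root_.abs_le.1 (hψ a)).2
  have h4 := norm_sub_le_of_norm_fderiv_le hF hC (coordPt x e₁ e₂ τ a (ψ b))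
    (coordPt x e₁ e₂ τ b (ψ b))
  have h5 := (norm_coordPt_sub_le (x := x) (τ := τ) h1 h2 a (ψ b) b (ψ b)).trans_eq
    (c := |τ a - τ b|) (by rw [sub_self, abs_zero, add_zero])
  have h6 := h4.trans (mul_le_mul_of_nonneg_left (h5.trans (hK a b)) hC0)
  rw [hψh b, Real.norm_eq_abs] at h6
  rw [hψh a] at h3
  rw [abs_of_nonneg (by linarith), div_mul_eq_mul_div, le_div_iff₀ hc]
  have := (le_abs_self _).trans h6
  linarith

/-- Implicit differentiation with the Lipschitz bound of ψ already known: the curve `p` is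
Lipschitz, so the error of the expansion of F along it is o(a' - a). -/
lemma implicit_hasDerivAt (hF : Differentiable ℝ F) (hc : 0 < c) {M : ℝ}
    (h1 : ‖e₁‖ = 1) (h2 : ‖e₂‖ = 1) (hψh : ∀ a, F (coordPt x e₁ e₂ τ a (ψ a)) = h)
    (hτd : Differentiable ℝ τ) (hK : ∀ a b, |τ a - τ b| ≤ K * |a - b|)
    (hM : ∀ a b, |ψ a - ψ b| ≤ M * |a - b|) (a : ℝ)
    (hQ : fderiv ℝ F (coordPt x e₁ e₂ τ a (ψ a)) e₂ ≤ -c) :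
    HasDerivAt ψ (-(fderiv ℝ F (coordPt x e₁ e₂ τ a (ψ a)) e₁ * deriv τ a) /
      fderiv ℝ F (coordPt x e₁ e₂ τ a (ψ a)) e₂) a := by
  set p : ℝ → Plane := fun a => coordPt x e₁ e₂ τ a (ψ a) with hp
  set D := fderiv ℝ F (p a) with hD
  have hQ0 : D e₂ ≠ 0 := by
    have : D e₂ ≤ -c := hQ
    linarith
  have hpb : (fun a' => p a' - p a) =O[𝓝 a] fun a' => a' - a := by
    refine Asymptotics.IsBigO.of_bound (K + M) (Eventually.of_forall fun a' => ?_)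
    refine (norm_coordPt_sub_le h1 h2 _ _ _ _).trans ?_
    rw [Real.norm_eq_abs, add_mul]
    exact add_le_add (hK _ _) (hM _ _)
  have hpc : Tendsto p (𝓝 a) (𝓝 (p a)) := by
    rw [tendsto_iff_norm_sub_tendsto_zero]
    have h3 : Tendsto (fun a' => a' - a) (𝓝 a) (𝓝 0) := by
      have : Continuous fun a' : ℝ => a' - a := by fun_prop
      simpa using this.tendsto a
    exact (hpb.trans_tendsto h3).norm.trans (by simp)
  have hFo := ((hF (p a)).hasFDerivAt.isLittleO.comp_tendsto hpc).trans_isBigO hpb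
  have hτo := (hτd a).hasDerivAt.isLittleO
  rw [hasDerivAt_iff_isLittleO]
  -- F does not change along `p`, so its expansion can be solved for the increment of ψ after
  -- division by the nonzero slope `D e₂`.
  have hcomb := ((hFo.const_mul_left (-(D e₂)⁻¹)).add
    ((hτo.const_mul_left (-(D e₁ * (D e₂)⁻¹))))).congr_left
    (f₂ := fun a' => ψ a' - ψ a - (a' - a) • (-(D e₁ * deriv τ a) / D e₂)) ?_
  · exact hcomb
  · intro a'
    have h3 : p a' - p a = (τ a' - τ a) • e₁ + (ψ a' - ψ a) • e₂ := by
      simp only [hp, coordPt]; module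
    have h4 : F (p a') = F (p a) := by rw [hp]; simp only [hψh]
    simp only [Function.comp_apply, h4, sub_self, zero_sub, smul_eq_mul]
    rw [← hD, h3, map_add, map_smul, map_smul, smul_eq_mul, smul_eq_mul]
    field_simp
    ring

end Implicit

/-- Superlevel sets of functions with a uniform slope have `C^{1,α}` boundaries, uniformly. -/
lemma exists_holder_chart {c C Λ ρ α : ℝ} (hc : 0 < c) (hC : 0 < C) (hΛ : 0 ≤ Λ)
    (hρ : 0 < ρ) (hα : 0 < α) (hα1 : α ≤ 1) : ∃ L₁ : ℝ, ∀ (F : Plane → ℝ) (h ε : ℝ), 0 ≤ ε →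
    HasSlope F h ε c C Λ ρ → ∀ x ∈ frontier {x | h < F x},
      ∃ (e : Plane ≃ₗᵢ[ℝ] Plane) (φ : ℝ → ℝ), HolderOneNormLE α L₁ φ ∧
        IsGraphChart {x | h < F x} (c * ρ / (8 * C)) x e φ := by
  -- A chart function must be defined and bounded in C^{1,α} on the whole line, while the level
  -- curve is controlled only near `x`. Feeding the bounded coordinate τ(a) into the implicit
  -- function extends it globally without changing it near 0.
  obtain ⟨τ, K, hK0, hτd, hτid, hτb, hτ', hτL, hτL'⟩ :=
    exists_bounded_identity (a₀ := c * ρ / (4 * C)) (by positivity)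
  -- `M₁` bounds ψ', `ℓ` is the Lipschitz constant of the directional derivatives of F along the
  -- level curve, and `M₂` that of the quotient ψ'. All are fixed before F.
  set M₁ := C * K / c with hM₁
  have hM₁0 : 0 < M₁ := by positivity
  set ℓ := Λ * (K + M₁) with hℓ
  have hℓ0 : 0 ≤ ℓ := by positivity
  set M₂ := (ℓ * K + C * K) / c + C * K * ℓ / c ^ 2 with hM₂
  refine ⟨ρ / 2 + M₁ + (M₂ + 2 * M₁), fun F h ε hε hF x hx => ?_⟩
  have hFd := hF.differentiable
  have hxh : F x = h := by
    have := frontier_lt_subset_eq continuous_const hFd.continuous hx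
    exact this.symm
  obtain ⟨e, he⟩ := hF.slope x (by rw [hxh, sub_self, abs_zero]; exact hε)
  set e₁ : Plane := e.symm (EuclideanSpace.single 0 1) with he₁
  set e₂ : Plane := e.symm (EuclideanSpace.single 1 1) with he₂
  have h1 : ‖e₁‖ = 1 := by rw [he₁, e.symm.norm_map]; simp
  have h2 : ‖e₂‖ = 1 := by rw [he₂, e.symm.norm_map]; simp
  have hs : ∀ y ∈ Metric.ball x ρ, fderiv ℝ F y e₂ ≤ -c := by
    intro y hy
    have := he y hy
    rw [map_neg] at this
    linarith
  have hcC : c ≤ C := by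
    have h3 := he x (Metric.mem_ball_self hρ)
    have h4 := ContinuousLinearMap.le_opNorm (fderiv ℝ F x) (-e₂)
    rw [norm_neg, h2, mul_one] at h4
    exact (h3.trans (le_abs_self _)).trans (h4.trans (hF.grad_le x))
  have hle : c * ρ / (4 * C) ≤ ρ / 4 := by
    rw [div_le_div_iff₀ (by positivity) (by norm_num)]
    nlinarith
  have hτ4 : ∀ a, |τ a| ≤ ρ / 4 := fun a => (hτb a).trans hle
  choose ψ hψ hψh using exists_implicit hFd hF.grad_le hC hc hcC hs h1 h2 hρ hxh hτb
  have hlt := fun {a b : ℝ} => implicit_lt_iff (a := a) (b := b) hFd hc hs h1 h2 hρ hτ4 hψ hψh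
  have hψL := implicit_lipschitz hFd hF.grad_le hc hs h1 h2 hρ hτ4 hψ hψh hτL
  rw [← hM₁] at hψL
  set p : ℝ → Plane := fun a => coordPt x e₁ e₂ τ a (ψ a) with hp
  have hpb : ∀ a, p a ∈ Metric.ball x ρ := fun a => coordPt_mem_ball h1 h2 hρ (hτ4 a) (hψ a)
  have hpL : ∀ a b, ‖p a - p b‖ ≤ (K + M₁) * |a - b| := fun a b =>
    (norm_coordPt_sub_le h1 h2 _ _ _ _).trans (by
      rw [add_mul]; exact add_le_add (hτL _ _) (hψL _ _))
  have hDL : ∀ v : Plane, ‖v‖ = 1 → ∀ a b,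
      |fderiv ℝ F (p a) v - fderiv ℝ F (p b) v| ≤ ℓ * |a - b| := by
    intro v hv a b
    rw [← sub_apply]
    have h3 := ContinuousLinearMap.le_opNorm (fderiv ℝ F (p a) - fderiv ℝ F (p b)) v
    rw [hv, mul_one] at h3
    refine h3.trans ((norm_sub_le_of_norm_fderiv_le hF.differentiable_fderiv hF.hess_le _ _).trans ?_)
    rw [hℓ, mul_assoc]
    exact mul_le_mul_of_nonneg_left (hpL a b) hΛ
  have hDb : ∀ a, |fderiv ℝ F (p a) e₁| ≤ C := by
    intro a
    have h3 := ContinuousLinearMap.le_opNorm (fderiv ℝ F (p a)) e₁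
    rw [h1, mul_one] at h3
    exact h3.trans (hF.grad_le _)
  have hQ : ∀ a, fderiv ℝ F (p a) e₂ ≤ -c := fun a => hs _ (hpb a)
  have hder : ∀ a, HasDerivAt ψ (-(fderiv ℝ F (p a) e₁ * deriv τ a) / fderiv ℝ F (p a) e₂) a :=
    fun a => implicit_hasDerivAt hFd hc h1 h2 hψh hτd hτL hψL a (hQ a)
  have hNb : ∀ a, |-(fderiv ℝ F (p a) e₁ * deriv τ a)| ≤ C * K := by
    intro a
    rw [abs_neg, abs_mul]
    exact mul_le_mul (hDb a) (hτ' a) (abs_nonneg _) hC.le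
  have hQabs : ∀ a, c ≤ |fderiv ℝ F (p a) e₂| := fun a => by
    rw [abs_of_nonpos (by linarith [hQ a])]; linarith [hQ a]
  refine ⟨e, ψ, ?_, ?_, ?_⟩
  · refine holderOneNormLE_of_lipschitz hα hα1 hder hψ ?_ ?_
    · intro a
      rw [abs_div, hM₁]
      exact div_le_div₀ (by positivity) (hNb a) hc (hQabs a)
    · intro a b
      set N := fun a => -(fderiv ℝ F (p a) e₁ * deriv τ a) with hN
      set Q := fun a => fderiv ℝ F (p a) e₂ with hQd
      have hQ0 : ∀ a, Q a ≠ 0 := fun a => by have := hQ a; simp only [hQd]; linarith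
      have hNL : |N a - N b| ≤ (ℓ * K + C * K) * |a - b| := by
        have h3 : N a - N b = -((fderiv ℝ F (p a) e₁ - fderiv ℝ F (p b) e₁) * deriv τ a +
            fderiv ℝ F (p b) e₁ * (deriv τ a - deriv τ b)) := by simp only [hN]; ring
        rw [h3, abs_neg]
        refine (abs_add_le _ _).trans ?_
        rw [abs_mul, abs_mul]
        have h4 := mul_le_mul (hDL e₁ h1 a b) (hτ' a) (abs_nonneg _) (by positivity)
        have h5 := mul_le_mul (hDb b) (hτL' a b) (abs_nonneg _) hC.le
        linarith
      have h6 : N a / Q a - N b / Q b = (N a - N b) / Q a + N b * (Q b - Q a) / (Q a * Q b) := by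
        have := hQ0 a
        have := hQ0 b
        field_simp
        ring
      change |N a / Q a - N b / Q b| ≤ _
      rw [h6]
      refine (abs_add_le _ _).trans ?_
      rw [abs_div, abs_div, abs_mul, abs_mul, hM₂, add_mul]
      refine add_le_add ?_ ?_
      · rw [div_mul_eq_mul_div]
        exact div_le_div₀ (by positivity) hNL hc (hQabs a)
      · rw [div_mul_eq_mul_div]
        refine div_le_div₀ (by positivity) ?_ (by positivity) ?_
        · rw [mul_assoc]
          refine mul_le_mul (hNb b) ?_ (abs_nonneg _) (by positivity)
          rw [abs_sub_comm]
          exact hDL e₂ h2 a b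
        · rw [sq]
          exact mul_le_mul (hQabs a) (hQabs b) hc.le (abs_nonneg _)
  -- The level h is met only once on the vertical segment through `x`, namely at `x`.
  · have h3 : coordPt x e₁ e₂ τ 0 0 = x := by
      rw [coordPt, hτid 0 (by simp; positivity)]; simp
    have h4 := hlt (a := 0) (b := 0) (by simp; positivity)
    rw [h3, hxh] at h4
    have h5 : ¬ (0 < ψ 0) := fun h => lt_irrefl _ (h4.2 h)
    by_contra hne
    have h6 : ψ 0 < 0 := lt_of_le_of_ne (not_lt.1 h5) hne
    have h7 := coordPt_strict_decrease hFd hs h1 h2 hρ (hτ4 0) (_root_.abs_le.1 (hψ 0)).1 h6.le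
      (by linarith)
    rw [h3, hxh, hψh 0] at h7
    have : 0 < c * (0 - ψ 0) := mul_pos hc (by linarith)
    linarith
  · intro y hy
    have hn : ‖e (y - x)‖ < c * ρ / (8 * C) := by rw [e.norm_map, ← dist_eq_norm]; exact hy
    have ha := (abs_coord_le (e (y - x)) 0).trans hn.le
    have hb := (abs_coord_le (e (y - x)) 1).trans hn.le
    -- The chart radius is half the range of τ, where τ is the identity and the curved coordinates
    -- are the rigid ones.
    have hhalf : c * ρ / (8 * C) = c * ρ / (4 * C) / 2 := by field_simp; norm_num
    have hy' : y = coordPt x e₁ e₂ τ (e (y - x) 0) (e (y - x) 1) := by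
      rw [coordPt, hτid _ (ha.trans_eq hhalf), he₁, he₂, ← map_smul, ← map_smul, add_assoc,
        ← map_add]
      have h3 : e (y - x) 0 • EuclideanSpace.single 0 (1 : ℝ) +
          e (y - x) 1 • EuclideanSpace.single 1 (1 : ℝ) = e (y - x) := by
        ext i
        fin_cases i <;> simp [-map_sub]
      rw [h3, e.symm_apply_apply]
      abel
    have h4 := hlt (a := e (y - x) 0) (b := e (y - x) 1) (hb.trans (by linarith))
    rw [← hy'] at h4
    exact h4

/-! ### Vectors and covectors -/

/-- The vector that represents a linear form. -/
noncomputable def dualVec : (Plane →L[ℝ] ℝ) →L[ℝ] Plane :=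
  ∑ i : Fin 2, (ContinuousLinearMap.apply ℝ ℝ (EuclideanSpace.single i (1 : ℝ) : Plane)).smulRight
    (EuclideanSpace.single i (1 : ℝ))

lemma dualVec_apply (l : Plane →L[ℝ] ℝ) (i : Fin 2) :
    dualVec l i = l (EuclideanSpace.single i 1) := by
  fin_cases i <;> simp [dualVec, Fin.sum_univ_two]

lemma eq_sum_coords (v : Plane) : v = ∑ i : Fin 2, v i • EuclideanSpace.single i (1 : ℝ) := by
  ext i
  fin_cases i <;> simp [Fin.sum_univ_two]

lemma inner_dualVec (l : Plane →L[ℝ] ℝ) (v : Plane) : inner ℝ (dualVec l) v = l v := by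
  conv_rhs => rw [eq_sum_coords v]
  simp only [map_sum, map_smul, smul_eq_mul, PiLp.inner_apply, dualVec_apply]
  rfl

lemma apply_dualVec (l : Plane →L[ℝ] ℝ) : l (dualVec l) = ‖dualVec l‖ ^ 2 := by
  rw [← inner_dualVec, real_inner_self_eq_norm_sq]

lemma norm_dualVec_le (l : Plane →L[ℝ] ℝ) : ‖dualVec l‖ ≤ ‖l‖ := by
  rcases eq_or_ne (dualVec l) 0 with h | h
  · simp [h]
  · have h1 := (le_abs_self _).trans (l.le_opNorm (dualVec l))
    rw [apply_dualVec, sq] at h1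
    exact le_of_mul_le_mul_right h1 (norm_pos_iff.2 h)

lemma le_norm_dualVec {l : Plane →L[ℝ] ℝ} {v : Plane} {c : ℝ} (hv : ‖v‖ ≤ 1) (h : c ≤ l v) :
    c ≤ ‖dualVec l‖ := by
  refine h.trans ?_
  rw [← inner_dualVec]
  exact (real_inner_le_norm _ _).trans (mul_le_of_le_one_right (norm_nonneg _) hv)

lemma neg_norm_dualVec_le {l : Plane →L[ℝ] ℝ} {v : Plane} (hv : ‖v‖ ≤ 1) :
    -‖dualVec l‖ ≤ l v := by
  have := le_norm_dualVec (l := l) (v := -v) (by rwa [norm_neg]) le_rfl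
  rw [map_neg] at this
  linarith

lemma norm_normalize_sub_le {c : ℝ} (hc : 0 < c) {a b : Plane} (ha : c ≤ ‖a‖) (hb : c ≤ ‖b‖) :
    ‖‖a‖⁻¹ • a - ‖b‖⁻¹ • b‖ ≤ 2 / c * ‖a - b‖ := by
  have ha0 : 0 < ‖a‖ := hc.trans_le ha
  have hb0 : 0 < ‖b‖ := hc.trans_le hb
  have h1 : ‖a‖⁻¹ • a - ‖b‖⁻¹ • b = ‖a‖⁻¹ • (a - b) + (‖a‖⁻¹ * (‖b‖ - ‖a‖)) • (‖b‖⁻¹ • b) := by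
    rw [smul_smul, show ‖a‖⁻¹ * (‖b‖ - ‖a‖) * ‖b‖⁻¹ = ‖a‖⁻¹ - ‖b‖⁻¹ by field_simp]
    module
  rw [h1]
  refine (norm_add_le _ _).trans ?_
  have h2 : ‖‖b‖⁻¹ • b‖ = 1 := by rw [norm_smul, norm_inv, norm_norm, inv_mul_cancel₀ hb0.ne']
  rw [norm_smul, norm_smul, h2, mul_one, norm_mul, norm_inv, norm_norm, Real.norm_eq_abs]
  have h3 : |‖b‖ - ‖a‖| ≤ ‖a - b‖ := by rw [abs_sub_comm]; exact abs_norm_sub_norm_le a b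
  have h4 : ‖a‖⁻¹ ≤ c⁻¹ := inv_anti₀ hc ha
  have h5 : 0 ≤ c⁻¹ := by positivity
  calc ‖a‖⁻¹ * ‖a - b‖ + ‖a‖⁻¹ * |‖b‖ - ‖a‖| ≤ c⁻¹ * ‖a - b‖ + c⁻¹ * ‖a - b‖ := by gcongr
    _ = 2 / c * ‖a - b‖ := by ring

/-! ### The divergence theorem for compactly supported fields -/

section Divergence

variable {X Y : Plane → Plane}

lemma fderiv_coord (hX : ContDiff ℝ 1 X) (x v : Plane) (i : Fin 2) :
    fderiv ℝ (fun y => X y i) x v = fderiv ℝ X x v i := by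
  have h := (EuclideanSpace.proj i : Plane →L[ℝ] ℝ).hasFDerivAt.comp x
    ((hX.differentiable (by norm_num)) x).hasFDerivAt
  have h2 : HasFDerivAt (fun y => X y i) _ x := h
  rw [h2.fderiv]
  rfl

lemma continuous_diverg (hX : ContDiff ℝ 1 X) : Continuous (diverg X) := by
  have := hX.continuous_fderiv (by norm_num)
  unfold diverg
  fun_prop

lemma support_diverg_subset : Function.support (diverg X) ⊆ tsupport X := by
  intro x hx
  by_contra h
  apply hx
  have : fderiv ℝ X x = 0 := by
    by_contra h0
    exact h (support_fderiv_subset ℝ h0)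
  simp [diverg, this]

lemma hasCompactSupport_diverg (hX : HasCompactSupport X) : HasCompactSupport (diverg X) :=
  hX.mono' support_diverg_subset

lemma diverg_sub (hX : ContDiff ℝ 1 X) (hY : ContDiff ℝ 1 Y) (x : Plane) :
    diverg (fun y => X y - Y y) x = diverg X x - diverg Y x := by
  simp only [diverg]
  rw [fderiv_fun_sub ((hX.differentiable (by norm_num)) x) ((hY.differentiable (by norm_num)) x)]
  simp [Fin.sum_univ_two]

lemma integral_mul_diverg {g : Plane → ℝ} (hg : ContDiff ℝ 1 g) (hX : ContDiff ℝ 1 X)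
    (hXc : HasCompactSupport X) :
    ∫ x, g x * diverg X x = -∫ x, fderiv ℝ g x (X x) := by
  have hcoord : ∀ i : Fin 2, ContDiff ℝ 1 fun y => X y i := fun i =>
    (EuclideanSpace.proj i : Plane →L[ℝ] ℝ).contDiff.comp hX
  have hcs : ∀ i : Fin 2, HasCompactSupport fun y => X y i := fun i =>
    hXc.comp_left (g := fun v : Plane => v i) (by simp)
  have hcs' : ∀ (i : Fin 2) (v : Plane), HasCompactSupport fun x => fderiv ℝ (fun y => X y i) x v :=
    fun i v => (hcs i).fderiv_apply ℝ v
  have hg1 := hg.continuous_fderiv (by norm_num)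
  have hi1 : ∀ i : Fin 2, Integrable fun x =>
      g x * fderiv ℝ (fun y => X y i) x (EuclideanSpace.single i 1) := by
    intro i
    have := (hcoord i).continuous_fderiv (by norm_num)
    have hgc := hg.continuous
    exact Continuous.integrable_of_hasCompactSupport (by fun_prop) (hcs' i _).mul_left
  have hi2 : ∀ i : Fin 2, Integrable fun x =>
      fderiv ℝ g x (EuclideanSpace.single i 1) * X x i := by
    intro i
    have := (hcoord i).continuous
    exact Continuous.integrable_of_hasCompactSupport (by fun_prop) (hcs i).mul_left
  have hparts : ∀ i : Fin 2,
      ∫ x, g x * fderiv ℝ (fun y => X y i) x (EuclideanSpace.single i 1) =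
        -∫ x, fderiv ℝ g x (EuclideanSpace.single i 1) * X x i := by
    intro i
    refine integral_mul_fderiv_eq_neg_fderiv_mul_of_integrable (hi2 i) (hi1 i) ?_
      (fun x _ => hg.differentiable (by norm_num) x)
      (fun x _ => (hcoord i).differentiable (by norm_num) x)
    have h1 := (hcoord i).continuous
    have h2 := hg.continuous
    exact Continuous.integrable_of_hasCompactSupport (by fun_prop) (hcs i).mul_left
  have e1 : ∀ x, g x * diverg X x =
      ∑ i : Fin 2, g x * fderiv ℝ (fun y => X y i) x (EuclideanSpace.single i 1) := by
    intro x
    simp only [fderiv_coord hX, diverg, Finset.mul_sum]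
  have e2 : ∀ x, fderiv ℝ g x (X x) =
      ∑ i : Fin 2, fderiv ℝ g x (EuclideanSpace.single i 1) * X x i := by
    intro x
    conv_lhs => rw [eq_sum_coords (X x)]
    simp only [map_sum, map_smul, smul_eq_mul, mul_comm]
  simp only [e1, e2]
  rw [integral_finsetSum _ fun i _ => hi1 i, integral_finsetSum _ fun i _ => hi2 i,
    ← Finset.sum_neg_distrib]
  exact Finset.sum_congr rfl fun i _ => hparts i

/-- A field that crosses the level `h` upwards has nonpositive flux out of `{h < F}`. -/
lemma integral_superlevel_diverg_nonpos {F : Plane → ℝ} {h ε : ℝ} (hF : ContDiff ℝ 1 F)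
    (hε : 0 < ε) (hY : ContDiff ℝ 1 Y) (hYc : HasCompactSupport Y)
    (hup : ∀ x, h < F x → F x < h + ε → 0 ≤ fderiv ℝ F x (Y x)) :
    ∫ x, chi {x | h < F x} x * diverg Y x ≤ 0 := by
  -- Smooth steps rising on [h, h + 1/(n+1)]: H_n(F) tends to the indicator of {h < F}, and for
  -- large n the rise takes place inside the layer where the sign of the flux is known.
  set H : ℕ → ℝ → ℝ := fun n s => Real.smoothTransition ((n + 1 : ℝ) * (s - h)) with hH
  have hHs : ∀ n, ContDiff ℝ 1 (H n) := fun n =>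
    Real.smoothTransition.contDiff.comp (contDiff_const.mul (contDiff_id.sub contDiff_const))
  have hmono : ∀ n, Monotone (H n) := fun n s s' hs =>
    Real.smoothTransition.monotone (by gcongr)
  have hdiv := continuous_diverg hY
  have hdivi : Integrable (diverg Y) :=
    hdiv.integrable_of_hasCompactSupport (hasCompactSupport_diverg hYc)
  have hneg : ∀ᶠ n : ℕ in atTop, ∫ x, H n (F x) * diverg Y x ≤ 0 := by
    obtain ⟨N, hN⟩ := exists_nat_gt ε⁻¹
    filter_upwards [eventually_ge_atTop N] with n hn
    have hn1 : 1 ≤ (n + 1 : ℝ) * ε := by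
      have h1 : (N : ℝ) ≤ n := by exact_mod_cast hn
      have h2 : ε⁻¹ * ε = 1 := inv_mul_cancel₀ hε.ne'
      nlinarith
    change ∫ x, (H n ∘ F) x * diverg Y x ≤ 0
    rw [integral_mul_diverg ((hHs n).comp hF) hY hYc, neg_nonpos]
    refine integral_nonneg fun x => ?_
    have hd1 : HasDerivAt (H n) (deriv (H n) (F x)) (F x) :=
      (((hHs n).differentiable (by norm_num)) _).hasDerivAt
    have hd := hd1.comp_hasFDerivAt x ((hF.differentiable (by norm_num)) x).hasFDerivAt
    have hd' : HasFDerivAt (H n ∘ F) (deriv (H n) (F x) • fderiv ℝ F x) x := hd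
    have hpos : 0 ≤ deriv (H n) (F x) := (hmono n).deriv_nonneg
    change 0 ≤ fderiv ℝ (H n ∘ F) x (Y x)
    rw [hd'.fderiv, smul_apply, smul_eq_mul]
    by_cases h1 : h < F x
    · by_cases h2 : F x < h + ε
      · exact mul_nonneg hpos (hup x h1 h2)
      -- Outside the layer the step takes its extreme value, so its derivative vanishes, even at the
      -- end points.
      · have h3 : IsLocalMax (H n) (F x) := Eventually.of_forall fun s => by
          have : H n (F x) = 1 := Real.smoothTransition.one_of_one_le (by
            nlinarith [Nat.cast_nonneg (α := ℝ) n])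
          rw [this]
          exact Real.smoothTransition.le_one _
        rw [h3.deriv_eq_zero, zero_mul]
    · have h3 : IsLocalMin (H n) (F x) := Eventually.of_forall fun s => by
        have : H n (F x) = 0 := Real.smoothTransition.zero_of_nonpos
          (mul_nonpos_of_nonneg_of_nonpos (by positivity) (by linarith))
        rw [this]
        exact Real.smoothTransition.nonneg _
      rw [h3.deriv_eq_zero, zero_mul]
  have hlim : Tendsto (fun n => ∫ x, H n (F x) * diverg Y x) atTop
      (𝓝 (∫ x, chi {x | h < F x} x * diverg Y x)) := by
    refine tendsto_integral_of_dominated_convergence (fun x => ‖diverg Y x‖) (fun n => ?_)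
      hdivi.norm (fun n => Eventually.of_forall fun x => ?_) (Eventually.of_forall fun x => ?_)
    · have := (hHs n).continuous
      have := hF.continuous
      exact Continuous.aestronglyMeasurable (by fun_prop)
    · rw [norm_mul]
      refine mul_le_of_le_one_left (norm_nonneg _) ?_
      rw [Real.norm_of_nonneg (Real.smoothTransition.nonneg _)]
      exact Real.smoothTransition.le_one _
    · refine Tendsto.mul_const _ ?_
      by_cases h1 : h < F x
      · have : chi {x | h < F x} x = 1 := indicator_of_mem (show x ∈ {x | h < F x} from h1) _
        rw [this]
        refine tendsto_const_nhds.congr' ?_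
        obtain ⟨N, hN⟩ := exists_nat_gt (F x - h)⁻¹
        filter_upwards [eventually_ge_atTop N] with n hn
        refine (Real.smoothTransition.one_of_one_le ?_).symm
        have h1' : (N : ℝ) ≤ n := by exact_mod_cast hn
        have h2 : (F x - h)⁻¹ * (F x - h) = 1 := inv_mul_cancel₀ (by linarith)
        nlinarith
      · have : chi {x | h < F x} x = 0 := indicator_of_notMem (show x ∉ {x | h < F x} from h1) _
        rw [this]
        refine tendsto_const_nhds.congr fun n => ?_
        exact (Real.smoothTransition.zero_of_nonpos
          (mul_nonpos_of_nonneg_of_nonpos (by positivity) (by linarith))).symm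
  exact le_of_tendsto hlim hneg

end Divergence

/-! ### Calibrations -/

/-- `X` is a test field that crosses the level `h` of `F` downwards along the gradient. -/
structure IsCalibration (F : Plane → ℝ) (h ε c K R : ℝ) (X : Plane → Plane) : Prop where
  contDiff : ContDiff ℝ 1 X
  support : tsupport X ⊆ Metric.closedBall 0 R
  norm_le : ∀ x, ‖X x‖ ≤ 1
  diverg_le : ∀ x, |diverg X x| ≤ K
  descent : ∀ x, fderiv ℝ F x (X x) ≤ 0
  descent_le : ∀ x, |F x - h| ≤ ε → fderiv ℝ F x (X x) ≤ -c
  steepest : ∀ x, |F x - h| ≤ ε → ∀ v : Plane, ‖v‖ ≤ 1 → fderiv ℝ F x (X x) ≤ fderiv ℝ F x v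

lemma IsCalibration.hasCompactSupport {F : Plane → ℝ} {h ε c K R : ℝ} {X : Plane → Plane}
    (hX : IsCalibration F h ε c K R X) : HasCompactSupport X :=
  HasCompactSupport.of_support_subset_isCompact (isCompact_closedBall 0 R)
    ((subset_tsupport X).trans hX.support)

lemma abs_diverg_le_of_lipschitz {X : Plane → Plane} {K : ℝ} (hK : 0 ≤ K)
    (hX : ∀ x y, ‖X x - X y‖ ≤ K * ‖x - y‖) (x : Plane) : |diverg X x| ≤ 2 * K := by
  have hL : LipschitzWith K.toNNReal X := LipschitzWith.of_dist_le_mul fun x y => by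
    simpa [dist_eq_norm, Real.coe_toNNReal _ hK] using hX x y
  have h1 : ‖fderiv ℝ X x‖ ≤ K := by
    simpa [Real.coe_toNNReal _ hK] using norm_fderiv_le_of_lipschitz ℝ hL (x₀ := x)
  have h2 : ∀ i : Fin 2, |fderiv ℝ X x (EuclideanSpace.single i 1) i| ≤ K := by
    intro i
    refine (abs_coord_le _ i).trans (((fderiv ℝ X x).le_opNorm _).trans ?_)
    simpa using h1
  rw [diverg, Fin.sum_univ_two]
  refine (abs_add_le _ _).trans ?_
  linarith [h2 0, h2 1]

/-- The field is -β(F) ∇F/|∇F| with a cutoff β near h. On the support of β(F) the slope keeps |∇F|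
at least c, so the Hessian bound makes the field Lipschitz. The divergence bound thus depends on the
constants but not on F. -/
lemma exists_calibration {h ε c C Λ ρ : ℝ} (hε : 0 < ε) (hc : 0 < c) (hC : 0 ≤ C) (hΛ : 0 ≤ Λ)
    (hρ : 0 < ρ) : ∃ K : ℝ, 0 < K ∧ ∀ (F : Plane → ℝ) (R : ℝ), HasSlope F h ε c C Λ ρ →
      (∀ x, h - ε ≤ F x → ‖x‖ ≤ R) →
      ∃ X : Plane → Plane, IsCalibration F h (ε / 2) c K R X := by
  let β : ContDiffBump h := ⟨ε / 2, ε, by positivity, by linarith⟩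
  have hβs : ContDiff ℝ 1 β := β.contDiff
  obtain ⟨Kβ, hKβ⟩ := (hβs.continuous_deriv le_rfl).bounded_above_of_compact_support
    β.hasCompactSupport.deriv
  have hKβ0 : 0 ≤ Kβ := (norm_nonneg _).trans (hKβ 0)
  have hβL : ∀ a b, |β a - β b| ≤ Kβ * |a - b| := fun a b =>
    Convex.norm_image_sub_le_of_norm_deriv_le (s := univ)
      (fun z _ => (hβs.differentiable (by norm_num)) z) (fun z _ => hKβ z) convex_univ
      (mem_univ b) (mem_univ a)
  set K := Kβ * C + 2 / c * Λ with hK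
  have hK0 : 0 ≤ K := by positivity
  refine ⟨2 * K + 1, by positivity, fun F R hF hR => ?_⟩
  have hFd := hF.differentiable
  set N : Plane → Plane := fun x => dualVec (fderiv ℝ F x) with hN
  have hNc : ∀ x, |F x - h| ≤ ε → c ≤ ‖N x‖ := by
    intro x hx
    obtain ⟨e, he⟩ := hF.slope x hx
    exact le_norm_dualVec (by rw [norm_neg, e.symm.norm_map]; simp) (he x (Metric.mem_ball_self hρ))
  have hNs : ContDiff ℝ 1 N := dualVec.contDiff.comp (hF.contDiff.fderiv_right (by norm_num))
  have hNL : ∀ x y, ‖N x - N y‖ ≤ Λ * ‖x - y‖ := by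
    intro x y
    simp only [hN, ← map_sub]
    exact (norm_dualVec_le _).trans
      (norm_sub_le_of_norm_fderiv_le hF.differentiable_fderiv hF.hess_le x y)
  set X : Plane → Plane := fun x => -(β (F x) • (‖N x‖⁻¹ • N x)) with hX
  have hunit : ∀ x, ‖‖N x‖⁻¹ • N x‖ ≤ 1 := by
    intro x
    rw [norm_smul, norm_inv, norm_norm]
    exact inv_mul_le_one
  have hdesc : ∀ x, fderiv ℝ F x (X x) = -(β (F x) * ‖N x‖) := by
    intro x
    simp only [hX, map_neg, map_smul, smul_eq_mul, hN, apply_dualVec]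
    rcases eq_or_ne ‖dualVec (fderiv ℝ F x)‖ 0 with h0 | h0
    · simp [h0]
    · field_simp
  have hone : ∀ x, |F x - h| ≤ ε / 2 → β (F x) = 1 := fun x hx =>
    β.one_of_mem_closedBall (by simpa [Real.dist_eq] using hx)
  have hzero : ∀ x, ¬ |F x - h| < ε → β (F x) = 0 := fun x hx =>
    β.zero_of_le_dist (by simpa [Real.dist_eq] using hx)
  have hts : tsupport X ⊆ {x | |F x - h| ≤ ε} := by
    refine closure_minimal (fun x hx => ?_) (isClosed_le
      ((hFd.continuous.sub continuous_const).abs) continuous_const)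
    by_contra hcon
    apply hx
    simp only [hX, hzero x (fun h' => hcon h'.le), zero_smul, neg_zero]
  have hnorm : ∀ x, ‖X x‖ ≤ β (F x) := by
    intro x
    rw [hX, norm_neg, norm_smul, Real.norm_of_nonneg β.nonneg]
    exact mul_le_of_le_one_right β.nonneg (hunit x)
  have hβF : ∀ x y, |β (F x) - β (F y)| ≤ Kβ * C * ‖x - y‖ := by
    intro x y
    rw [mul_assoc]
    exact (hβL _ _).trans (mul_le_mul_of_nonneg_left
      (norm_sub_le_of_norm_fderiv_le hFd hF.grad_le x y) hKβ0)
  have hXL : ∀ x y, ‖X x - X y‖ ≤ K * ‖x - y‖ := by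
    -- If one point lies off the layer, the cutoff alone gives the bound; the normalised gradient
    -- need not be regular there.
    have hside : ∀ x y, ¬ |F y - h| < ε → ‖X x - X y‖ ≤ K * ‖x - y‖ := by
      intro x y hy
      have h1 : X y = 0 := by simp only [hX, hzero y hy, zero_smul, neg_zero]
      rw [h1, sub_zero]
      refine (hnorm x).trans ?_
      have h2 := hβF x y
      rw [hzero y hy, sub_zero, abs_of_nonneg β.nonneg] at h2
      refine h2.trans ?_
      rw [hK]
      gcongr
      linarith [show 0 ≤ 2 / c * Λ by positivity]
    intro x y
    by_cases hy : |F y - h| < ε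
    · by_cases hx : |F x - h| < ε
      · have h1 : X x - X y = (β (F y) - β (F x)) • (‖N x‖⁻¹ • N x) -
            β (F y) • (‖N x‖⁻¹ • N x - ‖N y‖⁻¹ • N y) := by
          simp only [hX]; module
        rw [h1]
        refine (norm_sub_le _ _).trans ?_
        rw [norm_smul (β (F y) - β (F x)) (‖N x‖⁻¹ • N x), norm_smul (β (F y)),
          Real.norm_of_nonneg β.nonneg, Real.norm_eq_abs, abs_sub_comm, hK, add_mul]
        refine add_le_add ?_ ?_
        · exact (mul_le_of_le_one_right (abs_nonneg _) (hunit x)).trans (hβF x y)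
        · refine (mul_le_of_le_one_left (norm_nonneg _) β.le_one).trans ?_
          refine (norm_normalize_sub_le hc (hNc x hx.le) (hNc y hy.le)).trans ?_
          rw [mul_assoc]
          exact mul_le_mul_of_nonneg_left (hNL x y) (by positivity)
      · rw [norm_sub_rev, norm_sub_rev x y]
        exact hside y x hx
    · exact hside x y hy
  refine ⟨X, ?_, ?_, ?_, ?_, ?_, ?_, ?_⟩
  -- Near a point off the support the field is zero; on the support the gradient does not vanish, so
  -- normalising it is smooth enough.
  · refine contDiff_iff_contDiffAt.2 fun x => ?_
    by_cases hx : x ∈ tsupport X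
    swap
    · exact contDiffAt_const.congr_of_eventuallyEq (notMem_tsupport_iff_eventuallyEq.1 hx)
    have hN0 : N x ≠ 0 := norm_pos_iff.1 (hc.trans_le (hNc x (hts hx)))
    have h1 : ContDiffAt ℝ 1 (fun x => β (F x)) x :=
      (hβs.comp (hF.contDiff.of_le (by norm_num))).contDiffAt
    have h2 : ContDiffAt ℝ 1 (fun x => ‖N x‖⁻¹) x :=
      (hNs.contDiffAt.norm ℝ hN0).inv (norm_ne_zero_iff.2 hN0)
    exact (h1.smul (h2.smul hNs.contDiffAt)).neg
  · intro x hx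
    rw [mem_closedBall_zero_iff]
    have := _root_.abs_le.1 (show |F x - h| ≤ ε from hts hx)
    exact hR x (by linarith)
  · exact fun x => (hnorm x).trans β.le_one
  · intro x
    have := abs_diverg_le_of_lipschitz hK0 hXL x
    linarith
  · intro x
    rw [hdesc x, neg_nonpos]
    exact mul_nonneg β.nonneg (norm_nonneg _)
  · intro x hx
    rw [hdesc x, hone x hx, one_mul, neg_le_neg_iff]
    exact hNc x (by linarith)
  · intro x hx v hv
    rw [hdesc x, hone x hx, one_mul]
    exact neg_norm_dualVec_le hv

/-! ### Perimeters of superlevel sets -/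

section Perimeter

variable {F F' : Plane → ℝ} {h ε c K R R' : ℝ} {X X' : Plane → Plane}

lemma setIntegral_mul_diverg {f : Plane → ℝ} {D : Set Plane} (hD : MeasurableSet D)
    (hX : tsupport X ⊆ D) : ∫ x in D, f x * diverg X x = ∫ x, f x * diverg X x := by
  rw [← integral_indicator hD]
  refine integral_congr_ae (Eventually.of_forall fun x => ?_)
  by_cases hx : x ∈ D
  · rw [indicator_of_mem hx]
  · rw [indicator_of_notMem hx]
    have : diverg X x = 0 := by
      by_contra h0
      exact hx (hX (support_diverg_subset h0))
    simp only [this, mul_zero]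

lemma integrable_chi_mul_diverg {S : Set Plane} (hS : MeasurableSet S) (hX : ContDiff ℝ 1 X)
    (hXc : HasCompactSupport X) : Integrable fun x => chi S x * diverg X x :=
  ((continuous_diverg hX).integrable_of_hasCompactSupport
    (hasCompactSupport_diverg hXc)).bdd_mul (c := 1)
    (measurable_const.indicator hS).aestronglyMeasurable
    (Eventually.of_forall fun x => abs_chi_le S x)

lemma measurableSet_superlevel (hF : Continuous F) : MeasurableSet {x | h < F x} :=
  (isOpen_lt continuous_const hF).measurableSet

/-- Since X descends most steeply, Y - X points upwards just above the level h, and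
`integral_superlevel_diverg_nonpos` applies. Hence X attains the supremum that defines the
perimeter. -/
lemma IsCalibration.le_flux (hX : IsCalibration F h ε c K R X) (hF : ContDiff ℝ 1 F)
    (hε : 0 < ε) {Y : Plane → Plane} (hY : ContDiff ℝ 1 Y) (hYc : HasCompactSupport Y)
    (hY1 : ∀ x, ‖Y x‖ ≤ 1) :
    ∫ x, chi {x | h < F x} x * diverg Y x ≤ ∫ x, chi {x | h < F x} x * diverg X x := by
  have hS := measurableSet_superlevel (h := h) hF.continuous
  have hi1 := integrable_chi_mul_diverg hS hX.contDiff hX.hasCompactSupport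
  have hi2 := integrable_chi_mul_diverg hS hY hYc
  have hc : HasCompactSupport fun x => Y x - X x := hYc.sub hX.hasCompactSupport
  have h1 := integral_superlevel_diverg_nonpos (Y := fun x => Y x - X x) (h := h) hF hε
    (hY.sub hX.contDiff) hc (fun x hx1 hx2 => by
      rw [map_sub, sub_nonneg]
      exact hX.steepest x (by rw [_root_.abs_le]; constructor <;> linarith) _ (hY1 x))
  simp only [diverg_sub hY hX.contDiff, mul_sub] at h1
  rw [integral_sub hi2 hi1] at h1
  linarith

lemma IsCalibration.flux_nonneg (hX : IsCalibration F h ε c K R X) (hF : ContDiff ℝ 1 F)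
    (hε : 0 < ε) : 0 ≤ ∫ x, chi {x | h < F x} x * diverg X x := by
  have := hX.le_flux hF hε (Y := fun _ => 0) contDiff_const HasCompactSupport.zero (by simp)
  simpa [diverg] using this

lemma IsCalibration.totalVar_eq (hX : IsCalibration F h ε c K R X) (hF : ContDiff ℝ 1 F)
    (hε : 0 < ε) (hR : R < R') :
    totalVar (chi {x | h < F x}) (Metric.ball 0 R') =
      ENNReal.ofReal (∫ x, chi {x | h < F x} x * diverg X x) := by
  have hsub : tsupport X ⊆ Metric.ball 0 R' :=
    hX.support.trans (Metric.closedBall_subset_ball hR)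
  refine le_antisymm (iSup₂_le fun Y hY => ?_) ?_
  · rw [setIntegral_mul_diverg measurableSet_ball hY.2.2.1]
    exact ENNReal.ofReal_le_ofReal (hX.le_flux hF hε hY.1 hY.2.1 hY.2.2.2)
  · rw [← setIntegral_mul_diverg measurableSet_ball hsub]
    exact le_iSup₂ (f := fun (Y : Plane → Plane) (_ : ContDiff ℝ 1 Y ∧ HasCompactSupport Y ∧
      tsupport Y ⊆ Metric.ball 0 R' ∧ ∀ x, ‖Y x‖ ≤ 1) =>
      ENNReal.ofReal (∫ x in Metric.ball 0 R', chi {x | h < F x} x * diverg Y x)) X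
      ⟨hX.contDiff, hX.hasCompactSupport, hsub, hX.norm_le⟩

lemma IsCalibration.isBV (hX : IsCalibration F h ε c K R X) (hF : ContDiff ℝ 1 F)
    (hε : 0 < ε) (hR : R < R') : IsBV (chi {x | h < F x}) (Metric.ball 0 R') := by
  refine ⟨?_, ?_⟩
  · exact Measure.integrableOn_of_bounded (M := 1) measure_ball_lt_top.ne
      (measurable_const.indicator (measurableSet_superlevel hF.continuous)).aestronglyMeasurable
      (Eventually.of_forall fun x => abs_chi_le _ x)
  · rw [hX.totalVar_eq hF hε hR]
    exact ENNReal.ofReal_lt_top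

lemma integrableOn_abs_chi_sub {S S' : Set Plane} (hS : MeasurableSet S) (hS' : MeasurableSet S')
    (r : ℝ) : IntegrableOn (fun x => |chi S x - chi S' x|) (Metric.ball 0 r) := by
  refine Measure.integrableOn_of_bounded (M := 2) measure_ball_lt_top.ne
    ((measurable_const.indicator hS).sub (measurable_const.indicator hS')).abs.aestronglyMeasurable
    (Eventually.of_forall fun x => ?_)
  rw [Real.norm_eq_abs, abs_abs]
  have := abs_sub (chi S x) (chi S' x)
  linarith [abs_chi_le S x, abs_chi_le S' x]

/-- X attains the perimeter of {h < F} and is a competitor for that of {h < F'}. The difference is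
therefore at most the integral of the difference of the indicators against div X. -/
lemma IsCalibration.totalVar_sub_le (hX : IsCalibration F h ε c K R X) (hF : ContDiff ℝ 1 F)
    (hX' : IsCalibration F' h ε c K R X') (hF' : ContDiff ℝ 1 F') (hε : 0 < ε) (hR : R < R') :
    (totalVar (chi {x | h < F x}) (Metric.ball 0 R')).toReal -
        (totalVar (chi {x | h < F' x}) (Metric.ball 0 R')).toReal ≤
      K * distL1 (Metric.ball 0 R') (chi {x | h < F x}) (chi {x | h < F' x}) := by
  have hS := measurableSet_superlevel (h := h) hF.continuous
  have hS' := measurableSet_superlevel (h := h) hF'.continuous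
  have hsub : tsupport X ⊆ Metric.ball 0 R' :=
    hX.support.trans (Metric.closedBall_subset_ball hR)
  rw [hX.totalVar_eq hF hε hR, hX'.totalVar_eq hF' hε hR,
    ENNReal.toReal_ofReal (hX.flux_nonneg hF hε), ENNReal.toReal_ofReal (hX'.flux_nonneg hF' hε)]
  have h1 := hX'.le_flux hF' hε hX.contDiff hX.hasCompactSupport hX.norm_le
  have hi1 := integrable_chi_mul_diverg hS hX.contDiff hX.hasCompactSupport
  have hi2 := integrable_chi_mul_diverg hS' hX.contDiff hX.hasCompactSupport
  have h2 : (∫ x, chi {x | h < F x} x * diverg X x) - ∫ x, chi {x | h < F' x} x * diverg X x ≤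
      K * distL1 (Metric.ball 0 R') (chi {x | h < F x}) (chi {x | h < F' x}) := by
    rw [← setIntegral_mul_diverg measurableSet_ball hsub,
      ← setIntegral_mul_diverg measurableSet_ball hsub,
      ← integral_sub hi1.integrableOn hi2.integrableOn, distL1, ← integral_const_mul]
    refine setIntegral_mono (hi1.integrableOn.sub hi2.integrableOn)
      ((integrableOn_abs_chi_sub hS hS' R').const_mul K) fun x => ?_
    simp only []
    rw [← sub_mul, mul_comm]
    refine (le_abs_self _).trans ?_
    rw [abs_mul]
    exact mul_le_mul_of_nonneg_right (hX.diverg_le x) (abs_nonneg _)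
  linarith

/-- Thin layers about the level set have small area. -/
lemma IsCalibration.volume_layer_le (hX : IsCalibration F h ε c K R X) (hF : ContDiff ℝ 1 F)
    (hc : 0 < c) {η : ℝ} (hη : 0 < η) (hηε : η ≤ ε)
    (hR : ∀ x, h - ε ≤ F x → ‖x‖ ≤ R) :
    volume.real {x | |F x - h| ≤ η} ≤
      Real.pi * K * volume.real (Metric.closedBall (0 : Plane) R) / c * η := by
  set V := volume.real (Metric.closedBall (0 : Plane) R) with hV
  have hS : MeasurableSet {x | |F x - h| ≤ η} :=
    (isClosed_le ((hF.continuous.sub continuous_const).abs) continuous_const).measurableSet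
  have hSsub : {x | |F x - h| ≤ η} ⊆ Metric.closedBall (0 : Plane) R := by
    intro x hx
    have := _root_.abs_le.1 (show |F x - h| ≤ η from hx)
    rw [mem_closedBall_zero_iff]
    exact hR x (by linarith)
  have hSfin : volume {x | |F x - h| ≤ η} ≠ ⊤ :=
    ((measure_mono hSsub).trans_lt measure_closedBall_lt_top).ne
  -- A function of size O(η) whose derivative is at least 1/2 on the layer. Integrating by parts
  -- against X gives (c/2)·area on one side and at most η(π/2)KV on the other.
  set H : ℝ → ℝ := fun s => η * Real.arctan ((s - h) / η) with hH
  have hHs : ContDiff ℝ 1 H :=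
    contDiff_const.mul (Real.contDiff_arctan.comp ((contDiff_id.sub contDiff_const).div_const _))
  have hHd : ∀ s, HasDerivAt H (1 + ((s - h) / η) ^ 2)⁻¹ s := by
    intro s
    have h1 := (((((hasDerivAt_id s).sub_const h).div_const η).arctan).const_mul η)
    refine h1.congr_deriv ?_
    simp only [id]
    field_simp
  have hHb : ∀ s, |H s| ≤ η * (Real.pi / 2) := by
    intro s
    rw [hH, abs_mul, abs_of_pos hη]
    refine mul_le_mul_of_nonneg_left ?_ hη.le
    rw [_root_.abs_le]
    exact ⟨(Real.neg_pi_div_two_lt_arctan _).le, (Real.arctan_lt_pi_div_two _).le⟩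
  have hder : ∀ x, fderiv ℝ (H ∘ F) x (X x) =
      (1 + ((F x - h) / η) ^ 2)⁻¹ * fderiv ℝ F x (X x) := by
    intro x
    have hd := (hHd (F x)).comp_hasFDerivAt x ((hF.differentiable (by norm_num)) x).hasFDerivAt
    rw [hd.fderiv]
    rfl
  have hparts := integral_mul_diverg (hHs.comp hF) hX.contDiff hX.hasCompactSupport
  have hF1 := hF.continuous_fderiv (by norm_num)
  have hint : Integrable fun x => -fderiv ℝ (H ∘ F) x (X x) := by
    have h1 := (hHs.comp hF).continuous_fderiv (by norm_num)
    have h2 := hX.contDiff.continuous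
    refine Continuous.integrable_of_hasCompactSupport (by fun_prop)
      (hX.hasCompactSupport.mono fun x hx h0 => hx ?_)
    simp [show X x = 0 from h0]
  have hlow : c / 2 * volume.real {x | |F x - h| ≤ η} ≤ -∫ x, fderiv ℝ (H ∘ F) x (X x) := by
    rw [← integral_neg]
    have hnn : 0 ≤ᵐ[volume] fun x => -fderiv ℝ (H ∘ F) x (X x) :=
      Eventually.of_forall fun x => by
        simp only [hder]
        rw [Pi.zero_apply, ← mul_neg]
        exact mul_nonneg (by positivity) (neg_nonneg.2 (hX.descent x))
    refine le_trans ?_ (setIntegral_le_integral (s := {x | |F x - h| ≤ η}) hint hnn)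
    rw [mul_comm, ← smul_eq_mul, ← setIntegral_const]
    refine setIntegral_mono_on (integrableOn_const hSfin) hint.integrableOn hS fun x hx => ?_
    have hx' : |F x - h| ≤ η := hx
    rw [hder, ← mul_neg]
    have h1 : (2 : ℝ)⁻¹ ≤ (1 + ((F x - h) / η) ^ 2)⁻¹ := by
      apply inv_anti₀ (by positivity)
      have h2 : |(F x - h) / η| ≤ 1 := by
        rw [abs_div, abs_of_pos hη, div_le_one hη]; exact hx'
      have := sq_le_sq' (_root_.abs_le.1 h2).1 (_root_.abs_le.1 h2).2
      linarith
    have h2 := hX.descent_le x (hx'.trans hηε)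
    calc c / 2 = 2⁻¹ * c := by ring
      _ ≤ (1 + ((F x - h) / η) ^ 2)⁻¹ * -fderiv ℝ F x (X x) := by
        gcongr
        linarith
  have hup : ∫ x, (H ∘ F) x * diverg X x ≤ η * (Real.pi / 2) * K * V := by
    rw [← setIntegral_mul_diverg measurableSet_closedBall hX.support]
    refine (le_abs_self _).trans ?_
    rw [← Real.norm_eq_abs]
    refine norm_setIntegral_le_of_norm_le_const (C := η * (Real.pi / 2) * K)
      measure_closedBall_lt_top fun x _ => ?_
    rw [norm_mul]
    exact mul_le_mul (hHb _) (hX.diverg_le x) (abs_nonneg _) (by positivity)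
  rw [hparts] at hup
  have h3 := hlow.trans hup
  rw [div_mul_eq_mul_div, le_div_iff₀ hc]
  linarith

/-- The indicators differ only where h separates the values of F and F', which forces F to be within
η of h. -/
lemma distL1_superlevel_le (hF : Continuous F) (hF' : Continuous F') {η r : ℝ}
    (hη : ∀ x, |F x - F' x| ≤ η) (hfin : volume {x | |F x - h| ≤ η} ≠ ⊤) :
    distL1 (Metric.ball 0 r) (chi {x | h < F x}) (chi {x | h < F' x}) ≤
      volume.real {x | |F x - h| ≤ η} := by
  have hS : MeasurableSet {x | |F x - h| ≤ η} :=
    (isClosed_le ((hF.sub continuous_const).abs) continuous_const).measurableSet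
  have hi : Integrable (chi {x | |F x - h| ≤ η}) :=
    (integrable_indicator_iff hS).2 (integrableOn_const hfin)
  have h1 : ∫ x, chi {x | |F x - h| ≤ η} x = volume.real {x | |F x - h| ≤ η} := by
    simp only [chi]
    rw [integral_indicator hS, setIntegral_const, smul_eq_mul, mul_one]
  rw [distL1, ← h1]
  refine le_trans (setIntegral_mono (integrableOn_abs_chi_sub (measurableSet_superlevel hF)
    (measurableSet_superlevel hF') r) hi.integrableOn fun x => ?_)
    (setIntegral_le_integral hi (Eventually.of_forall fun x => chi_nonneg _ x))
  have hx := _root_.abs_le.1 (hη x)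
  by_cases a1 : h < F x <;> by_cases a2 : h < F' x
  · simp [chi, a1, a2, indicator_nonneg]
  · have : |F x - h| ≤ η := by rw [_root_.abs_le]; constructor <;> linarith
    simp [chi, a1, a2, this]
  · have : |F x - h| ≤ η := by rw [_root_.abs_le]; constructor <;> linarith
    simp [chi, a1, a2, this]
  · simp [chi, a1, a2]
    exact indicator_nonneg (fun _ _ => zero_le_one) _

end Perimeter

/-- Superlevel sets depend continuously on the function, in the sense of strict convergence. -/
lemma exists_strict_modulus {h ε c C Λ ρ R R' : ℝ} (hε : 0 < ε) (hc : 0 < c) (hC : 0 ≤ C)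
    (hΛ : 0 ≤ Λ) (hρ : 0 < ρ) (hRR : R < R') {ε' : ℝ} (hε' : 0 < ε') : ∃ η : ℝ, 0 < η ∧
      ∀ F F' : Plane → ℝ, HasSlope F h ε c C Λ ρ → HasSlope F' h ε c C Λ ρ →
        (∀ x, h - ε ≤ F x → ‖x‖ ≤ R) → (∀ x, h - ε ≤ F' x → ‖x‖ ≤ R) →
        (∀ x, |F x - F' x| ≤ η) →
        distStrict (Metric.ball 0 R') (chi {x | h < F x}) (chi {x | h < F' x}) < ε' := by
  obtain ⟨K, hK, hcal⟩ := exists_calibration (h := h) hε hc hC hΛ hρ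
  set A := Real.pi * K * volume.real (Metric.closedBall (0 : Plane) R) / c with hA
  have hA0 : 0 ≤ A := by positivity
  -- The field calibrates only the layer of half-width ε/2; the second term makes (1 + K)Aη < ε',
  -- which covers the L¹ distance and K times it for the perimeters.
  refine ⟨min (ε / 2) (ε' / (2 * (1 + K) * (A + 1))), by positivity,
    fun F F' hF hF' hR hR' hclose => ?_⟩
  set η := min (ε / 2) (ε' / (2 * (1 + K) * (A + 1))) with hη
  have hη0 : 0 < η := by positivity
  obtain ⟨X, hX⟩ := hcal F R hF hR
  obtain ⟨X', hX'⟩ := hcal F' R hF' hR'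
  have hF1 : ContDiff ℝ 1 F := hF.contDiff.of_le (by norm_num)
  have hF1' : ContDiff ℝ 1 F' := hF'.contDiff.of_le (by norm_num)
  have hlay := hX.volume_layer_le hF1 hc hη0 (min_le_left _ _)
    (fun x hx => hR x (by linarith))
  rw [← hA] at hlay
  have hfin : volume {x | |F x - h| ≤ η} ≠ ⊤ := by
    refine ((measure_mono (t := Metric.closedBall (0 : Plane) R) fun x hx => ?_).trans_lt
      measure_closedBall_lt_top).ne
    have h1 := _root_.abs_le.1 (show |F x - h| ≤ η from hx)
    have h2 : η ≤ ε / 2 := min_le_left _ _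
    rw [mem_closedBall_zero_iff]
    exact hR x (by linarith)
  have hd := (distL1_superlevel_le (h := h) (r := R') hF1.continuous hF1'.continuous hclose
    hfin).trans hlay
  have t1 := hX.totalVar_sub_le hF1 hX' hF1' (half_pos hε) hRR
  have t2 := hX'.totalVar_sub_le hF1' hX hF1 (half_pos hε) hRR
  have hsymm : distL1 (Metric.ball 0 R') (chi {x | h < F' x}) (chi {x | h < F x}) =
      distL1 (Metric.ball 0 R') (chi {x | h < F x}) (chi {x | h < F' x}) := by
    simp only [distL1, abs_sub_comm]
  rw [hsymm] at t2
  set d := distL1 (Metric.ball 0 R') (chi {x | h < F x}) (chi {x | h < F' x}) with hdd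
  have hsum : distStrict (Metric.ball 0 R') (chi {x | h < F x}) (chi {x | h < F' x}) ≤
      d + K * d := by
    rw [distStrict]
    refine add_le_add le_rfl ?_
    rw [_root_.abs_le]
    constructor <;> linarith
  refine hsum.trans_lt ?_
  have h3 : η * (2 * (1 + K) * (A + 1)) ≤ ε' := by
    rw [← le_div_iff₀ (by positivity)]; exact min_le_right _ _
  have h4 : (1 + K) * d ≤ (1 + K) * (A * η) := mul_le_mul_of_nonneg_left hd (by positivity)
  have h5 : 0 < (1 + K) * η := by positivity
  have h6 : 0 ≤ (1 + K) * η * A := by positivity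
  nlinarith

/-! ### The transition layer of the blurred domain -/

section Blur

variable {L δ₁ δ₂ m₁ δ R₀ hTil a₁ : ℝ} {D : Set Plane} {x : Plane}

lemma IsLipschitzDomain.isCompact_frontier {r : ℝ} (hD : IsLipschitzDomain r L D) :
    IsCompact (frontier D) :=
  hD.1.isCompact_closure.of_isClosed_subset isClosed_frontier frontier_subset_closure

lemma IsBlurConst.exists_near_frontier (hg : IsGeomConst L δ₁ δ₂ m₁) (hδ : 0 ≤ δ)
    (hb : IsBlurConst L δ₁ m₁ δ R₀ hTil a₁) (hD : IsLipschitzDomain R₀ L D)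
    (h1 : hTil < gaussBlur D x) (h2 : gaussBlur D x < 1 - hTil) :
    ∃ z ∈ frontier D, dist x z ≤ m₁ * δ * R₀ := by
  have hnn : 0 ≤ m₁ * δ * R₀ :=
    mul_nonneg (mul_nonneg hg.m₁_pos.le hδ) (zero_le_one.trans hb.one_le_R₀)
  have hx := hb.layer D x hD h1 h2
  rw [hD.isCompact_frontier.cthickening_eq_biUnion_closedBall hnn] at hx
  simpa using hx

/-- A point of the transition layer is within m₁δR₀ of a boundary point z. As z is the origin of its
own chart, it lies on the graph piece, and the third strip inclusion with d = δ places the point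
where the slope is known. -/
lemma IsBlurConst.exists_slope (hg : IsGeomConst L δ₁ δ₂ m₁) (hδ : δ = δ₂ / 4)
    (hb : IsBlurConst L δ₁ m₁ δ R₀ hTil a₁) (hD : IsLipschitzDomain R₀ L D)
    (h1 : hTil < gaussBlur D x) (h2 : gaussBlur D x < 1 - hTil) :
    ∃ e : Plane ≃ₗᵢ[ℝ] Plane,
      a₁ ≤ fderiv ℝ (gaussBlur D) x (-(e.symm (EuclideanSpace.single 1 1))) := by
  have hδ₂ := hg.δ₂_pos
  have hR₀ : 0 < R₀ := zero_lt_one.trans_le hb.one_le_R₀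
  obtain ⟨z, hz, hxz⟩ := hb.exists_near_frontier hg (by linarith) hD h1 h2
  obtain ⟨e, φ, hφ, hch⟩ := hD.2.2 z hz
  have hstrip := (hg.strips R₀ D z e φ δ hR₀ hD hz hφ hch (by linarith) (by linarith)).2.2.1
  refine ⟨e, hb.slope D z e φ x hD hz hφ hch (hstrip ?_)⟩
  refine Metric.mem_cthickening_of_dist_le x z _ _ ⟨?_, ?_⟩ hxz
  · have := hg.δ₁_pos
    rw [sub_self, map_zero, PiLp.zero_apply, abs_zero]
    positivity
  · rw [sub_self, map_zero, PiLp.zero_apply, PiLp.zero_apply, hch.1]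

lemma gaussBlur_nonneg (D : Set Plane) (x : Plane) : 0 ≤ gaussBlur D x :=
  integral_nonneg fun y => mul_nonneg (chi_nonneg D y) (gauss_pos _).le

/-- Reflect in x: of y and 2x - y at most one lies in a ball about 0 of radius at most |x|, so `D`
catches at most half of the Gaussian mass. -/
lemma gaussBlur_le_half {ρ : ℝ} (hDo : IsOpen D) (hD : D ⊆ Metric.ball 0 ρ) (hx : ρ ≤ ‖x‖) :
    gaussBlur D x ≤ 1 / 2 := by
  obtain ⟨B, hB⟩ := isKernel_gauss.bounded
  have hw := isWeight_chi hDo (Metric.isBounded_ball.subset hD)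
  have hi : Integrable fun y => chi D y * gauss (x - y) :=
    integrable_weight_smul hw.integrable continuous_gauss (fun x => (hB x).1) x
  have hswap : ∫ y, chi D ((x + x) - y) * gauss (x - y) = gaussBlur D x := by
    rw [gaussBlur, ← integral_sub_left_eq_self (fun y => chi D y * gauss (x - y)) volume (x + x)]
    refine integral_congr_ae (Eventually.of_forall fun y => ?_)
    have : gauss (x - (x + x - y)) = gauss (x - y) := by
      rw [show x - (x + x - y) = -(x - y) by abel]
      simp only [gauss, norm_neg]
    simp only [this]
  have hi2 : Integrable fun y => chi D ((x + x) - y) * gauss (x - y) := by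
    refine (hi.comp_sub_left (x + x)).congr (Eventually.of_forall fun y => ?_)
    have : gauss (x - (x + x - y)) = gauss (x - y) := by
      rw [show x - (x + x - y) = -(x - y) by abel]
      simp only [gauss, norm_neg]
    simp only [this]
  have hg : Integrable fun y => gauss (x - y) := isKernel_gauss.integrable.comp_sub_left x
  have hle : ∀ y, chi D y * gauss (x - y) + chi D ((x + x) - y) * gauss (x - y) ≤
      gauss (x - y) := by
    intro y
    rw [← add_mul]
    refine mul_le_of_le_one_left (gauss_pos _).le ?_
    by_cases h1 : y ∈ D
    · have h2 : (x + x) - y ∉ D := by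
        intro h2
        have e1 := mem_ball_zero_iff.1 (hD h1)
        have e2 := mem_ball_zero_iff.1 (hD h2)
        have e3 := norm_add_le y (x + x - y)
        rw [add_sub_cancel, ← two_smul ℝ x, norm_smul, Real.norm_ofNat] at e3
        rw [← two_smul ℝ x] at e2
        linarith
      simp [chi, h1, h2]
    · simpa [chi, h1] using chi_le_one D (x + x - y)
  have := integral_mono (hi.add hi2) hg hle
  simp only [Pi.add_apply] at this
  rw [integral_add hi hi2, hswap, integral_gauss_sub] at this
  change gaussBlur D x + gaussBlur D x ≤ 1 at this
  linarith

/-- Away from the boundary the layer condition leaves both extremes open; the bound 1/2 rules out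
the value near 1. -/
lemma IsBlurConst.gaussBlur_le_of_far (hg : IsGeomConst L δ₁ δ₂ m₁) (hδ : 0 ≤ δ)
    (hb : IsBlurConst L δ₁ m₁ δ R₀ hTil a₁) (hD : IsLipschitzDomain R₀ L D) {ρ : ℝ}
    (hDρ : D ⊆ Metric.ball 0 ρ) (hx : ρ + m₁ * δ * R₀ < ‖x‖) : gaussBlur D x ≤ hTil := by
  have hnn : 0 ≤ m₁ * δ * R₀ :=
    mul_nonneg (mul_nonneg hg.m₁_pos.le hδ) (zero_le_one.trans hb.one_le_R₀)
  by_contra! hcon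
  have h1 := gaussBlur_le_half hD.2.1 hDρ (x := x) (by linarith)
  have h2 := hb.hTil_le
  obtain ⟨z, hz, hxz⟩ := hb.exists_near_frontier hg hδ hD hcon (by linarith)
  have h3 : z ∈ Metric.closedBall (0 : Plane) ρ :=
    closure_minimal (hDρ.trans Metric.ball_subset_closedBall) Metric.isClosed_closedBall
      (frontier_subset_closure hz)
  rw [mem_closedBall_zero_iff] at h3
  have h4 := norm_le_norm_add_norm_sub' x z
  rw [← dist_eq_norm] at h4
  linarith

lemma norm_fderiv_gaussBlur_sub_le (hDo : IsOpen D) (hDb : Bornology.IsBounded D) (x y : Plane) :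
    ‖fderiv ℝ (gaussBlur D) x - fderiv ℝ (gaussBlur D) y‖ ≤
      (∫ z, ‖fderiv ℝ (fderiv ℝ gauss) z‖) * ‖x - y‖ := by
  obtain ⟨B, hB⟩ := isKernel_gauss.bounded
  have hw := isWeight_chi hDo hDb
  have e : fderiv ℝ (gaussBlur D) = smear (fderiv ℝ gauss) (chi D) :=
    funext fun x => (hasFDerivAt_gaussBlur hDo hDb x).fderiv
  have hd : ∀ x, HasFDerivAt (smear (fderiv ℝ gauss) (chi D))
      (smear (fderiv ℝ (fderiv ℝ gauss)) (chi D) x) x :=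
    hasFDerivAt_smear hw.integrable isKernel_gauss.contDiff_fderiv
      (fun x => (hB x).2.1) (fun x => (hB x).2.2)
  rw [e]
  refine norm_sub_le_of_norm_fderiv_le (fun x => (hd x).differentiableAt) (fun x => ?_) x y
  rw [(hd x).fderiv]
  exact norm_smear_le isKernel_gauss.integrable_fderiv_fderiv hw.abs_le x

end Blur

/-! ### Comparison of the intensity with the squared blur -/

section Comparison

/-- Change the weight first, then the kernel: w ∗ K - w' ∗ K' = (w - w') ∗ K + w' ∗ (K - K'). -/
lemma norm_smear_sub_smear_le {V : Type} [NormedAddCommGroup V] [NormedSpace ℝ V]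
    {K K' : Plane → V} {w w' : Plane → ℝ} {B B' ε δ : ℝ} (hK : Continuous K)
    (hB : ∀ x, ‖K x‖ ≤ B) (hK' : Continuous K') (hB' : ∀ x, ‖K' x‖ ≤ B')
    (hi : Integrable fun x => K x - K' x) (hδ : ∫ x, ‖K x - K' x‖ ≤ δ)
    (hw : IsWeight w) (hw' : IsWeight w') {x : Plane}
    (hε : ‖smear K (fun z => w z - w' z) x‖ ≤ ε) : ‖smear K w x - smear K' w' x‖ ≤ ε + δ := by
  have h1 := smear_sub_weight hw.integrable hw'.integrable hK hB x
  have h2 := smear_sub_kernel hw'.integrable hK hB hK' hB' x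
  have h3 := norm_smear_le hi hw'.abs_le x
  rw [← sub_add_sub_cancel (smear K w x) (smear K w' x) (smear K' w' x), ← h1, ← h2]
  exact (norm_add_le _ _).trans (add_le_add hε (h3.trans hδ))

variable {K : Plane → ℝ} {a : Plane × Plane → ℝ} {w : Plane → ℝ} {ε A₀ A₁ : ℝ}

/-- The square is itself the pair integral with weight w(ξ)w(η), so the difference has a weight of
size ε. -/
lemma abs_pairSmear_sub_sq_le (hK : IsKernel K) (ha : Integrable a) (hw : IsWeight w)
    (hε : 0 ≤ ε) (haw : ∀ z : Plane × Plane, |a z - w z.1 * w z.2| ≤ ε) (h0 : ∫ z, ‖K z‖ ≤ A₀)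
    (x : Plane) : |pairSmear K a x - smear K w x ^ 2| ≤ ε * (A₀ * A₀) := by
  have hi : Integrable fun z : Plane × Plane => w z.1 * w z.2 :=
    hw.integrable.mul_prod hw.integrable
  rw [← pairSmear_prod, ← pairSmear_sub hK ha hi]
  exact abs_pairSmear_le hK hε haw h0 x

lemma norm_fderiv_pairSmear_sub_le (hK : IsKernel K) (ha : Integrable a) (hw : IsWeight w)
    (hε : 0 ≤ ε) (haw : ∀ z : Plane × Plane, |a z - w z.1 * w z.2| ≤ ε) (h0 : ∫ z, ‖K z‖ ≤ A₀)
    (h1 : ∫ z, ‖fderiv ℝ K z‖ ≤ A₁) (x : Plane) :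
    ‖fderiv ℝ (pairSmear K a) x - (2 * smear K w x) • smear (fderiv ℝ K) w x‖ ≤
      ε * (2 * A₀ * A₁) := by
  obtain ⟨B, hB⟩ := hK.bounded
  have hi : Integrable fun z : Plane × Plane => w z.1 * w z.2 :=
    hw.integrable.mul_prod hw.integrable
  have hd1 := hasFDerivAt_smear hw.integrable (hK.contDiff.of_le (by norm_num))
    (fun x => (hB x).1) (fun x => (hB x).2.1) x
  have hd2 : HasFDerivAt (fun x => smear K w x ^ 2)
      ((2 * smear K w x) • smear (fderiv ℝ K) w x) x := by
    refine (hd1.pow 2).congr_fderiv ?_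
    simp
  have hd3 := (hasFDerivAt_pairSmear hK ha x).sub hd2
  have hd4 := hasFDerivAt_pairSmear hK (ha.sub hi) x
  have hfun : pairSmear K (a - fun z => w z.1 * w z.2) =
      fun x => pairSmear K a x - smear K w x ^ 2 := by
    funext y
    rw [← pairSmear_prod, ← pairSmear_sub hK ha hi]
    rfl
  rw [hfun] at hd4
  rw [(hasFDerivAt_pairSmear hK ha x).fderiv, hd3.unique hd4]
  exact norm_integral_pairDeriv_le hK hε haw h0 h1 x

end Comparison

/-! ### Rescaling of functions with a definite slope -/

/-- The ratio c/C is invariant and ρ scales with t, so the chart radius cρ/(8C) is exactly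
proportional to t. -/
lemma HasSlope.comp_inv_smul {F : Plane → ℝ} {h ε c C Λ ρ t : ℝ} (hF : HasSlope F h ε c C Λ ρ)
    (ht : 0 < t) : HasSlope (fun x => F (t⁻¹ • x)) h ε (t⁻¹ * c) (t⁻¹ * C) (t⁻¹ * (t⁻¹ * Λ))
      (t * ρ) := by
  have ht' : 0 < t⁻¹ := inv_pos.2 ht
  have h1 : fderiv ℝ (fun x => F (t⁻¹ • x)) = fun x => t⁻¹ • fderiv ℝ F (t⁻¹ • x) :=
    funext fun x => fderiv_comp_smul ..
  have h2 : ∀ x, fderiv ℝ (fun x => t⁻¹ • fderiv ℝ F (t⁻¹ • x)) x =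
      t⁻¹ • t⁻¹ • fderiv ℝ (fderiv ℝ F) (t⁻¹ • x) := by
    intro x
    have h3 : DifferentiableAt ℝ (fun x => fderiv ℝ F (t⁻¹ • x)) x :=
      (hF.differentiable_fderiv _).comp x (by fun_prop)
    rw [fderiv_fun_const_smul h3, fderiv_comp_smul]
  refine ⟨hF.contDiff.comp (contDiff_const_smul _), fun x => ?_, fun x => ?_, fun x hx => ?_⟩
  · rw [h1, norm_smul, Real.norm_of_nonneg ht'.le]
    exact mul_le_mul_of_nonneg_left (hF.grad_le _) ht'.le
  · rw [h1, h2, norm_smul, norm_smul, Real.norm_of_nonneg ht'.le]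
    have := hF.hess_le (t⁻¹ • x)
    gcongr
  · obtain ⟨e, he⟩ := hF.slope _ hx
    refine ⟨e, fun y hy => ?_⟩
    rw [h1]
    refine mul_le_mul_of_nonneg_left (he _ ?_) ht'.le
    rw [Metric.mem_ball, dist_smul₀, Real.norm_of_nonneg ht'.le, inv_mul_lt_iff₀ ht]
    exact hy

/-! ### Functions close to the square of a blur -/

section NearSquare

variable {L δ₁ δ₂ m₁ δ R₀ hTil a₁ : ℝ} {D : Set Plane}

/-- `F` is close to the square of a function `f` that is close in `C¹` to the blur of `D`. -/
structure IsNearSquare (a₁ A C Λ : ℝ) (D : Set Plane) (F f : Plane → ℝ) : Prop where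
  contDiff : ContDiff ℝ 2 F
  grad_le : ∀ x, ‖fderiv ℝ F x‖ ≤ C
  hess_le : ∀ x, ‖fderiv ℝ (fderiv ℝ F) x‖ ≤ Λ
  differentiable : Differentiable ℝ f
  grad_le' : ∀ x, ‖fderiv ℝ f x‖ ≤ A
  close_sq : ∀ x, |F x - f x ^ 2| ≤ 1 / 1000
  grad_close_sq : ∀ x, ‖fderiv ℝ F x - (2 * f x) • fderiv ℝ f x‖ ≤ a₁ / 10
  close : ∀ x, |f x - gaussBlur D x| ≤ 1 / 24 + 1 / 1000
  grad_close : ∀ x, ‖fderiv ℝ f x - fderiv ℝ (gaussBlur D) x‖ ≤ 5 / 8 * a₁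

variable {A C Λ h : ℝ} {F f : Plane → ℝ}

/-- The blur is nonnegative, so f is nearly so. This selects the positive root of f² ≈ F and gives
11/20 ≤ f ≤ 5/6, well inside the transition range even after the error 1/24 + 1/1000. -/
lemma IsNearSquare.bounds (hF : IsNearSquare a₁ A C Λ D F f)
    (hh1 : 1 / 3 ≤ h) (hh2 : h ≤ 2 / 3) {x : Plane} (hx : |F x - h| ≤ 1 / 100) :
    11 / 20 ≤ f x ∧ 1 / 24 < gaussBlur D x ∧ gaussBlur D x < 1 - 1 / 24 := by
  have e1 := _root_.abs_le.1 hx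
  have e2 := _root_.abs_le.1 (hF.close_sq x)
  have e3 := _root_.abs_le.1 (hF.close x)
  have e4 := gaussBlur_nonneg D x
  have e5 : 11 / 20 ≤ f x := by nlinarith
  have e6 : f x ≤ 5 / 6 := by nlinarith
  exact ⟨e5, by linarith, by linarith⟩

lemma IsNearSquare.hasSlope (hF : IsNearSquare a₁ A C Λ D F f) (hg : IsGeomConst L δ₁ δ₂ m₁)
    (hδ : δ = δ₂ / 4) (hb : IsBlurConst L δ₁ m₁ δ R₀ hTil a₁) (hD : IsLipschitzDomain R₀ L D)
    {ρ : ℝ} (hρ : (∫ z, ‖fderiv ℝ (fderiv ℝ gauss) z‖) * ρ ≤ a₁ / 8) (hρA : A * ρ ≤ 1 / 10)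
    (hh1 : 1 / 3 ≤ h) (hh2 : h ≤ 2 / 3) : HasSlope F h (1 / 100) (a₁ / 8) C Λ ρ := by
  refine ⟨hF.contDiff, hF.grad_le, hF.hess_le, fun x hx => ?_⟩
  obtain ⟨e1, e2, e3⟩ := hF.bounds hh1 hh2 hx
  have hT := hb.hTil_le
  have ha := hb.a₁_pos
  obtain ⟨e, he⟩ := hb.exists_slope hg hδ hD (x := x) (by linarith) (by linarith)
  refine ⟨e, fun y hy => ?_⟩
  set n : Plane := -(e.symm (EuclideanSpace.single 1 1)) with hn
  have hn1 : ‖n‖ = 1 := by rw [hn, norm_neg, LinearIsometryEquiv.norm_map]; simp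
  have hlow : ∀ l : Plane →L[ℝ] ℝ, -‖l‖ ≤ l n := fun l => by
    have := l.le_opNorm n
    rw [hn1, mul_one] at this
    exact (_root_.abs_le.1 this).1
  have hxy : ‖y - x‖ ≤ ρ := by rw [← dist_eq_norm]; exact (Metric.mem_ball.1 hy).le
  have g1 := hlow (fderiv ℝ (gaussBlur D) y - fderiv ℝ (gaussBlur D) x)
  have g2 := norm_fderiv_gaussBlur_sub_le hD.2.1 hD.1 y x
  have hB : 0 ≤ ∫ z, ‖fderiv ℝ (fderiv ℝ gauss) z‖ := integral_nonneg fun _ => norm_nonneg _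
  have g3 := mul_le_mul_of_nonneg_left hxy hB
  have g4 := hlow (fderiv ℝ f y - fderiv ℝ (gaussBlur D) y)
  have g5 := hF.grad_close y
  have g6 := hlow (fderiv ℝ F y - (2 * f y) • fderiv ℝ f y)
  have g7 := hF.grad_close_sq y
  have g8 := norm_sub_le_of_norm_fderiv_le hF.differentiable hF.grad_le' y x
  have hA : 0 ≤ A := (norm_nonneg _).trans (hF.grad_le' 0)
  have g9 := mul_le_mul_of_nonneg_left hxy hA
  rw [Real.norm_eq_abs] at g8
  have g10 := (_root_.abs_le.1 g8).1
  simp only [sub_apply, smul_apply, smul_eq_mul] at g1 g4 g6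
  -- From `x` to `y`, f loses at most 1/10 of 11/20. The slope a₁ of the blur loses a₁/8 by the
  -- displacement and 5a₁/8 in passing to f. Then 2·(9/20)·(a₁/4) - a₁/10 = a₁/8.
  have k1 : 9 / 20 ≤ f y := by linarith
  have k2 : a₁ / 4 ≤ fderiv ℝ f y n := by linarith
  have k3 : 9 / 20 * (a₁ / 4) ≤ f y * fderiv ℝ f y n :=
    mul_le_mul k1 k2 (by positivity) (by linarith)
  linarith

/-- Far out the blur is at most 1/24, so |f| < 1/10 and F is far below h - 1/100. -/
lemma IsNearSquare.norm_le (hF : IsNearSquare a₁ A C Λ D F f) (hg : IsGeomConst L δ₁ δ₂ m₁)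
    (hδ : 0 ≤ δ) (hb : IsBlurConst L δ₁ m₁ δ R₀ hTil a₁) (hD : IsLipschitzDomain R₀ L D)
    {ρ : ℝ} (hDρ : D ⊆ Metric.ball 0 ρ) (hh1 : 1 / 3 ≤ h) {x : Plane} (hx : h - 1 / 100 ≤ F x) :
    ‖x‖ ≤ ρ + m₁ * δ * R₀ := by
  by_contra! hcon
  have e1 := hb.gaussBlur_le_of_far hg hδ hD hDρ hcon
  have e2 := _root_.abs_le.1 (hF.close_sq x)
  have e3 := _root_.abs_le.1 (hF.close x)
  have e4 := gaussBlur_nonneg D x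
  have hT := hb.hTil_le
  nlinarith

end NearSquare

/-! ### The intensity of a mask near the Lipschitz class -/

section Intensity

variable {δTil hTil a₁ s₀ : ℝ} {THat T : Plane → ℝ}

/-- The error budget: 1/24 and a₁/2 are spent on T - G, 1/1000 and a₁/8 on replacing the mask by the
domain, and ε on replacing J by 1. -/
lemma IsPointSpread.isNearSquare (hT : IsPointSpread δTil s₀ THat T) (hδT : δTil ≤ 1 / 24)
    (hδT' : δTil ≤ a₁ / 2) {D : Set Plane} (hDo : IsOpen D) (hDb : Bornology.IsBounded D)
    {w : Plane → ℝ} (hw : IsWeight w) {a : Plane × Plane → ℝ} (ha : Integrable a)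
    (ha2 : ∀ z, |a z| ≤ 2) {A₁ A₂ ε : ℝ} (hA₁ : ∫ x, ‖fderiv ℝ T x‖ ≤ A₁)
    (hA₂ : ∫ x, ‖fderiv ℝ (fderiv ℝ T) x‖ ≤ A₂) (hε : 0 ≤ ε) (hε1 : ε ≤ 1 / 4000)
    (hε2 : ε * (4 * A₁) ≤ a₁ / 10) (haw : ∀ z : Plane × Plane, |a z - w z.1 * w z.2| ≤ ε)
    (h0 : ∀ x, ‖smear T (fun z => w z - chi D z) x‖ ≤ min (1 / 1000) (a₁ / 8))
    (h1 : ∀ x, ‖smear (fderiv ℝ T) (fun z => w z - chi D z) x‖ ≤ min (1 / 1000) (a₁ / 8)) :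
    IsNearSquare a₁ A₁ (8 * A₁) (2 * (4 * A₂ + 2 * A₁ * A₁)) D (pairSmear T a) (smear T w) := by
  have hK := hT.isKernel
  have hG := isKernel_gauss
  obtain ⟨B, hB⟩ := hK.bounded
  obtain ⟨B', hB'⟩ := hG.bounded
  obtain ⟨b0, b1, b2, -, -⟩ := hT.norm_bounds
  have hA₀ : ∫ x, ‖T x‖ ≤ 2 := by linarith
  have hχ := isWeight_chi hDo hDb
  have hfd := hasFDerivAt_smear hw.integrable (hK.contDiff.of_le (by norm_num))
    (fun x => (hB x).1) (fun x => (hB x).2.1)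
  have hf1 : ∀ x, fderiv ℝ (smear T w) x = smear (fderiv ℝ T) w x := fun x => (hfd x).fderiv
  rw [hK.fderiv_sub hG] at b1
  refine ⟨contDiff_pairSmear hK ha, fun x => ?_, fun x => ?_, fun x => (hfd x).differentiableAt,
    fun x => ?_, fun x => ?_, fun x => ?_, fun x => ?_, fun x => ?_⟩
  · rw [(hasFDerivAt_pairSmear hK ha x).fderiv]
    refine (norm_integral_pairDeriv_le hK zero_le_two ha2 hA₀ hA₁ x).trans_eq ?_
    ring
  · rw [(fderiv_fderiv_pairSmear hK ha x).fderiv]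
    refine (norm_integral_pairDeriv₂_le hK zero_le_two ha2 hA₀ hA₁ hA₂ x).trans_eq ?_
    ring
  · rw [hf1]
    exact (norm_smear_le hK.integrable_fderiv hw.abs_le x).trans hA₁
  · exact (abs_pairSmear_sub_sq_le hK ha hw hε haw hA₀ x).trans (by linarith)
  · rw [hf1]
    exact (norm_fderiv_pairSmear_sub_le hK ha hw hε haw hA₀ hA₁ x).trans (by linarith)
  · have := norm_smear_sub_smear_le hK.continuous (fun x => (hB x).1) hG.continuous
      (fun x => (hB' x).1) (hK.integrable.sub hG.integrable) b0 hw hχ (h0 x)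
    rw [Real.norm_eq_abs] at this
    rw [gaussBlur_eq_smear]
    linarith [min_le_left (1 / 1000) (a₁ / 8)]
  · have := norm_smear_sub_smear_le hK.continuous_fderiv (fun x => (hB x).2.1)
      hG.continuous_fderiv (fun x => (hB' x).2.1)
      (hK.integrable_fderiv.sub hG.integrable_fderiv) b1 hw hχ (h1 x)
    rw [hf1, (hasFDerivAt_gaussBlur hDo hDb x).fderiv]
    linarith [min_le_right (1 / 1000) (a₁ / 8)]

end Intensity

/-! ### Rescaled masks -/

section Masks

variable {u u' : Plane → ℝ} {R t : ℝ}

lemma isWeight_comp_smul (ht : 0 < t) (hm : Measurable u) (h0 : ∀ x, 0 ≤ u x) (h1 : ∀ x, u x ≤ 1)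
    (hs : ∀ x ∉ Metric.ball (0 : Plane) R, u x = 0) :
    IsWeight (fun x => u (t • x)) ∧ ∀ x ∉ Metric.ball (0 : Plane) (R / t), u (t • x) = 0 := by
  have key : ∀ x ∉ Metric.ball (0 : Plane) (R / t), u (t • x) = 0 := by
    intro x hx
    refine hs _ fun h => hx ?_
    rw [mem_ball_zero_iff, norm_smul, Real.norm_of_nonneg ht.le] at h
    rw [mem_ball_zero_iff, lt_div_iff₀ ht]
    linarith
  refine ⟨⟨hm.comp (measurable_const_smul t), fun x => ?_, R / t, key⟩, key⟩
  rw [abs_of_nonneg (h0 _)]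
  exact h1 _

lemma integral_abs_sub_comp_smul (ht : 0 < t) {f g f' g' : Plane → ℝ} (hf : f =ᵐ[volume] f')
    (hg : g =ᵐ[volume] g') (hf' : ∀ x ∉ Metric.ball (0 : Plane) R, f' x = 0)
    (hg' : ∀ x ∉ Metric.ball (0 : Plane) R, g' x = 0) :
    ∫ x, |f' (t • x) - g' (t • x)| = (t ^ 2)⁻¹ * distL1 (Metric.ball 0 R) f g := by
  have h1 : distL1 (Metric.ball 0 R) f g = ∫ x, |f' x - g' x| := by
    rw [← setIntegral_eq_integral_of_forall_compl_eq_zero (s := Metric.ball (0 : Plane) R)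
      fun x hx => by rw [hf' x hx, hg' x hx, sub_self, abs_zero]]
    refine integral_congr_ae (ae_restrict_of_ae ?_)
    filter_upwards [hf, hg] with x h1 h2
    rw [h1, h2]
  rw [h1, integral_eq_smul_scale ht fun x => |f' x - g' x|, inv_mul_cancel_left₀ (by positivity)]

lemma mul_norm_smul_sub_le {κ ε : ℝ} (ht : 0 < t) (hκ0 : 0 ≤ κ) (hκ : κ * (2 * R) ≤ ε)
    {ξ η : Plane} (hξ : ξ ∈ Metric.ball (0 : Plane) (R / t))
    (hη : η ∈ Metric.ball (0 : Plane) (R / t)) : κ * ‖t • (ξ - η)‖ ≤ ε := by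
  rw [mem_ball_zero_iff, lt_div_iff₀ ht] at hξ hη
  refine le_trans (mul_le_mul_of_nonneg_left ?_ hκ0) hκ
  rw [norm_smul, Real.norm_of_nonneg ht.le]
  have := mul_le_mul_of_nonneg_left (norm_sub_le ξ η) ht.le
  linarith

end Masks

/-- For small coherence parameters and masks close to a domain, the intensity is a rescaled
function that is close to the square of the blur of the rescaled domain. -/
lemma exists_near_square_regime {a₁ M R t : ℝ} (ha : 0 < a₁) (hR : 0 < R) (ht : 0 < t) :
    ∃ σ₀ γ₀ Λ : ℝ, 0 < σ₀ ∧ σ₀ ≤ 1 ∧ σ₀ * (2 * R) ≤ 1 ∧ 0 < γ₀ ∧ 0 ≤ Λ ∧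
      ∀ (δTil s₀ : ℝ) (THat T : Plane → ℝ), δTil ≤ 1 / 24 → δTil ≤ a₁ / 2 →
        IsPointSpread δTil s₀ THat T → normD2 (fun x => T x - gauss x) = M →
      ∀ s σ : ℝ, 0 < s → s * s₀ = t → 0 < σ → σ ≤ σ₀ * s →
      ∀ u ∈ unitMasks R, ∀ D : Set Plane, IsOpen D → D ⊆ Metric.ball 0 R →
        distL1 (Metric.ball 0 R) u (chi D) ≤ γ₀ →
        ∃ F f : Plane → ℝ, IsNearSquare a₁ ((∫ x, ‖fderiv ℝ gauss x‖) + 1)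
          (8 * ((∫ x, ‖fderiv ℝ gauss x‖) + 1)) Λ {x | t • x ∈ D} F f ∧
          intensity T s₀ s σ u = fun x => F (t⁻¹ • x) := by
  set A₁ := (∫ x, ‖fderiv ℝ gauss x‖) + 1 with hA₁
  have hB1 : 0 ≤ ∫ x, ‖fderiv ℝ gauss x‖ := integral_nonneg fun _ => norm_nonneg _
  have hB2 : 0 ≤ ∫ x, ‖fderiv ℝ (fderiv ℝ gauss) x‖ := integral_nonneg fun _ => norm_nonneg _
  have hA₁0 : 0 < A₁ := by positivity
  -- `M` is an arbitrary real at this point, so the absolute value keeps `A₂` nonnegative.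
  set A₂ := (∫ x, ‖fderiv ℝ (fderiv ℝ gauss) x‖) + |M| with hA₂
  have hA₂0 : 0 ≤ A₂ := by positivity
  have hmin : 0 < min (1 / 1000) (a₁ / 8) := by positivity
  -- This bound dominates the L¹ norms of T, ∇T and D²T, so the same `γ` serves for convolution with
  -- T and with ∇T.
  obtain ⟨γ, hγ, hsmall⟩ := exists_smear_small (A := 2 + A₁ + A₂) (by positivity) hmin
  set ε := min (1 / 4000) (a₁ / (40 * A₁)) with hε
  have hε0 : 0 < ε := by positivity
  have hε1 : ε ≤ 1 / 4000 := min_le_left _ _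
  have hε2 : ε * (4 * A₁) ≤ a₁ / 10 := by
    have := (le_div_iff₀ (by positivity)).1 (min_le_right (1 / 4000) (a₁ / (40 * A₁)))
    rw [← hε] at this
    linarith
  have hσR : min 1 (ε / (2 * R)) * (2 * R) ≤ ε := (le_div_iff₀ (by positivity)).1 (min_le_right _ _)
  -- Points of the mask are at most 2R apart, so the argument of the Bessel quotient stays below ε;
  -- the factor t² undoes the dilation of the L¹ distance.
  refine ⟨min 1 (ε / (2 * R)), t ^ 2 * γ, 2 * (4 * A₂ + 2 * A₁ * A₁), by positivity,
    min_le_left _ _, hσR.trans (by linarith), by positivity, by positivity, ?_⟩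
  intro δTil s₀ THat T hδ hδ' hT hM s σ hs hst hσ hσ₀ u hu D hDo hD hdist
  obtain ⟨u', huu, hum, hu0, hu1, hus⟩ := exists_clean_mask hu
  obtain ⟨hw, hws⟩ := isWeight_comp_smul ht hum hu0 hu1 hus
  have hK := hT.isKernel
  obtain ⟨-, -, b0, b1, b2⟩ := hT.norm_bounds
  rw [hM] at b2
  have hDo' : IsOpen {x | t • x ∈ D} := hDo.preimage (continuous_const_smul t)
  have hDb' : {x | t • x ∈ D} ⊆ Metric.ball (0 : Plane) (R / t) := fun x hx => by
    have := hD hx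
    rw [mem_ball_zero_iff, norm_smul, Real.norm_of_nonneg ht.le] at this
    rw [mem_ball_zero_iff, lt_div_iff₀ ht]
    linarith
  have hχ := isWeight_chi hDo' (Metric.isBounded_ball.subset hDb')
  have hκ : 0 < σ / s := by positivity
  have hκ' : σ / s ≤ min 1 (ε / (2 * R)) := (div_le_iff₀ hs).2 hσ₀
  have hb : ∀ ξ ∈ Metric.ball (0 : Plane) (R / t), ∀ η ∈ Metric.ball (0 : Plane) (R / t),
      |mutualIntensity s σ (t • (ξ - η)) - 1| ≤ ε := fun ξ hξ η hη =>
    abs_mutualIntensity_sub_one_le hκ (by linarith) (mul_norm_smul_sub_le ht hκ.le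
      ((mul_le_mul_of_nonneg_right hκ' (by positivity)).trans hσR) hξ hη)
  set a := pairWeight (fun z => mutualIntensity s σ (t • z)) fun x => u' (t • x) with haa
  have hai : Integrable a := integrable_pairWeight
    ((measurable_mutualIntensity s σ).comp (measurable_const_smul t)) hw hws
    fun ξ hξ η hη => (hb ξ hξ η hη).trans (by linarith)
  have haw := abs_pairWeight_sub_le (b := fun z => mutualIntensity s σ (t • z)) hw hws hε0.le hb
  have ha2 : ∀ z, |a z| ≤ 2 := by
    intro z
    have h1 := _root_.abs_le.1 (haw z)
    have h2 := mul_le_one₀ (hu1 (t • z.1)) (hu0 (t • z.2)) (hu1 (t • z.2))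
    have h3 := mul_nonneg (hu0 (t • z.1)) (hu0 (t • z.2))
    rw [haa, _root_.abs_le]
    constructor <;> linarith
  have hd : ∫ x, |u' (t • x) - chi {x | t • x ∈ D} x| ≤ γ := by
    have h1 := integral_abs_sub_comp_smul ht huu (ae_eq_refl (chi D)) hus
      (fun x hx => indicator_of_notMem (fun h => hx (hD h)) _)
    have h2 : (t ^ 2)⁻¹ * distL1 (Metric.ball 0 R) u (chi D) ≤ γ := by
      rw [inv_mul_le_iff₀ (by positivity)]; exact hdist
    exact h1.trans_le h2
  have hsub := hw.of_sub hχ (fun x => hu0 _) (chi_nonneg _)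
  obtain ⟨B, hB⟩ := hK.bounded
  have c0 : ∫ x, ‖T x‖ ≤ 2 + A₁ + A₂ := by linarith
  have c1 : ∫ x, ‖fderiv ℝ T x‖ ≤ A₁ := by linarith
  have c2 : ∫ x, ‖fderiv ℝ (fderiv ℝ T) x‖ ≤ A₂ := by linarith [le_abs_self M]
  refine ⟨pairSmear T a, smear T fun x => u' (t • x), hT.isNearSquare hδ hδ' hDo'
    (Metric.isBounded_ball.subset hDb') hw hai ha2 c1 c2 hε0.le hε1 hε2 haw ?_ ?_, ?_⟩
  · exact hsmall ℝ T B _ (hK.contDiff.of_le (by norm_num)) (fun x => (hB x).1)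
      (fun x => (hB x).2.1) hK.integrable hK.integrable_fderiv c0 (by linarith) hsub hd
  · exact hsmall _ (fderiv ℝ T) B _ hK.contDiff_fderiv (fun x => (hB x).2.1)
      (fun x => (hB x).2.2) hK.integrable_fderiv hK.integrable_fderiv_fderiv (by linarith)
      (by linarith) hsub hd
  · rw [intensity_congr s₀ s σ huu]
    exact funext fun x => intensity_eq_pairSmear hK ht hst hai x

/-! ### Continuity of the intensity in the mask -/

lemma abs_pairWeight_sub_pairWeight_le {b w w' : Plane → ℝ} {ρ : ℝ}
    (hs : ∀ x ∉ Metric.ball (0 : Plane) ρ, w x = 0)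
    (hs' : ∀ x ∉ Metric.ball (0 : Plane) ρ, w' x = 0)
    (hb : ∀ ξ ∈ Metric.ball (0 : Plane) ρ, ∀ η ∈ Metric.ball (0 : Plane) ρ,
      |b (ξ - η) - 1| ≤ 1) (z : Plane × Plane) :
    |pairWeight b w z - pairWeight b w' z| ≤
      2 * (|w z.1| * |w z.2 - w' z.2| + |w z.1 - w' z.1| * |w' z.2|) := by
  by_cases h1 : z.1 ∈ Metric.ball (0 : Plane) ρ
  · by_cases h2 : z.2 ∈ Metric.ball (0 : Plane) ρ
    · have h3 := _root_.abs_le.1 (hb _ h1 _ h2)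
      have e : pairWeight b w z - pairWeight b w' z =
          b (z.1 - z.2) * (w z.1 * (w z.2 - w' z.2) + (w z.1 - w' z.1) * w' z.2) := by
        unfold pairWeight; ring
      rw [e, abs_mul]
      refine mul_le_mul ?_ ?_ (abs_nonneg _) zero_le_two
      · rw [_root_.abs_le]; constructor <;> linarith
      · refine (abs_add_le _ _).trans_eq ?_
        rw [abs_mul, abs_mul]
    · simp [pairWeight, hs _ h2, hs' _ h2]
  · simp [pairWeight, hs _ h1, hs' _ h1]

/-- The intensity is quadratic in a mask of bounded mass, so it is Lipschitz from L¹ to the supremum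
norm. The modulus may depend on T and σ here, since uniformity is needed only in the mask. -/
lemma exists_intensity_modulus {T : Plane → ℝ} (hT : IsKernel T) {R s₀ s σ t : ℝ} (ht : 0 < t)
    (hst : s * s₀ = t) (hκ : 0 < σ / s) (hκR : σ / s * (2 * R) ≤ 1) {ε : ℝ} (hε : 0 < ε) :
    ∃ η : ℝ, 0 < η ∧ ∀ u₁ ∈ unitMasks R, ∀ u₂ ∈ unitMasks R,
      distL1 (Metric.ball 0 R) u₁ u₂ < η →
      ∀ x, |intensity T s₀ s σ u₁ x - intensity T s₀ s σ u₂ x| ≤ ε := by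
  obtain ⟨B, hB0, hB⟩ := exists_pair_bound hT
  set V := volume.real (Metric.ball (0 : Plane) (R / t)) with hV
  have hb : ∀ ξ ∈ Metric.ball (0 : Plane) (R / t), ∀ η ∈ Metric.ball (0 : Plane) (R / t),
      |mutualIntensity s σ (t • (ξ - η)) - 1| ≤ 1 := fun ξ hξ η hη =>
    abs_mutualIntensity_sub_one_le hκ le_rfl (mul_norm_smul_sub_le ht hκ.le hκR hξ hη)
  have hbm : Measurable fun z : Plane => mutualIntensity s σ (t • z) :=
    (measurable_mutualIntensity s σ).comp (measurable_const_smul t)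
  refine ⟨ε * t ^ 2 / (4 * V * B + 1), by positivity, fun u₁ hu₁ u₂ hu₂ hd x => ?_⟩
  obtain ⟨v₁, e₁, m₁, p₁, q₁, z₁⟩ := exists_clean_mask hu₁
  obtain ⟨v₂, e₂, m₂, p₂, q₂, z₂⟩ := exists_clean_mask hu₂
  obtain ⟨w₁, s₁⟩ := isWeight_comp_smul ht m₁ p₁ q₁ z₁
  obtain ⟨w₂, s₂⟩ := isWeight_comp_smul ht m₂ p₂ q₂ z₂
  have i₁ := integrable_pairWeight hbm w₁ s₁ hb
  have i₂ := integrable_pairWeight hbm w₂ s₂ hb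
  rw [intensity_congr s₀ s σ e₁, intensity_congr s₀ s σ e₂,
    intensity_eq_pairSmear hT ht hst i₁, intensity_eq_pairSmear hT ht hst i₂,
    ← pairSmear_sub hT i₁ i₂]
  have hdw := w₁.of_sub w₂ (fun x => p₁ _) fun x => p₂ _
  have hmass : ∀ w : Plane → ℝ, IsWeight w → (∀ x ∉ Metric.ball (0 : Plane) (R / t), w x = 0) →
      ∫ x, |w x| ≤ V := by
    intro w hw hs
    rw [← setIntegral_eq_integral_of_forall_compl_eq_zero (s := Metric.ball (0 : Plane) (R / t))
      fun x hx => by rw [hs x hx, abs_zero]]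
    have := norm_setIntegral_le_of_norm_le_const (μ := volume) (f := fun x => |w x|) (C := 1)
      (measure_ball_lt_top (x := (0 : Plane)) (r := R / t)) fun x _ => by
        rw [Real.norm_eq_abs, abs_abs]; exact hw.abs_le x
    rw [one_mul] at this
    exact (le_abs_self _).trans this
  have j₁ := w₁.integrable.abs.mul_prod hdw.integrable.abs
  have j₂ := hdw.integrable.abs.mul_prod w₂.integrable.abs
  have hI := integral_abs_sub_comp_smul ht e₁ e₂ z₁ z₂
  set I := ∫ x, |v₁ (t • x) - v₂ (t • x)| with hIdef
  have hI0 : 0 ≤ I := integral_nonneg fun _ => abs_nonneg _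
  have hbound : |pairSmear T (fun z => pairWeight (fun z => mutualIntensity s σ (t • z))
      (fun x => v₁ (t • x)) z - pairWeight (fun z => mutualIntensity s σ (t • z))
      (fun x => v₂ (t • x)) z) (t⁻¹ • x)| ≤ 2 * (V * I + I * V) * B := by
    rw [← Real.norm_eq_abs, pairSmear]
    refine (norm_integral_le_of_norm_le (((j₁.add j₂).const_mul 2).mul_const B)
      (Eventually.of_forall fun z => ?_)).trans ?_
    · rw [norm_smul]
      exact mul_le_mul (abs_pairWeight_sub_pairWeight_le
        (b := fun z => mutualIntensity s σ (t • z)) s₁ s₂ hb z) (hB _ _).1 (norm_nonneg _)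
        (mul_nonneg zero_le_two (add_nonneg (by positivity) (by positivity)))
    · rw [integral_mul_const, integral_const_mul]
      simp only [Pi.add_apply]
      rw [integral_add j₁ j₂,
        integral_prod_mul (fun x => |v₁ (t • x)|) fun x => |v₁ (t • x) - v₂ (t • x)|,
        integral_prod_mul (fun x => |v₁ (t • x) - v₂ (t • x)|) fun x => |v₂ (t • x)|]
      have := hmass _ w₁ s₁
      have := hmass _ w₂ s₂
      gcongr
  refine hbound.trans ?_
  have hIη : I * (4 * V * B + 1) ≤ ε := by
    rw [lt_div_iff₀ (by positivity)] at hd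
    rw [hI, mul_assoc, inv_mul_le_iff₀ (by positivity)]
    linarith
  linarith

/-! ### Uniform slope and containment for all admissible masks -/

lemma HolderOneNormLE.mono {α K K' : ℝ} {φ : ℝ → ℝ} (h : HolderOneNormLE α K φ) (hK : K ≤ K') :
    HolderOneNormLE α K' φ := by
  obtain ⟨h1, A, B, C, h2, h3⟩ := h
  exact ⟨h1, A, B, C, h2.trans hK, h3⟩

lemma IsGraphChart.mono {Ω : Set Plane} {r r' : ℝ} {x : Plane} {e : Plane ≃ₗᵢ[ℝ] Plane}
    {φ : ℝ → ℝ} (h : IsGraphChart Ω r x e φ) (hr : r' ≤ r) : IsGraphChart Ω r' x e φ :=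
  ⟨h.1, fun y hy => h.2 y (Metric.ball_subset_ball hr hy)⟩

lemma closure_superlevel_subset {F : Plane → ℝ} {h ε R : ℝ} (hε : 0 ≤ ε)
    (hR : ∀ x, h - ε ≤ F x → ‖x‖ ≤ R) : closure {x | h < F x} ⊆ Metric.closedBall 0 R := by
  refine closure_minimal (fun x hx => ?_) Metric.isClosed_closedBall
  rw [mem_closedBall_zero_iff]
  have : h < F x := hx
  exact hR x (by linarith)

/-- The definite slope of the intensity of masks near the Lipschitz class. -/
lemma exists_slope_regime {L δ₁ δ₂ m₁ δ R₀ hTil a₁ : ℝ} (hg : IsGeomConst L δ₁ δ₂ m₁)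
    (hδ : δ = δ₂ / 4) (hb : IsBlurConst L δ₁ m₁ δ R₀ hTil a₁) :
    ∃ c C ρ : ℝ, 0 < c ∧ 0 < C ∧ 0 < ρ ∧ ∀ R M t : ℝ, 0 < R → 0 < t → t ≤ 1 →
    ∃ σ₀ γ₀ Λ : ℝ, 0 < σ₀ ∧ σ₀ ≤ 1 ∧ σ₀ * (2 * R) ≤ 1 ∧ 0 < γ₀ ∧ 0 ≤ Λ ∧
      ∀ (δTil s₀ : ℝ) (THat T : Plane → ℝ), δTil ≤ min hTil (a₁ / 2) →
        IsPointSpread δTil s₀ THat T → normD2 (fun x => T x - gauss x) = M →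
      ∀ s h σ γ : ℝ, 0 < s → s * s₀ = t → 1 / 3 ≤ h → h ≤ 2 / 3 → 0 < σ → σ ≤ σ₀ * s → γ ≤ γ₀ →
      ∀ u ∈ nearMasks (t * R₀) L R γ,
        HasSlope (intensity T s₀ s σ u) h (1 / 100) (t⁻¹ * c) (t⁻¹ * C) Λ (t * ρ) ∧
        ∀ x, h - 1 / 100 ≤ intensity T s₀ s σ u x → ‖x‖ ≤ R + m₁ * δ * R₀ := by
  have ha := hb.a₁_pos
  have hδ0 : 0 ≤ δ := by have := hg.δ₂_pos; linarith
  have hnn : 0 ≤ m₁ * δ * R₀ :=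
    mul_nonneg (mul_nonneg hg.m₁_pos.le hδ0) (zero_le_one.trans hb.one_le_R₀)
  set A₁ := (∫ x, ‖fderiv ℝ gauss x‖) + 1 with hA₁
  have hA₁0 : 0 < A₁ := add_pos_of_nonneg_of_pos (integral_nonneg fun _ => norm_nonneg _) one_pos
  set B₂ := ∫ x, ‖fderiv ℝ (fderiv ℝ gauss) x‖ with hB₂
  have hB₂0 : 0 ≤ B₂ := integral_nonneg fun _ => norm_nonneg _
  -- The radius uses only a₁ and the Gaussian: the first bound keeps the slope of the blur, the
  -- second keeps f away from zero.
  set ρ := min (a₁ / (8 * (B₂ + 1))) (1 / (10 * A₁)) with hρ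
  have hρ0 : 0 < ρ := by positivity
  have hρ1 : B₂ * ρ ≤ a₁ / 8 := by
    have := (le_div_iff₀ (by positivity)).1 (min_le_left (a₁ / (8 * (B₂ + 1))) (1 / (10 * A₁)))
    rw [← hρ] at this
    nlinarith
  have hρ2 : A₁ * ρ ≤ 1 / 10 := by
    have := (le_div_iff₀ (by positivity)).1 (min_le_right (a₁ / (8 * (B₂ + 1))) (1 / (10 * A₁)))
    rw [← hρ] at this
    linarith
  refine ⟨a₁ / 8, 8 * A₁, ρ, by positivity, by positivity, hρ0, fun R M t hR ht ht1 => ?_⟩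
  obtain ⟨σ₀, γ₀, Λ, hσ₀, hσ₀1, hσ₀R, hγ₀, hΛ, hreg⟩ := exists_near_square_regime (M := M) ha hR ht
  refine ⟨σ₀, γ₀, t⁻¹ * (t⁻¹ * Λ), hσ₀, hσ₀1, hσ₀R, hγ₀, by positivity, ?_⟩
  intro δTil s₀ THat T hδT hT hM s h σ γ hs hst hh1 hh2 hσ hσ1 hγ u hu
  obtain ⟨hu, D, ⟨hD, hDR⟩, hdist⟩ := hu
  have hT1 := hb.hTil_le
  obtain ⟨F, f, hF, hI⟩ := hreg δTil s₀ THat T (by linarith [hδT.trans (min_le_left _ _)])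
    (hδT.trans (min_le_right _ _)) hT hM s σ hs hst hσ hσ1 u hu D hD.2.1 hDR (hdist.trans hγ)
  have hD' := hD.scale ht
  have hDR' : {x | t • x ∈ D} ⊆ Metric.ball (0 : Plane) (R / t) := fun x hx => by
    have := hDR hx
    rw [mem_ball_zero_iff, norm_smul, Real.norm_of_nonneg ht.le] at this
    rw [mem_ball_zero_iff, lt_div_iff₀ ht]
    linarith
  rw [hI]
  refine ⟨(hF.hasSlope hg hδ hb hD' hρ1 hρ2 hh1 hh2).comp_inv_smul ht, fun x hx => ?_⟩
  have h1 := hF.norm_le hg hδ0 hb hD' hDR' hh1 hx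
  rw [norm_smul, norm_inv, Real.norm_of_nonneg ht.le, inv_mul_le_iff₀ ht, mul_add,
    mul_div_cancel₀ _ ht.ne'] at h1
  -- Undoing the dilation turns the margin into t m₁δR₀, which t ≤ 1 bounds by m₁δR₀.
  have h2 := mul_le_of_le_one_left hnn ht1
  linarith

end Litho

theorem theorem4p2 (L : ℝ) (hL : 0 < L) :
    (∃ δ₁ δ₂ m₁ : ℝ, IsGeomConst L δ₁ δ₂ m₁) ∧
    ∀ δ₁ δ₂ m₁ δ : ℝ, IsGeomConst L δ₁ δ₂ m₁ → δ = δ₂ / 4 →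
      (∃ R₀ hTil a₁ : ℝ, IsBlurConst L δ₁ m₁ δ R₀ hTil a₁) ∧
      ∀ R₀ hTil a₁ : ℝ, IsBlurConst L δ₁ m₁ δ R₀ hTil a₁ →
        -- `RTil₀` depends on `L` (and the constants fixed above) only
        ∃ RTil₀ : ℝ, 0 < RTil₀ ∧ RTil₀ ≤ δ₁ * R₀ / 8 ∧
        -- the next constants depend also on `R`, `p`, `M = ‖D²(T - G)‖_{L¹}` and `t = s s₀` only
        ∀ R p M t : ℝ, 10 * R₀ ≤ R → 4 < p → 0 < t → t ≤ 1 →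
        ∃ σTil₀ γ₀ L₁ : ℝ, 0 < σTil₀ ∧ σTil₀ ≤ 1 ∧ 0 < γ₀ ∧ L ≤ L₁ ∧
        ∀ (δTil s₀ : ℝ) (THat T : Plane → ℝ),
          0 < δTil → δTil ≤ min hTil (a₁ / 2) →
          IsPointSpread δTil s₀ THat T → normD2 (fun x => T x - gauss x) = M →
        ∀ s h σ γ : ℝ, 0 < s → s ≤ 1 / s₀ → s * s₀ = t → 1 / 3 ≤ h → h ≤ 2 / 3 →
          0 < σ → σ ≤ σTil₀ * s → 0 < γ → γ ≤ γ₀ →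
        ∀ α r RTil r₁ : ℝ, α = 1 - 4 / p → r = s * s₀ * R₀ → RTil = R + 2 * m₁ * δ * R₀ →
          r₁ = s * s₀ * RTil₀ →
          r₁ ≤ r ∧
          (∀ u ∈ nearMasks r L R γ,
            IsCompact (closure (exposedSet T s₀ s σ h u)) ∧
            closure (exposedSet T s₀ s σ h u) ⊆ Metric.ball 0 RTil ∧
            exposedSet T s₀ s σ h u ∈ HolderOneClass α r₁ L₁ RTil) ∧
          (∀ u ∈ nearMasks r L R γ,
            IsBV (chi (exposedSet T s₀ s σ h u)) (Metric.ball 0 RTil)) ∧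
          ∀ ε : ℝ, 0 < ε → ∃ η : ℝ, 0 < η ∧
            ∀ u₁ ∈ nearMasks r L R γ, ∀ u₂ ∈ nearMasks r L R γ,
              distL1 (Metric.ball 0 R) u₁ u₂ < η →
              distStrict (Metric.ball 0 RTil) (chi (exposedSet T s₀ s σ h u₁))
                (chi (exposedSet T s₀ s σ h u₂)) < ε
  := by
  refine ⟨exists_isGeomConst hL, fun δ₁ δ₂ m₁ δ hg hδ => ⟨?_, fun R₀ hTil a₁ hb => ?_⟩⟩
  · subst hδ
    exact exists_isBlurConst hL hg
  have hR₀ : 0 < R₀ := zero_lt_one.trans_le hb.one_le_R₀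
  have hδ₁ := hg.δ₁_pos
  have hδ₁' := hg.δ₁_le
  have hδ0 : 0 < δ := by have := hg.δ₂_pos; linarith
  have hm := hg.m₁_pos
  have hmδ : 0 < m₁ * δ * R₀ := by positivity
  obtain ⟨c, C, ρ, hc, hC, hρ, hreg⟩ := exists_slope_regime hg hδ hb
  -- The second entry is the chart radius at unit scale; it is fixed before R, p, M and t.
  refine ⟨min (δ₁ * R₀ / 8) (c * ρ / (8 * C)), by positivity, min_le_left _ _, ?_⟩
  intro R p M t hR hp ht ht1
  have hR0 : 0 < R := by linarith
  obtain ⟨σ₀, γ₀, Λ, hσ₀, hσ₀1, hσ₀R, hγ₀, hΛ, hslope⟩ := hreg R M t hR0 ht ht1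
  have hα : 0 < 1 - 4 / p := by
    rw [sub_pos, div_lt_one (by linarith)]
    exact hp
  have hα1 : 1 - 4 / p ≤ 1 := by
    have : 0 < 4 / p := by positivity
    linarith
  have hct : 0 < t⁻¹ * c := by positivity
  have hCt : 0 < t⁻¹ * C := by positivity
  have hρt : 0 < t * ρ := by positivity
  obtain ⟨K, hK⟩ := exists_holder_chart hct hCt hΛ hρt hα hα1
  refine ⟨σ₀, γ₀, max L K, hσ₀, hσ₀1, hγ₀, le_max_left _ _, ?_⟩
  intro δTil s₀ THat T _ hδT hT hM s h σ γ hs _ hst hh1 hh2 hσ hσ1 _ hγ α r RTil r₁ hα' hr hRT hr₁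
  rw [hst] at hr hr₁
  subst hα' hr hRT hr₁
  have hgood := hslope δTil s₀ THat T hδT hT hM s h σ γ hs hst hh1 hh2 hσ hσ1 hγ
  -- The spare m₁δR₀ gives compact containment and room for the supports of the calibrations.
  have hRR : R + m₁ * δ * R₀ < R + 2 * m₁ * δ * R₀ := by linarith
  have hradius : t * min (δ₁ * R₀ / 8) (c * ρ / (8 * C)) ≤
      t⁻¹ * c * (t * ρ) / (8 * (t⁻¹ * C)) := by
    have e : t⁻¹ * c * (t * ρ) / (8 * (t⁻¹ * C)) = t * (c * ρ / (8 * C)) := by field_simp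
    rw [e]
    exact mul_le_mul_of_nonneg_left (min_le_right _ _) ht.le
  refine ⟨?_, fun u hu => ?_, fun u hu => ?_, fun ε hε => ?_⟩
  · refine mul_le_mul_of_nonneg_left ((min_le_left _ _).trans ?_) ht.le
    nlinarith
  · obtain ⟨hF, hout⟩ := hgood u hu
    have hcl := closure_superlevel_subset (by norm_num) hout
    have hcl' := hcl.trans (Metric.closedBall_subset_ball hRR)
    refine ⟨(isCompact_closedBall _ _).of_isClosed_subset isClosed_closure hcl, hcl', ⟨?_, ?_, ?_⟩,
      subset_closure.trans hcl'⟩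
    · exact Metric.isBounded_ball.subset (subset_closure.trans hcl')
    · exact isOpen_lt continuous_const hF.contDiff.continuous
    · intro x hx
      obtain ⟨e, φ, hφ, hch⟩ := hK _ h _ (by norm_num) hF x hx
      exact ⟨e, φ, hφ.mono (le_max_right _ _), hch.mono hradius⟩
  · obtain ⟨hF, hout⟩ := hgood u hu
    obtain ⟨K', -, hcal⟩ := exists_calibration (h := h) (ε := 1 / 100) (by norm_num) hct hCt.le
      hΛ hρt
    obtain ⟨X, hX⟩ := hcal _ _ hF hout
    exact hX.isBV (hF.contDiff.of_le (by norm_num)) (by norm_num) hRR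
  · obtain ⟨η, hη, hmod⟩ := exists_strict_modulus (h := h) (ε := 1 / 100) (by norm_num) hct hCt.le
      hΛ hρt hRR hε
    have hσs : σ / s ≤ σ₀ := (div_le_iff₀ hs).2 hσ1
    obtain ⟨η', hη', hint⟩ := exists_intensity_modulus hT.isKernel ht hst (div_pos hσ hs)
      ((mul_le_mul_of_nonneg_right hσs (by positivity)).trans hσ₀R) hη
    refine ⟨η', hη', fun u₁ hu₁ u₂ hu₂ hd => ?_⟩
    obtain ⟨hF₁, hout₁⟩ := hgood u₁ hu₁
    obtain ⟨hF₂, hout₂⟩ := hgood u₂ hu₂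
    exact hmod _ _ hF₁ hF₂ hout₁ hout₂ (hint u₁ hu₁.1 u₂ hu₂.1 hd)
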